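/- Let $d\ge 1$, let $\lambda$ be a Lévy measure on $\mathbb R$ (so $\lambda(\{0\})=0$) such that $$\int_{\mathbb R}|z|^{1+\varepsilon}\,\lambda(dz)<\infty\ \text{ for some }\varepsilon>0\qquad\text{and}\qquad \int_{[-1,1]}|z\log|z||\,\lambda(dz)<\infty ,$$ let $m\in\mathbb R$ and $m_0=m-\int_{\mathbb R}z\,\lambda(dz)$. Let $\mu$ be a Poisson random measure on $(0,\infty)\times\mathbb R^d\times\mathbb R$ with intensity $dt\,dx\,\lambda(dz)$, and let $\Lambda(dt,dx)=m_0\,dt\,dx+\int_{\mathbb R}z\,\mu(dt,dx,dz)$ be the associated Lévy space-time white noise with mean $m$. Let $g(t,x)=(4\pi t)^{-d/2}e^{-|x|^2/(4t)}\mathbf 1_{t>0}$ be the heat kernel on $\mathbb R^d$, let $$Y(t,x)=\int_0^t\!\int_{\mathbb R^d}g(t-s,x-y)\,\Lambda(ds,dy)=m_0\int_0^t\!\int_{\mathbb R^d}g(t-s,x-y)\,dy\,ds+\int g(t-s,x-y)\,z\,\mathbf 1_{s<t}\,\mu(ds,dy,dz)$$ be the mild solution of the stochastic heat equation $\partial_tY=\Delta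 Y+\dot\Lambda$ on $(0,\infty)\times\mathbb R^d$ with $Y(0,\cdot)=0$, and put $Y_0(t)=Y(t,0)$. Let $f\colon(0,\infty)\to(0,\infty)$ be nondecreasing. Then, almost surely, the integrals defining $Y_0(t)$ converge absolutely for all $t>0$ simultaneously, and the following hold. 1. If $\int_1^\infty \frac{dt}{f(t)}=\infty$ and $\lambda((0,\infty))>0$ (resp. $\lambda((-\infty,0))>0$), then $\limsup_{t\to\infty}\frac{Y_0(t)}{f(t)}=\infty$ (resp. $\liminf_{t\to\infty}\frac{Y_0(t)}{f(t)}=-\infty$) almost surely. 2. If $\int_1^\infty \frac{dt}{f(t)}<\infty$, then $\lim_{t\to\infty}\frac{Y_0(t)}{f(t)}=0$ almost surely. 3. If $\lambda((0,\infty))=0$ (resp. $\lambda((-\infty,0))=0$), then $\limsup_{t\to\infty}\frac{Y_0(t)}{t}=m$ (resp. $\liminf_{t\to\infty}\frac{Y_0(t)}{t}=m$) almost surely. -/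

import Mathlib

open MeasureTheory ProbabilityTheory Filter Topology Set
open scoped ENNReal NNReal

noncomputable section

/-- The space `ℝ^d` with its Euclidean norm. -/
abbrev Space (d : ℕ) : Type := EuclideanSpace ℝ (Fin d)

/-- The heat kernel `g(t,x) = (4πt)^{-d/2} exp(-|x|²/(4t)) 1_{t>0}` on `ℝ^d`. -/
def heatKernel (d : ℕ) (t : ℝ) (x : Space d) : ℝ :=
  if 0 < t then (4 * Real.pi * t) ^ (-(d : ℝ) / 2) * Real.exp (-‖x‖ ^ 2 / (4 * t)) else 0

/-- `lam` is a Lévy measure on `ℝ`. -/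
structure IsLevyMeasure (lam : Measure ℝ) : Prop where
  zero_singleton : lam {0} = 0
  lintegral_min_lt_top : ∫⁻ z, ENNReal.ofReal (min 1 (z ^ 2)) ∂lam < ⊤

/-- Lebesgue measure `dt dx` on `(0,∞) × ℝ^d`, as a measure on `ℝ × ℝ^d`. -/
def spaceTimeVolume (d : ℕ) : Measure (ℝ × Space d) :=
  ((volume : Measure ℝ).restrict (Ioi 0)).prod volume

/-- The measure `dt dx lam(dz)` on `(0,∞) × ℝ^d × ℝ`, as a measure on `ℝ × ℝ^d × ℝ`. -/
def jumpIntensity (d : ℕ) (lam : Measure ℝ) : Measure (ℝ × Space d × ℝ) :=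
  ((volume : Measure ℝ).restrict (Ioi 0)).prod ((volume : Measure (Space d)).prod lam)

/-- `N` is a Poisson random measure on `E` with intensity measure `nu`, under `P`. -/
structure IsPoissonRandomMeasure {Ω E : Type*} [MeasurableSpace Ω] [MeasurableSpace E]
    (P : Measure Ω) (N : Ω → Measure E) (nu : Measure E) : Prop where
  measurable : Measurable N
  /-- `N(A)` is Poisson distributed with parameter `nu(A)` if this is finite. -/
  map_eq : ∀ A : Set E, MeasurableSet A → nu A < ⊤ →
    P.map (fun ω => N ω A)
      = (poissonMeasure (nu A).toNNReal).map (fun n : ℕ => (n : ℝ≥0∞))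
  /-- A Poisson variable with infinite parameter is almost surely infinite. -/
  ae_eq_top : ∀ A : Set E, MeasurableSet A → nu A = ⊤ → ∀ᵐ ω ∂P, N ω A = ⊤
  /-- The values on pairwise disjoint sets are independent. -/
  iIndepFun : ∀ A : ℕ → Set E, (∀ i, MeasurableSet (A i)) →
    Pairwise (fun i j => Disjoint (A i) (A j)) → iIndepFun (fun i ω => N ω (A i)) P

/-- The drift `m₀ = m - ∫ z lam(dz)` of a noise with mean `m` and Lévy measure `lam`. -/
def noiseDrift (m : ℝ) (lam : Measure ℝ) : ℝ := m - ∫ z, z ∂lam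

/-- The integral `∫ h dΛ` of a deterministic function `h` on `(0,∞) × ℝ^d` against the noise
`Λ(dt,dx) = m₀ dt dx + ∫ z N(dt,dx,dz)`, for one realization `N` of the jump measure. -/
def noiseIntegral {d : ℕ} (m₀ : ℝ) (N : Measure (ℝ × Space d × ℝ)) (h : ℝ × Space d → ℝ) : ℝ :=
  m₀ * (∫ q, h q ∂(spaceTimeVolume d)) + ∫ p, h (p.1, p.2.1) * p.2.2 ∂N

/-- Absolute convergence of both terms in `noiseIntegral`. -/
def NoiseIntegrable {d : ℕ} (N : Measure (ℝ × Space d × ℝ)) (h : ℝ × Space d → ℝ) : Prop :=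
  Integrable h (spaceTimeVolume d) ∧ Integrable (fun p => h (p.1, p.2.1) * p.2.2) N

/-- The integrand `(s,y) ↦ g(t-s, x-y)`; it vanishes for `s ≥ t`. -/
def mildKernel {d : ℕ} (t : ℝ) (x : Space d) (q : ℝ × Space d) : ℝ :=
  heatKernel d (t - q.1) (x - q.2)

/-- The mild solution `Y(t,x) = ∫_0^t ∫ g(t-s, x-y) Λ(ds,dy)` of the heat equation with
additive noise `Λ` (mean `m`, Lévy measure `lam`, jump measure `N`) and zero initial condition. -/
def mildSolution {d : ℕ} (m : ℝ) (lam : Measure ℝ) (N : Measure (ℝ × Space d × ℝ))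
    (t : ℝ) (x : Space d) : ℝ :=
  noiseIntegral (noiseDrift m lam) N (mildKernel t x)

end

/-! ### Poisson random measures: counts, moments, Campbell's formula -/

namespace IsPoissonRandomMeasure

variable {Ω E : Type*} [MeasurableSpace Ω] [MeasurableSpace E] {P : Measure Ω}
  {N : Ω → Measure E} {nu : Measure E}

/-! At the origin the solution is a drift plus the sum of `g(t-s,y) z` over the jumps `(s,y,z)`. In
terms of `v = ‖y‖^d`, under which Lebesgue measure becomes a multiple of `dv`, the kernel is at most
`C/v` at every age, at most `C/v²` up to age 2 and at most 1 from age 1 on. So a jump close to the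
origin contributes at its highest about `|z|/v`, and per unit of time such maxima exceed a level `b`
with intensity of order `1/b`. Over `[n,n+1]` the event that a peak exceeds `f n` thus has
probability of order `1/f n`, which leads to the integral test; everything else grows linearly.

Smallness (2). For `t` in `[n,n+1]` the jumps are split into past ones (`s ≤ n-1`) and recent ones,
and each group is bounded by a variable free of `t` (`lintegral_jumpHeat_le_pastSum_add_recentSum`),
which also gives convergence for all `t` at once. By the `1+ε` moment, past jumps with contribution
above `s^β` have finite total intensity, and a Chernoff bound makes the others `O(n)`, which is `o(f
n)` because integrability of `1/f` forces `t = o(f t)`. Among recent jumps, values above `η f n` are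
excluded by Borel–Cantelli; the truncated rest has a mean logarithmic in `f n`, thanks to the `|z
log|z||` condition, and a second Chernoff bound applies.

Peaks (1). A jump larger than `δ` at distance below `1/M` produces a value of order `M^d` about
`M⁻²` later. Space-time cells with `M^d` comparable to `max (f t) t` have infinite total intensity,
so some cell is charged. Observed at a deterministic time attached to the cell, the negative jumps
are independent of the cells and, by Markov, at most of order `t` with probability close to one.
Independence applied to the first charged cell combines both events (`exists_peak_event`).

One-sided law of large numbers (3). Without positive jumps `Y₀(t) = (m+κ)t - Z(t)` with `κ = ∫|z|
dλ`, `Z ≥ 0` and `E Z(t) = κt`. A lower-tail Chernoff bound for truncated jumps gives `liminf Z(t)/t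
≥ κ`; Fatou along the integers then forces equality. The statements with opposite sign follow by
reflecting all jumps. -/

lemma measurable_apply (hN : IsPoissonRandomMeasure P N nu) {A : Set E} (hA : MeasurableSet A) :
    Measurable (fun ω => N ω A) :=
  (Measure.measurable_coe hA).comp hN.measurable

lemma measurable_lintegral (hN : IsPoissonRandomMeasure P N nu) {h : E → ℝ≥0∞}
    (hh : Measurable h) : Measurable (fun ω => ∫⁻ x, h x ∂(N ω)) :=
  (Measure.measurable_lintegral hh).comp hN.measurable

lemma ae_exists_nat (hN : IsPoissonRandomMeasure P N nu) {A : Set E} (hA : MeasurableSet A)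
    (hfin : nu A < ⊤) : ∀ᵐ ω ∂P, ∃ k : ℕ, N ω A = k := by
  have hm : MeasurableSet (range (fun n : ℕ => (n : ℝ≥0∞))) := (countable_range _).measurableSet
  have h1 : ∀ᵐ x ∂(P.map (fun ω => N ω A)), x ∈ range (fun n : ℕ => (n : ℝ≥0∞)) := by
    rw [hN.map_eq A hA hfin]
    exact (ae_map_iff (by fun_prop) hm).2 (ae_of_all _ fun n => ⟨n, rfl⟩)
  filter_upwards [(ae_map_iff (hN.measurable_apply hA).aemeasurable hm).1 h1] with ω ⟨k, hk⟩
  exact ⟨k, hk.symm⟩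

/-- Weighting the Poisson probabilities by `exp (θ n)` replaces the parameter `r` by `r exp θ`, up
to normalisation, so the series is again exponential. Both signs of `θ` are used, one for each tail.
-/
lemma integrable_exp_and_mgf (hN : IsPoissonRandomMeasure P N nu) {A : Set E}
    (hA : MeasurableSet A) (hfin : nu A < ⊤) (θ : ℝ) :
    Integrable (fun ω => Real.exp (θ * (N ω A).toReal)) P ∧
    mgf (fun ω => (N ω A).toReal) P θ = Real.exp ((nu A).toReal * (Real.exp θ - 1)) := by
  set r := (nu A).toNNReal with hr
  have hF : Measurable (fun x : ℝ≥0∞ => Real.exp (θ * x.toReal)) := by fun_prop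
  have key : ∀ n : ℕ, Real.exp (-r) * r ^ n / n.factorial * Real.exp (θ * n)
      = Real.exp (-r) * ((r * Real.exp θ) ^ n / n.factorial) := by
    intro n
    rw [mul_pow, ← Real.exp_nat_mul, mul_comm θ]
    ring
  have hsum : HasSum (fun n : ℕ => Real.exp (-r) * r ^ n / n.factorial * Real.exp (θ * n))
      (Real.exp (-r) * Real.exp (r * Real.exp θ)) := by
    simp_rw [key]
    have := (NormedSpace.expSeries_div_hasSum_exp ((r : ℝ) * Real.exp θ)).mul_left (Real.exp (-r))
    rwa [← Real.exp_eq_exp_ℝ] at this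
  constructor
  · have h1 : Integrable (fun x : ℝ≥0∞ => Real.exp (θ * x.toReal)) (P.map (fun ω => N ω A)) := by
      rw [hN.map_eq A hA hfin, integrable_map_measure hF.aestronglyMeasurable (by fun_prop),
        integrable_poissonMeasure_iff]
      refine hsum.summable.congr fun n => ?_
      simp [hr]
    exact (integrable_map_measure hF.aestronglyMeasurable
      (hN.measurable_apply hA).aemeasurable).1 h1
  · have h2 : mgf (fun ω => (N ω A).toReal) P θ
        = ∫ x, Real.exp (θ * x.toReal) ∂(P.map (fun ω => N ω A)) := by
      rw [integral_map (hN.measurable_apply hA).aemeasurable hF.aestronglyMeasurable]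
      rfl
    rw [h2, hN.map_eq A hA hfin, integral_map (by fun_prop) hF.aestronglyMeasurable,
      integral_poissonMeasure]
    simp only [ENNReal.toReal_natCast, smul_eq_mul]
    rw [hsum.tsum_eq, ← Real.exp_add]
    congr 1
    rw [hr, ENNReal.coe_toNNReal_eq_toReal]
    ring

/-- The mean of a Poisson random measure is its intensity. -/
lemma lintegral_apply (hN : IsPoissonRandomMeasure P N nu) [IsProbabilityMeasure P] {A : Set E}
    (hA : MeasurableSet A) : ∫⁻ ω, N ω A ∂P = nu A := by
  rcases eq_or_lt_of_le (le_top : nu A ≤ ⊤) with htop | hfin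
  · rw [lintegral_congr_ae (hN.ae_eq_top A hA htop), htop]
    simp
  · set r := (nu A).toNNReal with hr
    have h1 : ∫⁻ ω, N ω A ∂P = ∫⁻ x, x ∂(P.map (fun ω => N ω A)) := by
      rw [lintegral_map (f := fun x => x) measurable_id (hN.measurable_apply hA)]
    rw [h1, hN.map_eq A hA hfin, lintegral_map (f := fun x => x) measurable_id (by fun_prop),
      poissonMeasure, lintegral_sum_measure]
    simp only [lintegral_smul_measure, lintegral_dirac, smul_eq_mul]
    rw [← hr]
    have h2 : ∀ n : ℕ, ENNReal.ofReal (Real.exp (-r) * r ^ n / n.factorial) * (n : ℝ≥0∞)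
        = ENNReal.ofReal (Real.exp (-r) * r ^ n / n.factorial * n) := by
      intro n
      rw [ENNReal.ofReal_mul (by positivity), ENNReal.ofReal_natCast]
    simp_rw [h2]
    have hsum : HasSum (fun n : ℕ => Real.exp (-r) * (r : ℝ) ^ n / n.factorial * n) r := by
      -- The term `n = 0` vanishes, and `n r^n / n! = r · r^(n-1) / (n-1)!` turns the remaining
      -- terms into `r` times the Poisson probabilities.
      rw [← hasSum_nat_add_iff' 1]
      simp only [Finset.range_one, Finset.sum_singleton, Nat.cast_zero, mul_zero, sub_zero]
      have := (hasSum_one_poissonMeasure r).mul_left (r : ℝ)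
      rw [mul_one] at this
      refine this.congr_fun ?_
      intro n
      rw [Nat.factorial_succ]
      push_cast
      field_simp
      ring
    rw [← ENNReal.ofReal_tsum_of_nonneg (fun n => by positivity) hsum.summable, hsum.tsum_eq, hr,
      ENNReal.ofReal_coe_nnreal, ENNReal.coe_toNNReal hfin.ne]

lemma bind_eq (hN : IsPoissonRandomMeasure P N nu) [IsProbabilityMeasure P] :
    P.bind N = nu := by
  ext A hA
  rw [Measure.bind_apply hA hN.measurable.aemeasurable, hN.lintegral_apply hA]

/-- Campbell's formula. -/
lemma lintegral_lintegral (hN : IsPoissonRandomMeasure P N nu) [IsProbabilityMeasure P]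
    {h : E → ℝ≥0∞} (hh : Measurable h) : ∫⁻ ω, ∫⁻ x, h x ∂(N ω) ∂P = ∫⁻ x, h x ∂nu := by
  rw [← Measure.lintegral_bind hN.measurable.aemeasurable hh.aemeasurable, hN.bind_eq]

lemma ae_eq_zero (hN : IsPoissonRandomMeasure P N nu) [IsProbabilityMeasure P] {A : Set E}
    (hA : MeasurableSet A) (h0 : nu A = 0) : ∀ᵐ ω ∂P, N ω A = 0 := by
  have := hN.lintegral_apply hA
  rw [h0, lintegral_eq_zero_iff (hN.measurable_apply hA)] at this
  exact this

/-- Markov's inequality at level 1: a nonzero count is at least one. -/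
lemma measure_apply_ne_zero_le (hN : IsPoissonRandomMeasure P N nu) [IsProbabilityMeasure P]
    {A : Set E} (hA : MeasurableSet A) : P {ω | N ω A ≠ 0} ≤ nu A := by
  rcases eq_or_lt_of_le (le_top : nu A ≤ ⊤) with htop | hfin
  · simp [htop]
  · calc P {ω | N ω A ≠ 0} ≤ P {ω | 1 ≤ N ω A} := by
          apply measure_mono_ae
          filter_upwards [hN.ae_exists_nat hA hfin] with ω ⟨k, hk⟩ h0
          have h0' : N ω A ≠ 0 := h0
          change 1 ≤ N ω A
          rw [hk] at h0' ⊢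
          exact_mod_cast Nat.one_le_iff_ne_zero.2 (by exact_mod_cast h0')
      _ ≤ ∫⁻ ω, N ω A ∂P := by
          simpa using mul_meas_ge_le_lintegral (μ := P) (hN.measurable_apply hA) 1
      _ = nu A := hN.lintegral_apply hA

/-- The index set is injected into `ℕ`; unused indices receive the empty set. -/
lemma iIndepFun_countable (hN : IsPoissonRandomMeasure P N nu) {ι : Type*} [Countable ι]
    {A : ι → Set E} (hA : ∀ i, MeasurableSet (A i))
    (hd : Pairwise (fun i j => Disjoint (A i) (A j))) :
    ProbabilityTheory.iIndepFun (fun i ω => N ω (A i)) P := by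
  obtain ⟨e, he⟩ := exists_injective_nat ι
  let B : ℕ → Set E := fun n => ⋃ i, ⋃ (_ : e i = n), A i
  have hBe : ∀ i, B (e i) = A i := by
    intro i
    ext x
    simp only [B, mem_iUnion, exists_prop]
    exact ⟨fun ⟨j, hj, hx⟩ => he hj ▸ hx, fun hx => ⟨i, rfl, hx⟩⟩
  have hB := hN.iIndepFun B
    (fun n => MeasurableSet.iUnion fun i => MeasurableSet.iUnion fun _ => hA i) (by
      intro m n hmn
      rw [Set.disjoint_left]
      intro x hxm hxn
      simp only [B, mem_iUnion, exists_prop] at hxm hxn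
      obtain ⟨i, hi, hxi⟩ := hxm
      obtain ⟨j, hj, hxj⟩ := hxn
      have hij : i ≠ j := fun h => hmn (by rw [← hi, ← hj, h])
      exact Set.disjoint_left.1 (hd hij) hxi hxj)
  have := hB.precomp he
  simpa only [hBe] using this

/-! ### Chernoff bounds for Poisson integrals -/

/-- The moment generating function of the integral of a simple function. -/
lemma mgf_simpleFunc (hN : IsPoissonRandomMeasure P N nu) [IsProbabilityMeasure P]
    (φ : SimpleFunc E ℝ≥0∞) (hφ : ∀ x, φ x < ⊤) (hint : ∫⁻ x, φ x ∂nu < ⊤) (θ : ℝ) :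
    ∃ S : Ω → ℝ, (∀ᵐ ω ∂P, ∫⁻ x, φ x ∂(N ω) = ENNReal.ofReal (S ω)) ∧ (∀ ω, 0 ≤ S ω) ∧
      Integrable (fun ω => Real.exp (θ * S ω)) P ∧
      mgf S P θ = Real.exp (∑ c ∈ φ.range, (nu (φ ⁻¹' {c})).toReal *
        (Real.exp (θ * c.toReal) - 1)) := by
  classical
  have hc : ∀ c ∈ φ.range, c ≠ ⊤ := by
    intro c hc
    obtain ⟨x, rfl⟩ := SimpleFunc.mem_range.1 hc
    exact (hφ x).ne
  have hfin : ∀ c, c ≠ 0 → nu (φ ⁻¹' {c}) < ⊤ := by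
    intro c hc0
    by_cases hcr : c ∈ φ.range
    · rw [SimpleFunc.lintegral_eq_lintegral, SimpleFunc.lintegral] at hint
      have h1 := (ENNReal.sum_lt_top.1 hint) c hcr
      by_contra h
      rw [not_lt_top_iff.1 h, ENNReal.mul_top hc0] at h1
      exact lt_irrefl _ h1
    · rw [SimpleFunc.preimage_eq_empty_iff φ c |>.2 (by simpa using hcr)]
      simp
  let X : φ.range → Ω → ℝ := fun c ω => (c : ℝ≥0∞).toReal * (N ω (φ ⁻¹' {(c : ℝ≥0∞)})).toReal
  have hmeas : ∀ c, Measurable (X c) := fun c =>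
    ((hN.measurable_apply (φ.measurableSet_preimage _)).ennreal_toReal).const_mul _
  have hind : ProbabilityTheory.iIndepFun X P := by
    have h1 := hN.iIndepFun_countable (ι := φ.range) (A := fun c => φ ⁻¹' {(c : ℝ≥0∞)})
      (fun c => φ.measurableSet_preimage _) (by
        intro c c' hcc
        refine Disjoint.preimage φ ?_
        rw [Set.disjoint_singleton]
        exact fun h => hcc (Subtype.ext h))
    exact h1.comp (fun c x => (c : ℝ≥0∞).toReal * x.toReal) (fun c => by fun_prop)
  have hX : ∀ c : φ.range, Integrable (fun ω => Real.exp (θ * X c ω)) P ∧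
      mgf (X c) P θ = Real.exp ((nu (φ ⁻¹' {(c : ℝ≥0∞)})).toReal *
        (Real.exp (θ * (c : ℝ≥0∞).toReal) - 1)) := by
    intro c
    by_cases hc0 : (c : ℝ≥0∞) = 0
    · constructor
      · simp [X, hc0]
      · simp [X, hc0, mgf]
    · have h2 := hN.integrable_exp_and_mgf (φ.measurableSet_preimage {(c : ℝ≥0∞)}) (hfin c hc0)
        (θ * (c : ℝ≥0∞).toReal)
      constructor
      · simpa only [X, mul_assoc] using h2.1
      · rw [← h2.2]
        simp only [X, mgf, mul_assoc]
  refine ⟨∑ c, X c, ?_, fun ω => ?_, ?_, ?_⟩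
  · have h3 : ∀ᵐ ω ∂P, ∀ c : φ.range, (c : ℝ≥0∞) ≠ 0 → N ω (φ ⁻¹' {(c : ℝ≥0∞)}) ≠ ⊤ := by
      rw [ae_all_iff]
      intro c
      by_cases hc0 : (c : ℝ≥0∞) = 0
      · simp [hc0]
      · filter_upwards [hN.ae_exists_nat (φ.measurableSet_preimage {(c : ℝ≥0∞)}) (hfin c hc0)]
          with ω ⟨k, hk⟩ _
        rw [hk]
        exact ENNReal.natCast_ne_top k
    filter_upwards [h3] with ω hω
    rw [SimpleFunc.lintegral_eq_lintegral, SimpleFunc.lintegral, Finset.sum_apply,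
      ENNReal.ofReal_sum_of_nonneg (fun c _ => by positivity), ← Finset.sum_coe_sort φ.range]
    refine Finset.sum_congr rfl fun c _ => ?_
    by_cases hc0 : (c : ℝ≥0∞) = 0
    · simp [X, hc0]
    · simp only [X]
      rw [ENNReal.ofReal_mul ENNReal.toReal_nonneg, ENNReal.ofReal_toReal (hc c c.2),
        ENNReal.ofReal_toReal (hω c hc0)]
  · rw [Finset.sum_apply]
    exact Finset.sum_nonneg fun c _ => by positivity
  · exact hind.integrable_exp_mul_sum hmeas fun c _ => (hX c).1
  · rw [hind.mgf_sum hmeas, Finset.prod_congr rfl fun c _ => (hX c).2, ← Real.exp_sum,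
      Finset.sum_coe_sort φ.range (fun c => (nu (φ ⁻¹' {c})).toReal *
        (Real.exp (θ * c.toReal) - 1))]

lemma toReal_lintegral_simpleFunc (φ : SimpleFunc E ℝ≥0∞) (hint : ∫⁻ x, φ x ∂nu < ⊤) :
    (∫⁻ x, φ x ∂nu).toReal = ∑ c ∈ φ.range, (nu (φ ⁻¹' {c})).toReal * c.toReal := by
  rw [SimpleFunc.lintegral_eq_lintegral, SimpleFunc.lintegral] at hint ⊢
  rw [ENNReal.toReal_sum fun c hc => (ENNReal.sum_lt_top.1 hint c hc).ne]
  exact Finset.sum_congr rfl fun c _ => by rw [ENNReal.toReal_mul, mul_comm]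

/-- Markov's inequality for `exp (θ S)`, linearised by `exp (θu) - 1 ≤ θ exp (θb) u` on `[0,b]`, so
that only the bound `T` on the mean enters. -/
lemma measure_lt_lintegral_simpleFunc_le (hN : IsPoissonRandomMeasure P N nu)
    [IsProbabilityMeasure P] (φ : SimpleFunc E ℝ≥0∞) {b T x θ : ℝ} (hT : 0 ≤ T)
    (hb : ∀ y, φ y ≤ ENNReal.ofReal b) (hint : ∫⁻ y, φ y ∂nu ≤ ENNReal.ofReal T) (hθ : 0 ≤ θ) :
    P {ω | ENNReal.ofReal x < ∫⁻ y, φ y ∂(N ω)}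
      ≤ ENNReal.ofReal (Real.exp (-θ * x + θ * Real.exp (θ * b) * T)) := by
  have hφ : ∀ y, φ y < ⊤ := fun y => (hb y).trans_lt ENNReal.ofReal_lt_top
  have hfin : ∫⁻ y, φ y ∂nu < ⊤ := hint.trans_lt ENNReal.ofReal_lt_top
  obtain ⟨S, hS, hS0, hSi, hSm⟩ := hN.mgf_simpleFunc φ hφ hfin θ
  have h1 := measure_ge_le_exp_mul_mgf x hθ hSi
  have h2 : ∑ c ∈ φ.range, (nu (φ ⁻¹' {c})).toReal * (Real.exp (θ * c.toReal) - 1)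
      ≤ θ * Real.exp (θ * b) * T := by
    have h3 : (∫⁻ y, φ y ∂nu).toReal ≤ T := ENNReal.toReal_le_of_le_ofReal hT hint
    rw [toReal_lintegral_simpleFunc φ hfin] at h3
    calc _ ≤ ∑ c ∈ φ.range, θ * Real.exp (θ * b) * ((nu (φ ⁻¹' {c})).toReal * c.toReal) := by
          refine Finset.sum_le_sum fun c hc => ?_
          obtain ⟨y, rfl⟩ := SimpleFunc.mem_range.1 hc
          rcases le_or_gt 0 b with hb0 | hb0
          · have h5 : (φ y).toReal ≤ b := ENNReal.toReal_le_of_le_ofReal hb0 (hb y)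
            set u := (φ y).toReal
            have hu : 0 ≤ u := ENNReal.toReal_nonneg
            have h6 : Real.exp (θ * u) - 1 ≤ θ * Real.exp (θ * b) * u := by
              have h7 : 1 - θ * u ≤ Real.exp (-(θ * u)) := by
                linarith [Real.add_one_le_exp (-(θ * u))]
              have h8 : Real.exp (θ * u) * (1 - θ * u) ≤ 1 := by
                calc _ ≤ Real.exp (θ * u) * Real.exp (-(θ * u)) := by gcongr
                  _ = 1 := by rw [← Real.exp_add]; simp
              have h9 : Real.exp (θ * u) * (θ * u) ≤ Real.exp (θ * b) * (θ * u) := by gcongr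
              nlinarith
            calc _ ≤ (nu (φ ⁻¹' {φ y})).toReal * (θ * Real.exp (θ * b) * u) := by gcongr
              _ = _ := by ring
          · have : φ y = 0 := by
              have := hb y
              rw [ENNReal.ofReal_of_nonpos hb0.le] at this
              exact le_antisymm this zero_le
            simp [this]
      _ = θ * Real.exp (θ * b) * ∑ c ∈ φ.range, (nu (φ ⁻¹' {c})).toReal * c.toReal := by
          rw [Finset.mul_sum]
      _ ≤ _ := by gcongr
  calc P {ω | ENNReal.ofReal x < ∫⁻ y, φ y ∂(N ω)} ≤ P {ω | x ≤ S ω} := by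
        apply measure_mono_ae
        filter_upwards [hS] with ω hω h
        have h' : ENNReal.ofReal x < ∫⁻ y, φ y ∂(N ω) := h
        rw [hω] at h'
        exact ((ENNReal.ofReal_lt_ofReal_iff'.1 h').1).le
    _ = ENNReal.ofReal (P.real {ω | x ≤ S ω}) := by
        rw [measureReal_def, ENNReal.ofReal_toReal (measure_ne_top _ _)]
    _ ≤ _ := by
        apply ENNReal.ofReal_le_ofReal
        refine h1.trans ?_
        rw [hSm, ← Real.exp_add]
        gcongr

/-- **Chernoff bound** for the upper tail of an integral against a Poisson random measure. -/
lemma measure_lt_lintegral_le (hN : IsPoissonRandomMeasure P N nu)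
    [IsProbabilityMeasure P] {h : E → ℝ≥0∞} (hh : Measurable h) {b T x θ : ℝ} (hT : 0 ≤ T)
    (hb : ∀ y, h y ≤ ENNReal.ofReal b) (hint : ∫⁻ y, h y ∂nu ≤ ENNReal.ofReal T) (hθ : 0 ≤ θ) :
    P {ω | ENNReal.ofReal x < ∫⁻ y, h y ∂(N ω)}
      ≤ ENNReal.ofReal (Real.exp (-θ * x + θ * Real.exp (θ * b) * T)) := by
  have hle : ∀ n y, SimpleFunc.eapprox h n y ≤ h y := fun n y => by
    rw [← SimpleFunc.iSup_eapprox_apply hh y]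
    exact le_iSup (fun n => SimpleFunc.eapprox h n y) n
  -- With a strict inequality the events for the simple approximations increase to the event for
  -- `h`, and continuity from below applies.
  have hset : {ω | ENNReal.ofReal x < ∫⁻ y, h y ∂(N ω)}
      = ⋃ n, {ω | ENNReal.ofReal x < ∫⁻ y, SimpleFunc.eapprox h n y ∂(N ω)} := by
    ext ω
    simp only [mem_ofPred_eq, mem_iUnion]
    rw [lintegral_eq_iSup_eapprox_lintegral hh, lt_iSup_iff]
    simp only [SimpleFunc.lintegral_eq_lintegral]
  have hmono : Monotone fun n =>
      {ω | ENNReal.ofReal x < ∫⁻ y, SimpleFunc.eapprox h n y ∂(N ω)} := by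
    intro m n hmn ω hω
    exact lt_of_lt_of_le hω (lintegral_mono (SimpleFunc.monotone_eapprox h hmn))
  rw [hset, hmono.measure_iUnion]
  refine iSup_le fun n => ?_
  exact hN.measure_lt_lintegral_simpleFunc_le _ hT (fun y => (hle n y).trans (hb y))
    ((lintegral_mono (hle n)).trans hint) hθ

/-- Markov's inequality for `exp (-θ S)`; here `exp (-w) ≤ 1 - w + w²/2` for `w ≥ 0` keeps the
linear term sharp, and `w ≤ θb` turns the quadratic one into a small correction. -/
lemma measure_lintegral_simpleFunc_lt_le (hN : IsPoissonRandomMeasure P N nu)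
    [IsProbabilityMeasure P] (φ : SimpleFunc E ℝ≥0∞) {b x θ : ℝ} (hb0 : 0 ≤ b)
    (hb : ∀ y, φ y ≤ ENNReal.ofReal b) (hint : ∫⁻ y, φ y ∂nu < ⊤) (hθ : 0 ≤ θ) :
    P {ω | ∫⁻ y, φ y ∂(N ω) < ENNReal.ofReal x}
      ≤ ENNReal.ofReal
        (Real.exp (θ * x - θ * (1 - θ * b / 2) * (∫⁻ y, φ y ∂nu).toReal)) := by
  have hφ : ∀ y, φ y < ⊤ := fun y => (hb y).trans_lt ENNReal.ofReal_lt_top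
  obtain ⟨S, hS, hS0, hSi, hSm⟩ := hN.mgf_simpleFunc φ hφ hint (-θ)
  have h1 := measure_le_le_exp_mul_mgf x (neg_nonpos.2 hθ) hSi
  have h2 : ∑ c ∈ φ.range, (nu (φ ⁻¹' {c})).toReal * (Real.exp (-θ * c.toReal) - 1)
      ≤ -(θ * (1 - θ * b / 2) * (∫⁻ y, φ y ∂nu).toReal) := by
    rw [toReal_lintegral_simpleFunc φ hint, Finset.mul_sum, ← Finset.sum_neg_distrib]
    refine Finset.sum_le_sum fun c hc => ?_
    obtain ⟨y, rfl⟩ := SimpleFunc.mem_range.1 hc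
    have h5 : (φ y).toReal ≤ b := ENNReal.toReal_le_of_le_ofReal hb0 (hb y)
    set u := (φ y).toReal
    have hu : 0 ≤ u := ENNReal.toReal_nonneg
    have h6 : Real.exp (-θ * u) - 1 ≤ -(θ * (1 - θ * b / 2) * u) := by
      set w := θ * u with hw
      have hw0 : 0 ≤ w := by positivity
      have h7 := Real.quadratic_le_exp_of_nonneg hw0
      have h8 : Real.exp (-w) ≤ 1 - w + w ^ 2 / 2 := by
        rw [Real.exp_neg, inv_le_iff_one_le_mul₀ (Real.exp_pos _)]
        have h9 : 0 ≤ 1 - w + w ^ 2 / 2 := by nlinarith [sq_nonneg (w - 1)]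
        -- The product equals `1 + w⁴/4`.
        calc (1 : ℝ) ≤ (1 - w + w ^ 2 / 2) * (1 + w + w ^ 2 / 2) := by
              nlinarith [sq_nonneg (w ^ 2)]
          _ ≤ _ := by gcongr
      have h10 : w ^ 2 ≤ θ * b * w := by
        have : θ * u ≤ θ * b := by gcongr
        nlinarith
      rw [neg_mul, ← hw]
      nlinarith
    calc _ ≤ (nu (φ ⁻¹' {φ y})).toReal * (-(θ * (1 - θ * b / 2) * u)) := by gcongr
      _ = _ := by ring
  calc P {ω | ∫⁻ y, φ y ∂(N ω) < ENNReal.ofReal x} ≤ P {ω | S ω ≤ x} := by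
        apply measure_mono_ae
        filter_upwards [hS] with ω hω h
        have h' : ∫⁻ y, φ y ∂(N ω) < ENNReal.ofReal x := h
        rw [hω] at h'
        exact ((ENNReal.ofReal_lt_ofReal_iff'.1 h').1).le
    _ = ENNReal.ofReal (P.real {ω | S ω ≤ x}) := by
        rw [measureReal_def, ENNReal.ofReal_toReal (measure_ne_top _ _)]
    _ ≤ _ := by
        apply ENNReal.ofReal_le_ofReal
        refine h1.trans ?_
        rw [hSm, ← Real.exp_add]
        gcongr
        linarith

/-- **Chernoff bound** for the lower tail of an integral against a Poisson random measure. -/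
lemma measure_lintegral_lt_le (hN : IsPoissonRandomMeasure P N nu)
    [IsProbabilityMeasure P] {h : E → ℝ≥0∞} (hh : Measurable h) {b x θ : ℝ} (hb0 : 0 ≤ b)
    (hb : ∀ y, h y ≤ ENNReal.ofReal b) (hint : ∫⁻ y, h y ∂nu < ⊤) (hθ : 0 ≤ θ) :
    P {ω | ∫⁻ y, h y ∂(N ω) < ENNReal.ofReal x}
      ≤ ENNReal.ofReal
        (Real.exp (θ * x - θ * (1 - θ * b / 2) * (∫⁻ y, h y ∂nu).toReal)) := by
  have hle : ∀ n y, SimpleFunc.eapprox h n y ≤ h y := fun n y => by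
    rw [← SimpleFunc.iSup_eapprox_apply hh y]
    exact le_iSup (fun n => SimpleFunc.eapprox h n y) n
  have hlim : Tendsto (fun n => (∫⁻ y, SimpleFunc.eapprox h n y ∂nu).toReal) atTop
      (𝓝 (∫⁻ y, h y ∂nu).toReal) := by
    refine (ENNReal.tendsto_toReal hint.ne).comp ?_
    rw [lintegral_eq_iSup_eapprox_lintegral hh]
    simp only [SimpleFunc.lintegral_eq_lintegral]
    refine tendsto_atTop_iSup fun m n hmn => ?_
    exact SimpleFunc.lintegral_mono (SimpleFunc.monotone_eapprox h hmn) le_rfl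
  have hlim2 : Tendsto (fun n => ENNReal.ofReal (Real.exp (θ * x - θ * (1 - θ * b / 2) *
      (∫⁻ y, SimpleFunc.eapprox h n y ∂nu).toReal))) atTop
      (𝓝 (ENNReal.ofReal (Real.exp (θ * x - θ * (1 - θ * b / 2) * (∫⁻ y, h y ∂nu).toReal)))) :=
    ENNReal.tendsto_ofReal ((Real.continuous_exp.tendsto _).comp
      (tendsto_const_nhds.sub (hlim.const_mul _)))
  -- The event for `h` lies in the event for every approximation from below, so it suffices to pass
  -- to the limit in the bounds.
  refine ge_of_tendsto' hlim2 fun n => ?_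
  refine (measure_mono ?_).trans (hN.measure_lintegral_simpleFunc_lt_le _ hb0
    (fun y => (hle n y).trans (hb y)) ((lintegral_mono (hle n)).trans_lt hint) hθ)
  intro ω hω
  exact lt_of_le_of_lt (lintegral_mono (hle n)) hω

/-! ### Almost sure finiteness and independence -/

/-- On a set of finite intensity, every finite function is almost surely integrable. -/
lemma ae_setLIntegral_lt_top (hN : IsPoissonRandomMeasure P N nu) [IsProbabilityMeasure P]
    {A : Set E} (hA : MeasurableSet A) (hfin : nu A < ⊤) {h : E → ℝ≥0∞} (hh : Measurable h)
    (hlt : ∀ x, h x < ⊤) : ∀ᵐ ω ∂P, ∫⁻ x in A, h x ∂(N ω) < ⊤ := by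
  let B : ℕ → Set E := fun n => A ∩ {x | (n : ℝ≥0∞) < h x}
  have hB : ∀ n, MeasurableSet (B n) := fun n => hA.inter (measurableSet_lt measurable_const hh)
  have hlim : Tendsto (fun n => nu (B n)) atTop (𝓝 0) := by
    have hempty : ⋂ n, B n = ∅ := by
      ext x
      simp only [mem_iInter, mem_empty_iff_false, iff_false, not_forall]
      obtain ⟨n, hn⟩ := ENNReal.exists_nat_gt (hlt x).ne
      exact ⟨n, fun hx => (lt_asymm hn hx.2).elim⟩
    have := tendsto_measure_iInter_atTop (μ := nu) (s := B) (fun n => (hB n).nullMeasurableSet)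
      (fun m n hmn x hx => ⟨hx.1, lt_of_le_of_lt (Nat.cast_le.2 hmn) (show (n : ℝ≥0∞) < h x from hx.2)⟩)
      ⟨0, ((measure_mono inter_subset_left).trans_lt hfin).ne⟩
    rwa [hempty, measure_empty] at this
  -- `B n` is charged with probability at most `nu (B n)`, which tends to 0; hence almost surely
  -- some `B n` carries no mass, and `h ≤ n` holds `N ω`-almost everywhere on `A`.
  have hex : ∀ᵐ ω ∂P, ∃ n, N ω (B n) = 0 := by
    have h0 : P {ω | ¬ ∃ n, N ω (B n) = 0} = 0 := by
      refine le_antisymm (ge_of_tendsto' hlim fun n => ?_) zero_le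
      refine (measure_mono ?_).trans (hN.measure_apply_ne_zero_le (hB n))
      intro ω hω
      exact fun h => hω ⟨n, h⟩
    exact h0
  filter_upwards [hex, hN.ae_exists_nat hA hfin] with ω ⟨n, hn⟩ ⟨k, hk⟩
  calc ∫⁻ x in A, h x ∂(N ω) ≤ ∫⁻ _ in A, (n : ℝ≥0∞) ∂(N ω) := by
        apply lintegral_mono_ae
        rw [ae_restrict_iff' hA]
        have : ∀ᵐ x ∂(N ω), x ∉ B n := by
          rw [ae_iff]
          simpa using hn
        filter_upwards [this] with x hx hxA
        by_contra hcon
        exact hx ⟨hxA, not_le.1 hcon⟩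
    _ = n * k := by rw [setLIntegral_const, hk]
    _ < ⊤ := ENNReal.mul_lt_top (ENNReal.natCast_lt_top n) (ENNReal.natCast_lt_top k)

lemma ae_lintegral_lt_top (hN : IsPoissonRandomMeasure P N nu) [IsProbabilityMeasure P]
    {h : E → ℝ≥0∞} (hh : Measurable h) (hint : ∫⁻ x, h x ∂nu < ⊤) :
    ∀ᵐ ω ∂P, ∫⁻ x, h x ∂(N ω) < ⊤ := by
  rw [← hN.lintegral_lintegral hh] at hint
  exact ae_lt_top (hN.measurable_lintegral hh) hint.ne

/-- Events that depend on the values of `N` on the sets `A i` are independent of integrals of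
functions vanishing on these sets. -/
lemma measure_inter_lintegral_le (hN : IsPoissonRandomMeasure P N nu) [IsProbabilityMeasure P]
    {A : ℕ → Set E} (hA : ∀ i, MeasurableSet (A i))
    (hd : Pairwise (fun i j => Disjoint (A i) (A j)))
    {h : E → ℝ≥0∞} (hh : Measurable h) (h0 : ∀ i, ∀ x ∈ A i, h x = 0) (a : ℝ≥0∞) {F : Set Ω}
    (hF : MeasurableSet[⨆ i, MeasurableSpace.comap (fun ω => N ω (A i)) inferInstance] F) :
    P (F ∩ {ω | ∫⁻ x, h x ∂(N ω) ≤ a}) = P F * P {ω | ∫⁻ x, h x ∂(N ω) ≤ a} := by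
  classical
  -- With a non-strict inequality the events for the approximations decrease to the event for `h`.
  let G : ℕ → Set Ω := fun n => {ω | ∫⁻ x, SimpleFunc.eapprox h n x ∂(N ω) ≤ a}
  have hGm : ∀ n, MeasurableSet (G n) := fun n =>
    measurableSet_le (hN.measurable_lintegral (SimpleFunc.eapprox h n).measurable)
      measurable_const
  have hG : {ω | ∫⁻ x, h x ∂(N ω) ≤ a} = ⋂ n, G n := by
    ext ω
    simp only [mem_ofPred_eq, mem_iInter, G]
    rw [lintegral_eq_iSup_eapprox_lintegral hh, iSup_le_iff]
    simp only [SimpleFunc.lintegral_eq_lintegral]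
  have hanti : Antitone G := fun m n hmn ω hω =>
    le_trans (lintegral_mono (SimpleFunc.monotone_eapprox h hmn)) hω
  have hFm : MeasurableSet F := by
    have hle : (⨆ i, MeasurableSpace.comap (fun ω => N ω (A i)) inferInstance)
        ≤ (inferInstance : MeasurableSpace Ω) :=
      iSup_le fun i => (hN.measurable_apply (hA i)).comap_le
    exact hle F hF
  have key : ∀ n, P (F ∩ G n) = P F * P (G n) := by
    intro n
    set φ := SimpleFunc.eapprox h n with hφ
    have hφ0 : ∀ i, ∀ x ∈ A i, φ x = 0 := fun i x hx => by
      have : φ x ≤ h x := by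
        rw [← SimpleFunc.iSup_eapprox_apply hh x]
        exact le_iSup (fun n => SimpleFunc.eapprox h n x) n
      rw [h0 i x hx] at this
      exact le_antisymm this zero_le
    -- Only nonzero levels are kept: their level sets miss every `A i`, so together with the `A i`
    -- they form one disjoint family, which is split into two independent blocks.
    let κ := {c : φ.range // (c : ℝ≥0∞) ≠ 0}
    let C : ℕ ⊕ κ → Set E := Sum.elim A fun c => φ ⁻¹' {(c.1 : ℝ≥0∞)}
    have hC : ∀ i, MeasurableSet (C i) := by
      rintro (i | c)
      · exact hA i
      · exact φ.measurableSet_preimage _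
    have hAc : ∀ i (c : κ), Disjoint (A i) (φ ⁻¹' {(c.1 : ℝ≥0∞)}) := fun i c => by
      rw [Set.disjoint_left]
      intro x hx hxc
      exact c.2 (by rw [← show φ x = c.1 from hxc, hφ0 i x hx])
    have hind := hN.iIndepFun_countable hC (by
      rintro (i | c) (j | c') hij
      · exact hd (fun h => hij (by rw [h]))
      · exact hAc i c'
      · exact (hAc j c).symm
      · refine Disjoint.preimage φ ?_
        rw [Set.disjoint_singleton]
        intro h
        exact hij (by rw [Subtype.ext (Subtype.ext h)]))
    have hindep := indep_iSup_of_disjoint (S := range Sum.inl) (T := range Sum.inr)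
      (fun i => (hN.measurable_apply (hC i)).comap_le) hind.iIndep
      (by rw [Set.disjoint_left]; rintro _ ⟨i, rfl⟩ ⟨c, hc⟩; cases hc)
    refine (Indep_iff _ _ P).1 hindep F (G n) ?_ ?_
    · refine (iSup_le (fun i => ?_) : _ ≤ ⨆ i ∈ range Sum.inl,
        MeasurableSpace.comap (fun ω => N ω (C i)) inferInstance) F hF
      exact le_iSup₂_of_le (f := fun i (_ : i ∈ range Sum.inl) =>
        MeasurableSpace.comap (fun ω => N ω (C i)) inferInstance) (Sum.inl i) ⟨i, rfl⟩ le_rfl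
    · have hsum : ∀ ω, ∫⁻ x, φ x ∂(N ω) = ∑ c : κ, (c.1 : ℝ≥0∞) * N ω (C (Sum.inr c)) := by
        intro ω
        rw [SimpleFunc.lintegral_eq_lintegral, SimpleFunc.lintegral,
          ← Finset.sum_coe_sort φ.range]
        symm
        refine Finset.sum_of_injOn (fun c : κ => c.1) (Subtype.val_injective.injOn) (by simp) ?_
          (fun c _ => rfl)
        intro c _ hc
        by_cases hc0 : (c : ℝ≥0∞) = 0
        · rw [hc0, zero_mul]
        · exact absurd ⟨⟨c, hc0⟩, by simp, rfl⟩ hc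
      have hm : Measurable[⨆ i ∈ range Sum.inr,
          MeasurableSpace.comap (fun ω => N ω (C i)) inferInstance]
          (fun ω => ∑ c : κ, (c.1 : ℝ≥0∞) * N ω (C (Sum.inr c))) := by
        refine Finset.measurable_sum _ fun c _ => Measurable.const_mul ?_ _
        rw [measurable_iff_comap_le]
        exact le_iSup₂_of_le (f := fun i (_ : i ∈ range Sum.inr) =>
          MeasurableSpace.comap (fun ω => N ω (C i)) inferInstance) (Sum.inr c) ⟨c, rfl⟩ le_rfl
      have hGn : G n = (fun ω => ∑ c : κ, (c.1 : ℝ≥0∞) * N ω (C (Sum.inr c))) ⁻¹' (Iic a) := by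
        ext ω
        simp only [G, mem_ofPred_eq, mem_preimage, mem_Iic, ← hsum ω, ← hφ]
      rw [hGn]
      exact hm measurableSet_Iic
  have hl1 : Tendsto (fun n => P (F ∩ G n)) atTop (𝓝 (P (⋂ n, F ∩ G n))) :=
    tendsto_measure_iInter_atTop (fun n => (hFm.inter (hGm n)).nullMeasurableSet)
      (fun m n hmn => inter_subset_inter_right _ (hanti hmn)) ⟨0, measure_ne_top _ _⟩
  have hl2 : Tendsto (fun n => P (G n)) atTop (𝓝 (P (⋂ n, G n))) :=
    tendsto_measure_iInter_atTop (fun n => (hGm n).nullMeasurableSet) hanti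
      ⟨0, measure_ne_top _ _⟩
  rw [hG, inter_iInter]
  refine tendsto_nhds_unique hl1 ?_
  simp_rw [key]
  exact ENNReal.Tendsto.const_mul hl2 (Or.inr (measure_ne_top _ _))

/-- If the disjoint sets `A i` have infinite total intensity, then some `A i` is charged while
at the same time an independent event `∫ h i dN ≤ a i` of probability at least `p` occurs, with
probability at least `p`. -/
lemma le_measure_iUnion_hit (hN : IsPoissonRandomMeasure P N nu) [IsProbabilityMeasure P]
    {A : ℕ → Set E} (hA : ∀ i, MeasurableSet (A i))
    (hd : Pairwise (fun i j => Disjoint (A i) (A j))) (htop : nu (⋃ i, A i) = ⊤)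
    {h : ℕ → E → ℝ≥0∞} (hh : ∀ i, Measurable (h i)) (h0 : ∀ j i, ∀ x ∈ A i, h j x = 0)
    {a : ℕ → ℝ≥0∞} {p : ℝ≥0∞} (hp : ∀ i, p ≤ P {ω | ∫⁻ x, h i x ∂(N ω) ≤ a i}) :
    p ≤ P (⋃ i, {ω | N ω (A i) ≠ 0} ∩ {ω | ∫⁻ x, h i x ∂(N ω) ≤ a i}) := by
  let H : ℕ → Set Ω := fun i => {ω | N ω (A i) ≠ 0}
  have hHm' : ∀ i, MeasurableSet[⨆ i, MeasurableSpace.comap (fun ω => N ω (A i)) inferInstance]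
      (H i) := fun i => by
    refine (le_iSup (fun i => MeasurableSpace.comap (fun ω => N ω (A i)) inferInstance) i) _ ?_
    exact ⟨{0}ᶜ, (measurableSet_singleton 0).compl, rfl⟩
  have hDm' : ∀ i, MeasurableSet[⨆ i, MeasurableSpace.comap (fun ω => N ω (A i)) inferInstance]
      (disjointed H i) := fun i => by
    let _ : MeasurableSpace Ω := ⨆ i, MeasurableSpace.comap (fun ω => N ω (A i)) inferInstance
    exact MeasurableSet.disjointed hHm' i
  have hDm : ∀ i, MeasurableSet (disjointed H i) := fun i => by
    have hle : (⨆ i, MeasurableSpace.comap (fun ω => N ω (A i)) inferInstance)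
        ≤ (inferInstance : MeasurableSpace Ω) :=
      iSup_le fun i => (hN.measurable_apply (hA i)).comap_le
    exact hle _ (hDm' i)
  have hGm : ∀ i, MeasurableSet {ω | ∫⁻ x, h i x ∂(N ω) ≤ a i} := fun i =>
    measurableSet_le (hN.measurable_lintegral (hh i)) measurable_const
  have hone : P (⋃ i, H i) = 1 := by
    rw [prob_compl_eq_zero_iff₀ ?_ |>.symm, compl_iUnion]
    · have h1 := hN.ae_eq_top _ (MeasurableSet.iUnion hA) htop
      refine measure_mono_null ?_ (ae_iff.1 h1)
      intro ω hω
      simp only [H, mem_iInter, mem_compl_iff, mem_ofPred_eq, not_not] at hω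
      rw [mem_ofPred_eq, measure_iUnion_null hω]
      simp
    · refine (MeasurableSet.iUnion fun i => ?_).nullMeasurableSet
      exact (hN.measurable_apply (hA i)) (measurableSet_singleton 0).compl
  -- `disjointed H i` says that `A i` is the first set charged. It depends on the counts of the `A
  -- i` alone, so each piece factorises; the pieces partition an almost sure event.
  calc p = p * P (⋃ i, disjointed H i) := by rw [iUnion_disjointed, hone, mul_one]
    _ = ∑' i, p * P (disjointed H i) := by
        rw [measure_iUnion (disjoint_disjointed H) hDm, ENNReal.tsum_mul_left]
    _ ≤ ∑' i, P (disjointed H i ∩ {ω | ∫⁻ x, h i x ∂(N ω) ≤ a i}) := by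
        refine ENNReal.tsum_le_tsum fun i => ?_
        rw [hN.measure_inter_lintegral_le hA hd (hh i) (h0 i) (a i) (hDm' i), mul_comm]
        gcongr
        exact hp i
    _ = P (⋃ i, disjointed H i ∩ {ω | ∫⁻ x, h i x ∂(N ω) ≤ a i}) := by
        rw [measure_iUnion _ fun i => (hDm i).inter (hGm i)]
        intro i j hij
        exact (disjoint_disjointed H hij).mono inter_subset_left inter_subset_left
    _ ≤ _ := by
        refine measure_mono (iUnion_mono fun i => ?_)
        exact inter_subset_inter_left _ (disjointed_subset H i)

lemma ae_one_le_of_ne_zero (hN : IsPoissonRandomMeasure P N nu) {A : Set E}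
    (hA : MeasurableSet A) : ∀ᵐ ω ∂P, N ω A ≠ 0 → 1 ≤ N ω A := by
  rcases eq_or_lt_of_le (le_top : nu A ≤ ⊤) with htop | hfin
  · filter_upwards [hN.ae_eq_top A hA htop] with ω hω _
    simp [hω]
  · filter_upwards [hN.ae_exists_nat hA hfin] with ω ⟨k, hk⟩ h0
    rw [hk] at h0 ⊢
    exact_mod_cast Nat.one_le_iff_ne_zero.2 (by exact_mod_cast h0)

/-- The image of a Poisson random measure under a measurable bijection. -/
lemma map_equiv (hN : IsPoissonRandomMeasure P N nu) {E' : Type*} [MeasurableSpace E']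
    (e : E ≃ᵐ E') : IsPoissonRandomMeasure P (fun ω => (N ω).map e) (nu.map e) where
  measurable := (Measure.measurable_map e e.measurable).comp hN.measurable
  map_eq A hA hfin := by
    simp only [e.map_apply] at hfin ⊢
    exact hN.map_eq _ (e.measurable hA) hfin
  ae_eq_top A hA htop := by
    simp only [e.map_apply] at htop ⊢
    exact hN.ae_eq_top _ (e.measurable hA) htop
  iIndepFun A hA hd := by
    simp only [e.map_apply]
    exact hN.iIndepFun _ (fun i => e.measurable (hA i)) fun i j hij => (hd hij).preimage e


end IsPoissonRandomMeasure

/-! ### Pointwise bounds for the heat kernel and the substitution `v = ‖x‖^d` -/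

section HeatKernel

variable {d : ℕ}

lemma heatKernel_nonneg (t : ℝ) (x : Space d) : 0 ≤ heatKernel d t x := by
  unfold heatKernel
  split_ifs <;> positivity

lemma heatKernel_of_nonpos {t : ℝ} (ht : t ≤ 0) (x : Space d) : heatKernel d t x = 0 :=
  if_neg (not_lt.2 ht)

lemma heatKernel_neg (t : ℝ) (x : Space d) : heatKernel d t (-x) = heatKernel d t x := by
  simp [heatKernel]

lemma mildKernel_zero (t : ℝ) (q : ℝ × Space d) :
    mildKernel t 0 q = heatKernel d (t - q.1) q.2 := by
  rw [mildKernel, zero_sub, heatKernel_neg]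

@[fun_prop]
lemma measurable_heatKernel : Measurable (fun q : ℝ × Space d => heatKernel d q.1 q.2) := by
  unfold heatKernel
  refine Measurable.ite (measurableSet_lt measurable_const measurable_fst) ?_ measurable_const
  fun_prop

lemma lintegral_heatKernel {t : ℝ} (ht : 0 < t) :
    ∫⁻ x : Space d, ENNReal.ofReal (heatKernel d t x) = 1 := by
  have hb : 0 < 1 / (4 * t) := by positivity
  have h1 := GaussianFourier.integral_rexp_neg_mul_sq_norm (V := Space d) hb
  have h2 : ∀ x : Space d, heatKernel d t x
      = (4 * Real.pi * t) ^ (-(d : ℝ) / 2) * Real.exp (-(1 / (4 * t)) * ‖x‖ ^ 2) := by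
    intro x
    rw [heatKernel, if_pos ht]
    congr 2
    ring
  have h3 : Real.pi / (1 / (4 * t)) = 4 * Real.pi * t := by field_simp
  have hpos : 0 < (4 * Real.pi * t) ^ ((d : ℝ) / 2) := by positivity
  -- Otherwise the Bochner integral would be the default 0, against the positive value in `h1`.
  have hint : Integrable (fun x : Space d => Real.exp (-(1 / (4 * t)) * ‖x‖ ^ 2)) := by
    by_contra h
    rw [integral_undef h, h3, finrank_euclideanSpace, Fintype.card_fin] at h1
    exact hpos.ne h1
  rw [← ofReal_integral_eq_lintegral_ofReal]
  · simp_rw [h2]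
    rw [integral_const_mul, h1, h3, finrank_euclideanSpace, Fintype.card_fin, neg_div,
      Real.rpow_neg (by positivity), inv_mul_cancel₀ hpos.ne', ENNReal.ofReal_one]
  · rw [funext h2]
    exact hint.const_mul _
  · exact ae_of_all _ fun x => heatKernel_nonneg t x

/-- A constant in pointwise bounds of the heat kernel. -/
noncomputable def heatBound (d : ℕ) : ℝ := √((2 * d).factorial)

lemma one_le_heatBound : 1 ≤ heatBound d := by
  rw [heatBound, Real.one_le_sqrt]
  exact_mod_cast Nat.factorial_pos _

/-- Squaring removes the exponent `d/2`, so that the bounds below deal with natural powers only. -/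
lemma sq_heatKernel {t : ℝ} (ht : 0 < t) (x : Space d) :
    heatKernel d t x ^ 2 = ((4 * Real.pi * t) ^ d)⁻¹ * Real.exp (-(‖x‖ ^ 2 / (2 * t))) := by
  rw [heatKernel, if_pos ht, mul_pow, ← Real.rpow_natCast, ← Real.rpow_mul (by positivity),
    ← Real.exp_nat_mul]
  congr 1
  · rw [show -(d : ℝ) / 2 * (2 : ℕ) = -(d : ℝ) by push_cast; ring, Real.rpow_neg (by positivity),
      Real.rpow_natCast]
  · congr 1
    push_cast
    field_simp
    ring

/-- After squaring, all powers of `t` cancel and `u^d exp (-u) ≤ d!` remains, with `u = ‖x‖²/(2t)`.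
The bound is uniform in `t` and so controls the whole history of a jump. -/
lemma heatKernel_mul_pow_le (t : ℝ) (x : Space d) :
    heatKernel d t x * ‖x‖ ^ d ≤ heatBound d := by
  rcases le_or_gt t 0 with ht | ht
  · rw [heatKernel_of_nonpos ht, zero_mul]
    exact zero_le_one.trans one_le_heatBound
  apply Real.le_sqrt_of_sq_le
  rw [mul_pow, sq_heatKernel ht]
  set u := ‖x‖ ^ 2 / (2 * t) with hu
  have hu0 : 0 ≤ u := by positivity
  have h1 : (‖x‖ ^ d) ^ 2 = (2 * t) ^ d * u ^ d := by
    rw [← mul_pow, hu, mul_div_cancel₀ _ (by positivity), ← pow_mul, ← pow_mul, mul_comm]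
  have h2 : u ^ d ≤ d.factorial * Real.exp u := by
    have := Real.pow_div_factorial_le_exp (x := u) hu0 d
    rwa [div_le_iff₀' (by positivity)] at this
  have h3 : (2 * t) ^ d ≤ (4 * Real.pi * t) ^ d := by
    gcongr
    nlinarith [Real.pi_gt_three]
  rw [h1, Real.exp_neg]
  have h4 : (d.factorial : ℝ) ≤ (2 * d).factorial := by
    exact_mod_cast Nat.factorial_le (by omega)
  calc _ ≤ ((4 * Real.pi * t) ^ d)⁻¹ * (Real.exp u)⁻¹ *
        ((4 * Real.pi * t) ^ d * (d.factorial * Real.exp u)) := by gcongr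
    _ = d.factorial := by field_simp
    _ ≤ _ := h4

/-- The same argument with `u^(2d)` leaves a factor `t^d`, harmless for bounded `t`. The additional
decay makes the bound integrable far from the origin. -/
lemma heatKernel_mul_pow_sq_le {t : ℝ} (ht2 : t ≤ 2) (x : Space d) :
    heatKernel d t x * (‖x‖ ^ d) ^ 2 ≤ heatBound d := by
  rcases le_or_gt t 0 with ht | ht
  · rw [heatKernel_of_nonpos ht, zero_mul]
    exact zero_le_one.trans one_le_heatBound
  apply Real.le_sqrt_of_sq_le
  rw [mul_pow, sq_heatKernel ht]
  set u := ‖x‖ ^ 2 / (2 * t) with hu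
  have hu0 : 0 ≤ u := by positivity
  have h1 : ((‖x‖ ^ d) ^ 2) ^ 2 = (2 * t) ^ d * (2 * t) ^ d * u ^ (2 * d) := by
    have : ‖x‖ ^ 2 = 2 * t * u := by rw [hu, mul_div_cancel₀ _ (by positivity)]
    calc _ = (‖x‖ ^ 2) ^ (2 * d) := by rw [← pow_mul, ← pow_mul, ← pow_mul]; congr 1; ring
      _ = _ := by rw [this, mul_pow, two_mul d, pow_add]
  have h2 : u ^ (2 * d) ≤ (2 * d).factorial * Real.exp u := by
    have := Real.pow_div_factorial_le_exp (x := u) hu0 (2 * d)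
    rwa [div_le_iff₀' (by positivity)] at this
  have h3 : (2 * t) ^ d * (2 * t) ^ d ≤ (4 * Real.pi * t) ^ d := by
    rw [← mul_pow]
    apply pow_le_pow_left₀ (by positivity)
    nlinarith [Real.pi_gt_three]
  rw [h1, Real.exp_neg]
  calc _ ≤ ((4 * Real.pi * t) ^ d)⁻¹ * (Real.exp u)⁻¹ *
        ((4 * Real.pi * t) ^ d * ((2 * d).factorial * Real.exp u)) := by gcongr
    _ = (2 * d).factorial := by field_simp

lemma heatKernel_le_one {t : ℝ} (ht : 1 ≤ t) (x : Space d) : heatKernel d t x ≤ 1 := by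
  rw [heatKernel, if_pos (by linarith)]
  have h1 : (4 * Real.pi * t) ^ (-(d : ℝ) / 2) ≤ 1 := by
    apply Real.rpow_le_one_of_one_le_of_nonpos
    · nlinarith [Real.pi_gt_three]
    · rw [neg_div]
      exact neg_nonpos.2 (by positivity)
  have h2 : Real.exp (-‖x‖ ^ 2 / (4 * t)) ≤ 1 := by
    rw [Real.exp_le_one_iff, neg_div]
    exact neg_nonpos.2 (by positivity)
  exact mul_le_one₀ h1 (by positivity) h2

/-- The function `t ↦ t ^ (d / 2) * heatKernel d t x` is nondecreasing. -/
lemma rpow_mul_heatKernel_mono {s t : ℝ} (hs : 0 < s) (hst : s ≤ t) (x : Space d) :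
    s ^ ((d : ℝ) / 2) * heatKernel d s x ≤ t ^ ((d : ℝ) / 2) * heatKernel d t x := by
  have key : ∀ r : ℝ, 0 < r → r ^ ((d : ℝ) / 2) * heatKernel d r x
      = (4 * Real.pi) ^ (-(d : ℝ) / 2) * Real.exp (-‖x‖ ^ 2 / (4 * r)) := by
    intro r hr
    rw [heatKernel, if_pos hr, Real.mul_rpow (by positivity) hr.le, neg_div,
      Real.rpow_neg hr.le]
    have : r ^ ((d : ℝ) / 2) ≠ 0 := by positivity
    field_simp
  rw [key s hs, key t (hs.trans_le hst)]
  simp only [neg_div]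
  gcongr

/-- Parabolic scaling: at ages comparable to `r`, and within distance `√r`, the kernel is of order
`r^(-d/2)`. This is the source of the peaks. -/
lemma le_heatKernel_of_sq_le {r t : ℝ} (hr : 0 < r) (hrt : r ≤ t) (htr : t ≤ 2 * r) (x : Space d)
    (hx : ‖x‖ ^ 2 ≤ r) :
    (8 * Real.pi) ^ (-(d : ℝ) / 2) * Real.exp (-(1 / 4)) * r ^ (-(d : ℝ) / 2)
      ≤ heatKernel d t x := by
  have ht : 0 < t := hr.trans_le hrt
  rw [heatKernel, if_pos ht, mul_right_comm, ← Real.mul_rpow (by positivity) hr.le]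
  have h1 : (8 * Real.pi * r) ^ (-(d : ℝ) / 2) ≤ (4 * Real.pi * t) ^ (-(d : ℝ) / 2) := by
    apply Real.rpow_le_rpow_of_nonpos (by positivity)
    · nlinarith [Real.pi_pos]
    · rw [neg_div]
      exact neg_nonpos.2 (by positivity)
  have h2 : -(1 / 4) ≤ -‖x‖ ^ 2 / (4 * t) := by
    rw [neg_div, neg_le_neg_iff, div_le_div_iff₀ (by positivity) (by positivity)]
    linarith
  gcongr

/-- The image of Lebesgue measure on `ℝ^d` under `x ↦ ‖x‖ ^ d` is a multiple of Lebesgue measure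
on the half-line. -/
lemma map_norm_pow_volume (hd : 1 ≤ d) :
    (volume : Measure (Space d)).map (fun x => ‖x‖ ^ d)
      = volume (Metric.ball (0 : Space d) 1) • (volume : Measure ℝ).restrict (Ioi 0) := by
  have hd0 : d ≠ 0 := by omega
  have : Nonempty (Fin d) := ⟨⟨0, by omega⟩⟩
  have hm : Measurable (fun x : Space d => ‖x‖ ^ d) := by fun_prop
  have hball : ∀ a : ℝ, (volume : Measure (Space d)).map (fun x => ‖x‖ ^ d) (Iio a)
      = volume (Metric.ball (0 : Space d) 1) * ENNReal.ofReal a := by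
    intro a
    rw [Measure.map_apply hm measurableSet_Iio]
    rcases le_or_gt a 0 with ha | ha
    · rw [ENNReal.ofReal_of_nonpos ha, mul_zero]
      have : (fun x : Space d => ‖x‖ ^ d) ⁻¹' (Iio a) = ∅ := by
        ext x
        simp only [mem_preimage, mem_Iio, mem_empty_iff_false, iff_false, not_lt]
        exact ha.trans (by positivity)
      rw [this, measure_empty]
    · have : (fun x : Space d => ‖x‖ ^ d) ⁻¹' (Iio a)
          = Metric.ball (0 : Space d) (a ^ ((d : ℝ)⁻¹)) := by
        ext x
        simp only [mem_preimage, mem_Iio, mem_ball_zero_iff]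
        rw [Real.lt_rpow_inv_iff_of_pos (norm_nonneg _) ha.le (by positivity), Real.rpow_natCast]
      rw [this, Measure.addHaar_ball _ _ (by positivity), finrank_euclideanSpace,
        Fintype.card_fin, Real.rpow_inv_natCast_pow ha.le hd0, mul_comm]
  refine Measure.ext_of_generateFrom_of_iUnion (range Iio) (fun n : ℕ => Iio (n : ℝ))
    ((BorelSpace.measurable_eq (α := ℝ)).trans (borel_eq_generateFrom_Iio ℝ)) isPiSystem_Iio ?_
    (fun n => ⟨n, rfl⟩) ?_ ?_
  · ext x
    simpa using exists_nat_gt x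
  · intro n
    rw [hball]
    exact (ENNReal.mul_lt_top measure_ball_lt_top ENNReal.ofReal_lt_top).ne
  · rintro _ ⟨a, rfl⟩
    rw [hball, Measure.smul_apply, smul_eq_mul, Measure.restrict_apply measurableSet_Iio,
      Iio_inter_Ioi, Real.volume_Ioo, sub_zero]

lemma lintegral_norm_pow (hd : 1 ≤ d) {φ : ℝ → ℝ≥0∞} (hφ : Measurable φ) :
    ∫⁻ x : Space d, φ (‖x‖ ^ d)
      = volume (Metric.ball (0 : Space d) 1) * ∫⁻ v in Ioi 0, φ v := by
  rw [← lintegral_map (μ := volume) (g := fun x : Space d => ‖x‖ ^ d) hφ (by fun_prop),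
    map_norm_pow_volume hd, lintegral_smul_measure, smul_eq_mul]

lemma volume_norm_pow_lt (hd : 1 ≤ d) (a : ℝ) :
    volume {x : Space d | ‖x‖ ^ d < a}
      = volume (Metric.ball (0 : Space d) 1) * ENNReal.ofReal a := by
  have h := congrArg (fun μ => μ (Iio a)) (map_norm_pow_volume hd)
  rwa [Measure.map_apply (by fun_prop) measurableSet_Iio, Measure.smul_apply, smul_eq_mul,
    Measure.restrict_apply measurableSet_Iio, Iio_inter_Ioi, Real.volume_Ioo, sub_zero] at h

end HeatKernel

/-! ### Consequences of the assumptions on the Lévy measure -/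

section LevyMeasure

variable {lam : Measure ℝ}

lemma IsLevyMeasure.measure_lt_abs_lt_top (hlam : IsLevyMeasure lam) {δ : ℝ} (hδ : 0 < δ) :
    lam {z | δ < |z|} < ⊤ := by
  set a : ℝ≥0∞ := ENNReal.ofReal (min 1 (δ ^ 2)) with ha
  have ha0 : a ≠ 0 := by
    rw [ha, Ne, ENNReal.ofReal_eq_zero, not_le]
    positivity
  have h1 : lam {z | a ≤ ENNReal.ofReal (min 1 (z ^ 2))} < ⊤ := by
    refine (meas_ge_le_lintegral_div (by fun_prop) ha0 ENNReal.ofReal_ne_top).trans_lt ?_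
    exact ENNReal.div_lt_top hlam.lintegral_min_lt_top.ne ha0
  refine (measure_mono ?_).trans_lt h1
  intro z hz
  have hz' : δ < |z| := hz
  apply ENNReal.ofReal_le_ofReal
  apply min_le_min_left
  rw [← sq_abs z]
  gcongr

lemma IsLevyMeasure.sigmaFinite (hlam : IsLevyMeasure lam) : SigmaFinite lam := by
  refine ⟨⟨⟨fun n : ℕ => {0} ∪ {z | 1 / ((n : ℝ) + 1) < |z|}, fun _ => trivial, fun n => ?_, ?_⟩⟩⟩
  · refine (measure_union_le _ _).trans_lt ?_
    rw [hlam.zero_singleton, zero_add]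
    exact hlam.measure_lt_abs_lt_top (by positivity)
  · refine eq_univ_of_forall fun z => ?_
    rw [mem_iUnion]
    by_cases hz : z = 0
    · exact ⟨0, Or.inl hz⟩
    · obtain ⟨n, hn⟩ := exists_nat_one_div_lt (abs_pos.2 hz)
      exact ⟨n, Or.inr hn⟩

/-- Three ranges: the moment covers `|z| ≥ 1`; for `|z| ≤ exp (-1)` the logarithm is at least 1 in
absolute value; in between `|z| ≥ 1/3`, so `|z| ≤ 9 z²`. -/
lemma IsLevyMeasure.lintegral_abs_lt_top (hlam : IsLevyMeasure lam)
    (hmoment : ∃ ε : ℝ, 0 < ε ∧ Integrable (fun z : ℝ => |z| ^ (1 + ε)) lam)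
    (hlog : IntegrableOn (fun z : ℝ => |z * Real.log z|) (Icc (-1) 1) lam) :
    ∫⁻ z, ENNReal.ofReal |z| ∂lam < ⊤ := by
  obtain ⟨ε, hε, hm⟩ := hmoment
  have h1 : ∫⁻ z, ENNReal.ofReal (|z| ^ (1 + ε)) ∂lam < ⊤ := hm.lintegral_lt_top
  have h2 : ∫⁻ z in Icc (-1) 1, ENNReal.ofReal |z * Real.log z| ∂lam < ⊤ := hlog.lintegral_lt_top
  rw [← lintegral_indicator measurableSet_Icc] at h2
  have h3 : ∫⁻ z, 9 * ENNReal.ofReal (min 1 (z ^ 2)) ∂lam < ⊤ := by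
    rw [lintegral_const_mul _ (by fun_prop)]
    exact ENNReal.mul_lt_top (by simp) hlam.lintegral_min_lt_top
  have hmeas : Measurable fun z : ℝ => (Icc (-1 : ℝ) 1).indicator
      (fun z => ENNReal.ofReal |z * Real.log z|) z := by
    refine Measurable.indicator ?_ measurableSet_Icc
    fun_prop
  calc ∫⁻ z, ENNReal.ofReal |z| ∂lam
      ≤ ∫⁻ z, (ENNReal.ofReal (|z| ^ (1 + ε)) + ((Icc (-1 : ℝ) 1).indicator
          (fun z => ENNReal.ofReal |z * Real.log z|) z + 9 * ENNReal.ofReal (min 1 (z ^ 2)))) ∂lam := by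
        refine lintegral_mono fun z => ?_
        rcases le_or_gt 1 |z| with hz | hz
        · refine le_add_right (ENNReal.ofReal_le_ofReal ?_)
          exact Real.self_le_rpow_of_one_le hz (by linarith)
        · have hmem : z ∈ Icc (-1 : ℝ) 1 := abs_le.1 hz.le
          rcases le_or_gt |z| (Real.exp (-1)) with hz' | hz'
          · refine le_add_left (le_add_right ?_)
            rw [indicator_of_mem hmem]
            apply ENNReal.ofReal_le_ofReal
            rw [abs_mul]
            rcases eq_or_ne z 0 with rfl | hz0
            · simp
            · have : Real.log |z| ≤ -1 := by
                rw [Real.log_le_iff_le_exp (abs_pos.2 hz0)]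
                exact hz'
              rw [Real.log_abs] at this
              have h4 : 1 ≤ |Real.log z| := by
                rw [abs_of_nonpos (by linarith)]
                linarith
              exact le_mul_of_one_le_right (abs_nonneg z) h4
          · refine le_add_left (le_add_left ?_)
            have h5 : 1 / 3 ≤ |z| := by
              have h6 : Real.exp 1 ≤ 3 := Real.exp_one_lt_three.le
              have : 1 / 3 ≤ Real.exp (-1) := by
                rw [Real.exp_neg, one_div]
                gcongr
              linarith
            rw [show (9 : ℝ≥0∞) = ENNReal.ofReal 9 by simp, ← ENNReal.ofReal_mul (by norm_num)]
            apply ENNReal.ofReal_le_ofReal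
            rw [← sq_abs z, min_eq_right (by nlinarith [abs_nonneg z])]
            nlinarith
    _ < ⊤ := by
        rw [lintegral_add_left (by fun_prop), lintegral_add_left hmeas]
        exact ENNReal.add_lt_top.2 ⟨h1, ENNReal.add_lt_top.2 ⟨h2, h3⟩⟩

lemma lintegral_jumpIntensity {d : ℕ} [SFinite lam] {h : ℝ × Space d × ℝ → ℝ≥0∞}
    (hh : Measurable h) :
    ∫⁻ p, h p ∂(jumpIntensity d lam) = ∫⁻ s in Ioi 0, ∫⁻ z, ∫⁻ y, h (s, y, z) ∂volume ∂lam := by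
  rw [jumpIntensity, lintegral_prod _ hh.aemeasurable]
  refine lintegral_congr fun s => ?_
  rw [lintegral_prod_symm _ (by fun_prop)]

end LevyMeasure


/-! ### Intensity estimates for the contributions of single jumps -/

section JumpPotentials

variable {d : ℕ} {lam : Measure ℝ}

/-- The absolute contribution of a jump `(s,y,z)` to the solution at `(t,0)`. -/
noncomputable def jumpHeat (t : ℝ) (p : ℝ × Space d × ℝ) : ℝ≥0∞ :=
  ENNReal.ofReal (heatKernel d (t - p.1) p.2.1 * |p.2.2|)

@[fun_prop]
lemma measurable_jumpHeat (t : ℝ) : Measurable (jumpHeat (d := d) t) := by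
  unfold jumpHeat
  have h : Measurable (fun p : ℝ × Space d × ℝ => heatKernel d (t - p.1) p.2.1) :=
    measurable_heatKernel.comp (f := fun p : ℝ × Space d × ℝ => (t - p.1, p.2.1)) (by fun_prop)
  fun_prop

/-- A bound for the contribution of a jump shortly after it occurs. -/
noncomputable def recentJump (p : ℝ × Space d × ℝ) : ℝ≥0∞ :=
  ENNReal.ofReal (|p.2.2| * min (‖p.2.1‖ ^ d)⁻¹ ((‖p.2.1‖ ^ d) ^ 2)⁻¹)

@[fun_prop]
lemma measurable_recentJump : Measurable (recentJump (d := d)) := by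
  unfold recentJump
  fun_prop

/-- A bound for the contribution of a jump from one unit of time after its occurrence on. -/
noncomputable def pastJump (p : ℝ × Space d × ℝ) : ℝ≥0∞ :=
  ENNReal.ofReal (|p.2.2| * min 1 (‖p.2.1‖ ^ d)⁻¹)

@[fun_prop]
lemma measurable_pastJump : Measurable (pastJump (d := d)) := by
  unfold pastJump
  fun_prop

/-- The point `y = 0` is excluded because for `d ≥ 1` the inverses take the default value 0 there,
so the bound would fail. Almost surely there is no such jump. -/
lemma jumpHeat_le_recentJump {t : ℝ} {p : ℝ × Space d × ℝ} (hp : p.2.1 ≠ 0) (ht : t - p.1 ≤ 2) :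
    jumpHeat t p ≤ ENNReal.ofReal (heatBound d) * recentJump p := by
  have hv : 0 < ‖p.2.1‖ ^ d := by have := norm_pos_iff.2 hp; positivity
  rw [jumpHeat, recentJump, ← ENNReal.ofReal_mul (by unfold heatBound; positivity)]
  apply ENNReal.ofReal_le_ofReal
  have h1 : heatKernel d (t - p.1) p.2.1 ≤ heatBound d * (‖p.2.1‖ ^ d)⁻¹ := by
    rw [← div_eq_mul_inv, le_div_iff₀ hv]
    exact heatKernel_mul_pow_le _ _
  have h2 : heatKernel d (t - p.1) p.2.1 ≤ heatBound d * ((‖p.2.1‖ ^ d) ^ 2)⁻¹ := by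
    rw [← div_eq_mul_inv, le_div_iff₀ (by positivity)]
    exact heatKernel_mul_pow_sq_le ht _
  have h3 : heatKernel d (t - p.1) p.2.1
      ≤ heatBound d * min (‖p.2.1‖ ^ d)⁻¹ ((‖p.2.1‖ ^ d) ^ 2)⁻¹ := by
    rcases min_choice (‖p.2.1‖ ^ d)⁻¹ ((‖p.2.1‖ ^ d) ^ 2)⁻¹ with h | h <;> rw [h] <;> assumption
  calc _ ≤ heatBound d * min (‖p.2.1‖ ^ d)⁻¹ ((‖p.2.1‖ ^ d) ^ 2)⁻¹ * |p.2.2| := by gcongr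
    _ = _ := by ring

lemma jumpHeat_le_pastJump {t : ℝ} {p : ℝ × Space d × ℝ} (hp : p.2.1 ≠ 0) (ht : 1 ≤ t - p.1) :
    jumpHeat t p ≤ ENNReal.ofReal (heatBound d) * pastJump p := by
  have hv : 0 < ‖p.2.1‖ ^ d := by have := norm_pos_iff.2 hp; positivity
  rw [jumpHeat, pastJump, ← ENNReal.ofReal_mul (by unfold heatBound; positivity)]
  apply ENNReal.ofReal_le_ofReal
  have h1 : heatKernel d (t - p.1) p.2.1 ≤ heatBound d * (‖p.2.1‖ ^ d)⁻¹ := by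
    rw [← div_eq_mul_inv, le_div_iff₀ hv]
    exact heatKernel_mul_pow_le _ _
  have h2 : heatKernel d (t - p.1) p.2.1 ≤ heatBound d * 1 := by
    rw [mul_one]
    exact (heatKernel_le_one ht _).trans one_le_heatBound
  have h3 : heatKernel d (t - p.1) p.2.1 ≤ heatBound d * min 1 (‖p.2.1‖ ^ d)⁻¹ := by
    rcases min_choice 1 (‖p.2.1‖ ^ d)⁻¹ with h | h <;> rw [h] <;> assumption
  calc _ ≤ heatBound d * min 1 (‖p.2.1‖ ^ d)⁻¹ * |p.2.2| := by gcongr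
    _ = _ := by ring

/-- The kernel has mass one in space at every positive age, so only the length of the time set
remains. -/
lemma lintegral_heatKernel_mul [SFinite lam] (t : ℝ) {I : Set ℝ} (hI : MeasurableSet I)
    {w : ℝ → ℝ≥0∞} (hw : Measurable w) :
    ∫⁻ p, I.indicator 1 p.1 * ENNReal.ofReal (heatKernel d (t - p.1) p.2.1) * w p.2.2
      ∂(jumpIntensity d lam) = volume (I ∩ Ioo 0 t) * ∫⁻ z, w z ∂lam := by
  have h : Measurable (fun p : ℝ × Space d × ℝ => heatKernel d (t - p.1) p.2.1) :=
    measurable_heatKernel.comp (f := fun p : ℝ × Space d × ℝ => (t - p.1, p.2.1)) (by fun_prop)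
  have hi : Measurable (I.indicator (1 : ℝ → ℝ≥0∞)) := measurable_one.indicator hI
  have hg : ∀ s : ℝ, Measurable (fun y : Space d => ENNReal.ofReal (heatKernel d (t - s) y)) :=
    fun s => (measurable_heatKernel.comp
      (f := fun y : Space d => (t - s, y)) (by fun_prop)).ennreal_ofReal
  rw [lintegral_jumpIntensity (by fun_prop)]
  have h1 : ∀ s : ℝ, ∫⁻ z, ∫⁻ y : Space d, I.indicator 1 s *
      ENNReal.ofReal (heatKernel d (t - s) y) * w z ∂volume ∂lam
      = (I ∩ Iio t).indicator 1 s * ∫⁻ z, w z ∂lam := by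
    intro s
    simp_rw [mul_assoc]
    have h2 : ∀ z, ∫⁻ y : Space d, I.indicator 1 s *
        (ENNReal.ofReal (heatKernel d (t - s) y) * w z)
        = (I ∩ Iio t).indicator 1 s * w z := by
      intro z
      rw [lintegral_const_mul _ ((hg s).mul_const _), lintegral_mul_const _ (hg s)]
      by_cases hs : s < t
      · rw [lintegral_heatKernel (by linarith), one_mul]
        congr 1
        by_cases hsI : s ∈ I
        · rw [indicator_of_mem hsI, indicator_of_mem (mem_inter hsI hs)]
        · rw [indicator_of_notMem hsI, indicator_of_notMem fun h => hsI h.1]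
      · rw [indicator_of_notMem (fun h => hs h.2 : s ∉ I ∩ Iio t)]
        simp only [heatKernel_of_nonpos (sub_nonpos.2 (not_lt.1 hs))]
        simp
    simp_rw [h2]
    rw [lintegral_const_mul _ hw]
  simp_rw [h1]
  rw [lintegral_mul_const _ (measurable_one.indicator (hI.inter measurableSet_Iio)),
    lintegral_indicator_one (hI.inter measurableSet_Iio),
    Measure.restrict_apply (hI.inter measurableSet_Iio), inter_assoc, Iio_inter_Ioi]

lemma lintegral_jumpHeat [SFinite lam] (t : ℝ) :
    ∫⁻ p, jumpHeat t p ∂(jumpIntensity d lam)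
      = ENNReal.ofReal t * ∫⁻ z, ENNReal.ofReal |z| ∂lam := by
  have h := lintegral_heatKernel_mul (d := d) (lam := lam) t MeasurableSet.univ
    (w := fun z => ENNReal.ofReal |z|) (by fun_prop)
  rw [univ_inter, Real.volume_Ioo, sub_zero] at h
  rw [← h]
  refine lintegral_congr fun p => ?_
  rw [jumpHeat, ENNReal.ofReal_mul (heatKernel_nonneg _ _)]
  simp

lemma volume_ball_lt_top : volume (Metric.ball (0 : Space d) 1) < ⊤ := measure_ball_lt_top

lemma measurableSet_prod_recentJump {I : Set ℝ} (hI : MeasurableSet I) (b : ℝ≥0∞) :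
    MeasurableSet {p : ℝ × Space d × ℝ | p.1 ∈ I ∧ b < recentJump p} :=
  (measurable_fst hI).inter (measurableSet_lt measurable_const measurable_recentJump)

lemma lintegral_indicator_Ioi_le {I : Set ℝ} (hI : MeasurableSet I) (a : ℝ≥0∞) :
    ∫⁻ s in Ioi 0, I.indicator 1 s * a ≤ volume I * a := by
  rw [lintegral_mul_const _ (measurable_one.indicator hI), lintegral_indicator_one hI]
  gcongr
  exact Measure.restrict_le_self

/-- The branch `1/v` of the minimum alone forces `v < |z|/b`, a region of volume proportional to
`|z|/b`. -/
lemma jumpIntensity_recentJump_le (hd : 1 ≤ d) [SFinite lam] {I : Set ℝ} (hI : MeasurableSet I)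
    {b : ℝ} (hb : 0 < b) :
    jumpIntensity d lam {p | p.1 ∈ I ∧ ENNReal.ofReal b < recentJump p}
      ≤ volume I * (volume (Metric.ball (0 : Space d) 1) *
        ((∫⁻ z, ENNReal.ofReal |z| ∂lam) / ENNReal.ofReal b)) := by
  have hm := measurableSet_prod_recentJump (d := d) hI (ENNReal.ofReal b)
  rw [← lintegral_indicator_one hm, lintegral_jumpIntensity (measurable_one.indicator hm)]
  refine le_trans (lintegral_mono fun s => ?_) (lintegral_indicator_Ioi_le hI _)
  by_cases hs : s ∈ I
  · rw [indicator_of_mem hs, Pi.one_apply, one_mul]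
    calc _ ≤ ∫⁻ z, volume (Metric.ball (0 : Space d) 1) *
          (ENNReal.ofReal |z| / ENNReal.ofReal b) ∂lam := by
          refine lintegral_mono fun z => ?_
          rw [← ENNReal.ofReal_div_of_pos hb, ← volume_norm_pow_lt hd,
            ← lintegral_indicator_one (measurableSet_lt (by fun_prop) measurable_const)]
          refine lintegral_mono fun y => ?_
          by_cases hy : ENNReal.ofReal b < recentJump (s, y, z)
          · rw [indicator_of_mem (show (s, y, z) ∈ {p : ℝ × Space d × ℝ | p.1 ∈ I ∧
              ENNReal.ofReal b < recentJump p} from ⟨hs, hy⟩)]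
            rw [recentJump, ENNReal.ofReal_lt_ofReal_iff'] at hy
            have h1 := hy.1.trans_le (mul_le_mul_of_nonneg_left (min_le_left _ _) (abs_nonneg z))
            simp only at h1
            have hv : 0 < ‖y‖ ^ d := by
              by_contra hv
              rw [le_antisymm (not_lt.1 hv) (by positivity)] at h1
              simp at h1
              linarith
            rw [← div_eq_mul_inv, lt_div_iff₀ hv] at h1
            have hmem : y ∈ {x : Space d | ‖x‖ ^ d < |z| / b} := by
              rw [mem_ofPred_eq, lt_div_iff₀ hb]
              linarith
            rw [indicator_of_mem hmem]
            exact le_rfl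
          · rw [indicator_of_notMem fun h => hy h.2]
            exact zero_le
      _ = _ := by
          rw [lintegral_const_mul _ (by fun_prop)]
          simp_rw [ENNReal.div_eq_inv_mul]
          rw [lintegral_const_mul _ (by fun_prop)]
  · simp [hs]


lemma lintegral_Icc_inv_le {a b : ℝ} (ha : 0 < a) (hab : Real.log a⁻¹ ≤ b) :
    ∫⁻ v in Icc a 1, ENNReal.ofReal v⁻¹ ≤ ENNReal.ofReal b := by
  rcases le_or_gt a 1 with h1 | h1
  · have hint : IntegrableOn (fun v : ℝ => v⁻¹) (Icc a 1) := by
      refine ContinuousOn.integrableOn_Icc ?_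
      exact continuousOn_id.inv₀ fun x hx => (ha.trans_le hx.1).ne'
    rw [← ofReal_integral_eq_lintegral_ofReal hint ?_]
    · apply ENNReal.ofReal_le_ofReal
      rw [integral_Icc_eq_integral_Ioc, ← intervalIntegral.integral_of_le h1,
        integral_inv_of_pos ha one_pos]
      simpa using hab
    · rw [EventuallyLE, ae_restrict_iff' measurableSet_Icc]
      exact ae_of_all _ fun v hv => inv_nonneg.2 (ha.le.trans hv.1)
  · rw [Icc_eq_empty (not_le.2 h1)]
    simp

lemma lintegral_Ioi_inv_sq : ∫⁻ v in Ioi (1 : ℝ), ENNReal.ofReal (v ^ 2)⁻¹ = 1 := by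
  have h1 : ∀ v ∈ Ioi (1 : ℝ), v ^ (-2 : ℝ) = (v ^ 2)⁻¹ := fun v hv => by
    rw [Real.rpow_neg (zero_le_one.trans (le_of_lt hv))]
    norm_cast
  have hint : IntegrableOn (fun v : ℝ => (v ^ 2)⁻¹) (Ioi 1) :=
    (integrableOn_Ioi_rpow_of_lt (by norm_num : (-2 : ℝ) < -1) one_pos).congr_fun h1
      measurableSet_Ioi
  rw [← ofReal_integral_eq_lintegral_ofReal hint (ae_of_all _ fun v => by positivity),
    ← setIntegral_congr_fun measurableSet_Ioi h1,
    integral_Ioi_rpow_of_lt (by norm_num) one_pos]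
  norm_num

/-- The integral over the spatial variable (through `v = ‖y‖ ^ d`) of the truncated contribution
of a jump of size `z`. -/
lemma lintegral_truncated_le {z b : ℝ} (hz : z ≠ 0) (hb : 1 ≤ b) :
    ∫⁻ v in Ioi (0 : ℝ), (if ENNReal.ofReal (|z| * min v⁻¹ (v ^ 2)⁻¹) ≤ ENNReal.ofReal b then
        ENNReal.ofReal (|z| * min v⁻¹ (v ^ 2)⁻¹) else 0)
      ≤ ENNReal.ofReal |z| * ENNReal.ofReal (1 + Real.log b)
        + (Icc (-1 : ℝ) 1).indicator (fun z => ENNReal.ofReal |z * Real.log z|) z := by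
  have hz0 : 0 < |z| := abs_pos.2 hz
  have hb0 : 0 < b := one_pos.trans_le hb
  have hlogb : 0 ≤ Real.log b := Real.log_nonneg hb
  set a : ℝ := |z| / b with ha
  have ha0 : 0 < a := by positivity
  -- The truncation forces `v ≥ a = |z|/b`, so `1/v` integrates to `log (1/a) = log b - log |z|`
  -- when `a ≤ 1`. Here `-log |z|` matters only for `|z| ≤ 1`, and the factor `|z|` turns it into
  -- `|z log|z||`.
  set c : ℝ := Real.log b + (Icc (-1 : ℝ) 1).indicator (fun z => |Real.log z|) z with hc
  have hind : 0 ≤ (Icc (-1 : ℝ) 1).indicator (fun z => |Real.log z|) z :=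
    indicator_nonneg (fun _ _ => abs_nonneg _) _
  have hca : Real.log a⁻¹ ≤ c := by
    rw [ha, inv_div, Real.log_div hb0.ne' hz0.ne', Real.log_abs, hc]
    by_cases hzm : z ∈ Icc (-1 : ℝ) 1
    · rw [indicator_of_mem hzm]
      linarith [neg_le_abs (Real.log z)]
    · rw [indicator_of_notMem hzm]
      have : 1 < |z| := by
        by_contra h
        exact hzm (abs_le.1 (not_lt.1 h))
      have := Real.log_nonneg this.le
      rw [Real.log_abs] at this
      linarith
  calc _ ≤ ∫⁻ v in Ioi (0 : ℝ), ((Ioi (1 : ℝ)).indicator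
          (fun v => ENNReal.ofReal |z| * ENNReal.ofReal (v ^ 2)⁻¹) v
          + (Icc a 1).indicator (fun v => ENNReal.ofReal |z| * ENNReal.ofReal v⁻¹) v) := by
        refine setLIntegral_mono' measurableSet_Ioi fun v hv => ?_
        have hv0 : (0 : ℝ) < v := hv
        split_ifs with h
        · rcases le_or_gt v 1 with h1 | h1
          · refine le_add_left ?_
            have hmin : min v⁻¹ (v ^ 2)⁻¹ = v⁻¹ := by
              apply min_eq_left
              apply inv_anti₀ (by positivity)
              nlinarith
            rw [hmin] at h ⊢
            have hmem : v ∈ Icc a 1 := by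
              refine ⟨?_, h1⟩
              rw [ENNReal.ofReal_le_ofReal_iff hb0.le, ← div_eq_mul_inv, div_le_iff₀ hv0] at h
              rw [ha, div_le_iff₀ hb0]
              linarith
            rw [indicator_of_mem hmem, ENNReal.ofReal_mul hz0.le]
          · refine le_add_right ?_
            rw [indicator_of_mem (show v ∈ Ioi 1 from h1), ← ENNReal.ofReal_mul hz0.le]
            apply ENNReal.ofReal_le_ofReal
            gcongr
            exact min_le_right _ _
        · exact zero_le
    _ ≤ ∫⁻ v, ((Ioi (1 : ℝ)).indicator
          (fun v => ENNReal.ofReal |z| * ENNReal.ofReal (v ^ 2)⁻¹) v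
          + (Icc a 1).indicator (fun v => ENNReal.ofReal |z| * ENNReal.ofReal v⁻¹) v) :=
        setLIntegral_le_lintegral _ _
    _ = (ENNReal.ofReal |z| * ∫⁻ v in Ioi (1 : ℝ), ENNReal.ofReal (v ^ 2)⁻¹)
        + ENNReal.ofReal |z| * ∫⁻ v in Icc a 1, ENNReal.ofReal v⁻¹ := by
        rw [lintegral_add_left (Measurable.indicator (by fun_prop) measurableSet_Ioi),
          lintegral_indicator measurableSet_Ioi, lintegral_indicator measurableSet_Icc,
          lintegral_const_mul _ (by fun_prop), lintegral_const_mul _ (by fun_prop)]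
    _ ≤ ENNReal.ofReal |z| * 1 + ENNReal.ofReal |z| * ENNReal.ofReal c := by
        rw [lintegral_Ioi_inv_sq]
        gcongr
        exact lintegral_Icc_inv_le ha0 hca
    _ = _ := by
        rw [hc, ENNReal.ofReal_add hlogb hind, ENNReal.ofReal_add zero_le_one hlogb,
          ENNReal.ofReal_one, mul_add, mul_add, ← add_assoc]
        congr 1
        by_cases hzm : z ∈ Icc (-1 : ℝ) 1
        · rw [indicator_of_mem hzm, indicator_of_mem hzm, abs_mul, ENNReal.ofReal_mul hz0.le]
        · rw [indicator_of_notMem hzm, indicator_of_notMem hzm]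
          simp

/-- The truncated mean grows only logarithmically in `b`, slowly enough for a Chernoff bound at a
level proportional to `b`. -/
lemma lintegral_recentJump_le (hd : 1 ≤ d) (hlam : IsLevyMeasure lam) {I : Set ℝ}
    (hI : MeasurableSet I) {b : ℝ} (hb : 1 ≤ b) :
    ∫⁻ p in {p | p.1 ∈ I ∧ recentJump p ≤ ENNReal.ofReal b}, recentJump p ∂(jumpIntensity d lam)
      ≤ volume I * (volume (Metric.ball (0 : Space d) 1) *
        ((∫⁻ z, ENNReal.ofReal |z| ∂lam) * ENNReal.ofReal (1 + Real.log b)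
          + ∫⁻ z in Icc (-1) 1, ENNReal.ofReal |z * Real.log z| ∂lam)) := by
  have := hlam.sigmaFinite
  have hm : MeasurableSet {p : ℝ × Space d × ℝ | p.1 ∈ I ∧ recentJump p ≤ ENNReal.ofReal b} :=
    (measurable_fst hI).inter (measurableSet_le measurable_recentJump measurable_const)
  rw [← lintegral_indicator hm, lintegral_jumpIntensity (measurable_recentJump.indicator hm)]
  refine le_trans (lintegral_mono fun s => ?_) (lintegral_indicator_Ioi_le hI _)
  by_cases hs : s ∈ I
  · rw [indicator_of_mem hs, Pi.one_apply, one_mul]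
    have hz0 : ∀ᵐ z ∂lam, z ≠ 0 := by
      rw [ae_iff]
      simpa using hlam.zero_singleton
    have hmeas : Measurable fun z : ℝ => (Icc (-1 : ℝ) 1).indicator
        (fun z => ENNReal.ofReal |z * Real.log z|) z :=
      Measurable.indicator (by fun_prop) measurableSet_Icc
    calc _ ≤ ∫⁻ z, volume (Metric.ball (0 : Space d) 1) *
          (ENNReal.ofReal |z| * ENNReal.ofReal (1 + Real.log b)
          + (Icc (-1 : ℝ) 1).indicator (fun z => ENNReal.ofReal |z * Real.log z|) z) ∂lam := by
          refine lintegral_mono_ae ?_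
          filter_upwards [hz0] with z hz
          refine le_trans ?_ (mul_le_mul_right (lintegral_truncated_le hz hb) _)
          rw [← lintegral_norm_pow hd (φ := fun v =>
            if ENNReal.ofReal (|z| * min v⁻¹ (v ^ 2)⁻¹) ≤ ENNReal.ofReal b then
              ENNReal.ofReal (|z| * min v⁻¹ (v ^ 2)⁻¹) else 0)]
          · refine lintegral_mono fun y => ?_
            by_cases hy : recentJump (s, y, z) ≤ ENNReal.ofReal b
            · rw [indicator_of_mem (show (s, y, z) ∈ {p : ℝ × Space d × ℝ | p.1 ∈ I ∧
                recentJump p ≤ ENNReal.ofReal b} from ⟨hs, hy⟩)]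
              have hy' : ENNReal.ofReal (|z| * min (‖y‖ ^ d)⁻¹ ((‖y‖ ^ d) ^ 2)⁻¹)
                ≤ ENNReal.ofReal b := hy
              simp only [if_pos hy']
              exact le_rfl
            · rw [indicator_of_notMem fun h => hy h.2]
              exact zero_le
          · refine Measurable.ite (measurableSet_le (by fun_prop) measurable_const) (by fun_prop)
              measurable_const
      _ = _ := by
          rw [lintegral_const_mul _ (by fun_prop), lintegral_add_left (by fun_prop),
            lintegral_mul_const _ (by fun_prop), lintegral_indicator measurableSet_Icc]
  · have : ∀ (y : Space d) (z : ℝ), (s, y, z) ∉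
        {p : ℝ × Space d × ℝ | p.1 ∈ I ∧ recentJump p ≤ ENNReal.ofReal b} :=
      fun y z h => hs h.1
    simp [indicator_of_notMem (this _ _)]

/-- The jumps of size large compared with a power `β < 1` of the time of their occurrence. -/
def largeJumps (d : ℕ) (β : ℝ) : Set (ℝ × Space d × ℝ) :=
  {p | ENNReal.ofReal (max 1 p.1 ^ β) < pastJump p}

lemma measurableSet_largeJumps (β : ℝ) : MeasurableSet (largeJumps d β) :=
  measurableSet_lt (by fun_prop) measurable_pastJump

/-- Exceeding `b = max 1 s ^ β` requires both `|z| > b` and `v < |z|/b`. Since then `|z|/b ≤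
(|z|/b)^(1+ε)`, the intensity at time `s > 1` is of order at most `s^(-β(1+ε))`, which is
integrable. -/
lemma jumpIntensity_largeJumps_lt_top (hd : 1 ≤ d) [SFinite lam] {ε β : ℝ} (hε : 0 < ε)
    (hβ : 1 < β * (1 + ε)) (hm : Integrable (fun z : ℝ => |z| ^ (1 + ε)) lam) :
    jumpIntensity d lam (largeJumps d β) < ⊤ := by
  have hD := measurableSet_largeJumps (d := d) β
  set K : ℝ≥0∞ := ∫⁻ z, ENNReal.ofReal (|z| ^ (1 + ε)) ∂lam with hK
  have hKtop : K < ⊤ := hm.lintegral_lt_top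
  rw [← lintegral_indicator_one hD, lintegral_jumpIntensity (measurable_one.indicator hD)]
  have h1 : ∀ s : ℝ, ∫⁻ z, ∫⁻ y, (largeJumps d β).indicator 1 (s, y, z) ∂volume ∂lam
      ≤ ENNReal.ofReal (max 1 s ^ (-(β * (1 + ε)))) *
        (volume (Metric.ball (0 : Space d) 1) * K) := by
    intro s
    set b : ℝ := max 1 s ^ β with hb
    have hs1 : (0 : ℝ) < max 1 s := by positivity
    have hb0 : 0 < b := by positivity
    calc _ ≤ ∫⁻ z, volume (Metric.ball (0 : Space d) 1) *
          (ENNReal.ofReal (|z| ^ (1 + ε)) * ENNReal.ofReal (b ^ (-(1 + ε)))) ∂lam := by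
          refine lintegral_mono fun z => ?_
          rcases le_or_gt |z| b with hz | hz
          · refine le_trans (lintegral_mono (g := fun _ => 0) fun y => ?_) (by simp)
            rw [indicator_of_notMem]
            intro hy
            have hy' : ENNReal.ofReal b < ENNReal.ofReal (|z| * min 1 (‖y‖ ^ d)⁻¹) := hy
            have := ((ENNReal.ofReal_lt_ofReal_iff'.1 hy').1).trans_le
              (mul_le_mul_of_nonneg_left (min_le_left _ _) (abs_nonneg z))
            linarith
          · have hzb : |z| / b ≤ |z| ^ (1 + ε) * b ^ (-(1 + ε)) := by
              have h1 : 1 ≤ |z| / b := (one_le_div₀ hb0).2 hz.le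
              rw [Real.rpow_neg hb0.le, ← div_eq_mul_inv,
                ← Real.div_rpow (abs_nonneg z) hb0.le]
              exact Real.self_le_rpow_of_one_le h1 (by linarith)
            rw [← ENNReal.ofReal_mul (by positivity)]
            refine le_trans ?_ (mul_le_mul_right (ENNReal.ofReal_le_ofReal hzb) _)
            rw [← volume_norm_pow_lt hd,
              ← lintegral_indicator_one (measurableSet_lt (by fun_prop) measurable_const)]
            refine lintegral_mono fun y => ?_
            by_cases hy : (s, y, z) ∈ largeJumps d β
            · rw [indicator_of_mem hy]
              have hy' : ENNReal.ofReal b < ENNReal.ofReal (|z| * min 1 (‖y‖ ^ d)⁻¹) := hy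
              have h1 := ((ENNReal.ofReal_lt_ofReal_iff'.1 hy').1).trans_le
                (mul_le_mul_of_nonneg_left (min_le_right _ _) (abs_nonneg z))
              have hv : 0 < ‖y‖ ^ d := by
                by_contra hv
                rw [le_antisymm (not_lt.1 hv) (by positivity)] at h1
                simp only [inv_zero, mul_zero] at h1
                linarith
              rw [← div_eq_mul_inv, lt_div_iff₀ hv] at h1
              have hmem : y ∈ {x : Space d | ‖x‖ ^ d < |z| / b} := by
                rw [mem_ofPred_eq, lt_div_iff₀ hb0]
                linarith
              rw [indicator_of_mem hmem]
              exact le_rfl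
            · rw [indicator_of_notMem hy]
              exact zero_le
      _ = _ := by
          rw [lintegral_const_mul _ (by fun_prop), lintegral_mul_const _ (by fun_prop), hb,
            ← Real.rpow_mul hs1.le, mul_neg]
          ring
  refine (lintegral_mono h1).trans_lt ?_
  rw [lintegral_mul_const _ (by fun_prop)]
  refine ENNReal.mul_lt_top ?_ (ENNReal.mul_lt_top volume_ball_lt_top hKtop)
  have hsplit : Ioi (0 : ℝ) = Ioc 0 1 ∪ Ioi 1 := by rw [Ioc_union_Ioi_eq_Ioi zero_le_one]
  rw [hsplit]
  refine (lintegral_union_le _ _ _).trans_lt (ENNReal.add_lt_top.2 ⟨?_, ?_⟩)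
  · calc _ ≤ ∫⁻ _ in Ioc (0 : ℝ) 1, (1 : ℝ≥0∞) := by
          refine setLIntegral_mono' measurableSet_Ioc fun s hs => ?_
          rw [max_eq_left hs.2, Real.one_rpow, ENNReal.ofReal_one]
      _ < ⊤ := by simp
  · have hint := integrableOn_Ioi_rpow_of_lt (neg_lt_neg hβ) one_pos
    refine lt_of_le_of_lt (le_of_eq ?_) hint.lintegral_lt_top
    refine setLIntegral_congr_fun measurableSet_Ioi fun s hs => ?_
    simp only [max_eq_right (le_of_lt (show (1 : ℝ) < s from hs))]

end JumpPotentials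


/-! ### The integral condition on `f` and its discrete forms -/

section IntegralTest

variable {f : ℝ → ℝ}

lemma ofReal_one_div_anti (hfpos : ∀ t, 0 < t → 0 < f t) (hfmono : MonotoneOn f (Ioi 0)) {s t : ℝ}
    (hs : 0 < s) (hst : s ≤ t) : ENNReal.ofReal (1 / f t) ≤ ENNReal.ofReal (1 / f s) := by
  apply ENNReal.ofReal_le_ofReal
  apply one_div_le_one_div_of_le (hfpos s hs)
  exact hfmono hs (hs.trans_le hst) hst

/-- If `1 / f` is integrable and `f` nondecreasing, then `f` grows faster than linearly. -/
lemma tendsto_div_of_lintegral_lt_top (hfpos : ∀ t, 0 < t → 0 < f t)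
    (hfmono : MonotoneOn f (Ioi 0))
    (hint : (∫⁻ t in Ioi (1 : ℝ), ENNReal.ofReal (1 / f t)) < ⊤) :
    Tendsto (fun t => t / f t) atTop (𝓝 0) := by
  let ρ : Measure ℝ := (volume.restrict (Ioi (1 : ℝ))).withDensity fun t => ENNReal.ofReal (1 / f t)
  have hρ : ∀ A, MeasurableSet A → A ⊆ Ioi 1 → ρ A = ∫⁻ t in A, ENNReal.ofReal (1 / f t) := by
    intro A hA hA1
    rw [withDensity_apply _ hA, Measure.restrict_restrict hA, inter_eq_left.2 hA1]
  have hlim : Tendsto (fun a : ℝ => ρ (Ioi a)) atTop (𝓝 0) := by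
    have hempty : ⋂ a : ℝ, Ioi a = ∅ := by
      ext x
      simp only [mem_iInter, mem_Ioi, mem_empty_iff_false, iff_false, not_forall, not_lt]
      exact ⟨x, le_rfl⟩
    have := tendsto_measure_iInter_atTop (μ := ρ) (s := fun a : ℝ => Ioi a)
      (fun a => measurableSet_Ioi.nullMeasurableSet) (fun a b hab => Ioi_subset_Ioi hab)
      ⟨1, by rw [hρ _ measurableSet_Ioi subset_rfl]; exact hint.ne⟩
    rwa [hempty, measure_empty] at this
  have hlim2 : Tendsto (fun t : ℝ => 2 * ρ (Ioi (t / 2))) atTop (𝓝 0) := by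
    have h := ENNReal.Tendsto.const_mul
      (hlim.comp (tendsto_id.atTop_div_const (two_pos : (0 : ℝ) < 2))) (a := 2)
      (Or.inr (by simp))
    simpa using h
  have hbound : ∀ᶠ t : ℝ in atTop, ENNReal.ofReal (t / f t) ≤ 2 * ρ (Ioi (t / 2)) := by
    filter_upwards [eventually_ge_atTop 2] with t ht
    -- On `(t/2, t]` the function `1/f` is at least `1/f t`, so `t/(2 f t)` is bounded by a tail of
    -- the convergent integral.
    have h1 : ENNReal.ofReal (1 / f t) * ENNReal.ofReal (t / 2) ≤ ρ (Ioi (t / 2)) := by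
      calc ENNReal.ofReal (1 / f t) * ENNReal.ofReal (t / 2)
          = ∫⁻ _ in Ioc (t / 2) t, ENNReal.ofReal (1 / f t) := by
            rw [setLIntegral_const, Real.volume_Ioc]
            congr 2
            ring
        _ ≤ ∫⁻ u in Ioc (t / 2) t, ENNReal.ofReal (1 / f u) := by
            refine setLIntegral_mono' measurableSet_Ioc fun u hu => ?_
            exact ofReal_one_div_anti hfpos hfmono (lt_of_le_of_lt (by positivity) hu.1) hu.2
        _ = ρ (Ioc (t / 2) t) :=
            (hρ _ measurableSet_Ioc fun u hu => lt_of_le_of_lt (by linarith) hu.1).symm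
        _ ≤ ρ (Ioi (t / 2)) := measure_mono Ioc_subset_Ioi_self
    have hft := hfpos t (by linarith)
    calc ENNReal.ofReal (t / f t) = 2 * (ENNReal.ofReal (1 / f t) * ENNReal.ofReal (t / 2)) := by
          rw [show (2 : ℝ≥0∞) = ENNReal.ofReal 2 by simp, ← ENNReal.ofReal_mul (by positivity),
            ← ENNReal.ofReal_mul (by positivity)]
          congr 1
          field_simp
      _ ≤ _ := by gcongr
  have hlim3 : Tendsto (fun t => ENNReal.ofReal (t / f t)) atTop (𝓝 0) :=
    tendsto_of_tendsto_of_tendsto_of_le_of_le' tendsto_const_nhds hlim2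
      (Eventually.of_forall fun _ => zero_le) hbound
  have h4 := (ENNReal.tendsto_toReal ENNReal.zero_ne_top).comp hlim3
  rw [ENNReal.toReal_zero] at h4
  refine h4.congr' ?_
  filter_upwards [eventually_gt_atTop 0] with t ht
  exact ENNReal.toReal_ofReal (div_nonneg ht.le (hfpos t ht).le)

/-- Each term is compared with the integral over the unit interval to its left; the first such
interval is `(1, 2]`, whence the shift by 2. -/
lemma tsum_one_div_lt_top (hfpos : ∀ t, 0 < t → 0 < f t) (hfmono : MonotoneOn f (Ioi 0))
    (hint : (∫⁻ t in Ioi (1 : ℝ), ENNReal.ofReal (1 / f t)) < ⊤) :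
    ∑' n : ℕ, ENNReal.ofReal (1 / f ((n + 2 : ℕ) : ℝ)) < ⊤ := by
  refine lt_of_le_of_lt ?_ hint
  have hdisj : Pairwise (Function.onFun Disjoint fun n : ℕ => Ioc ((n : ℝ) + 1) (n + 2)) := by
    intro m n hmn
    rw [Function.onFun, Set.disjoint_left]
    rintro x ⟨h1, h2⟩ ⟨h3, h4⟩
    apply hmn
    have h5 : (m : ℝ) < n + 1 := by linarith
    have h6 : (n : ℝ) < m + 1 := by linarith
    norm_cast at h5 h6
    omega
  calc _ ≤ ∑' n : ℕ, ∫⁻ t in Ioc ((n : ℝ) + 1) (n + 2), ENNReal.ofReal (1 / f t) := by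
        refine ENNReal.tsum_le_tsum fun n => ?_
        calc _ = ∫⁻ _ in Ioc ((n : ℝ) + 1) (n + 2), ENNReal.ofReal (1 / f ((n + 2 : ℕ) : ℝ)) := by
              rw [setLIntegral_const, Real.volume_Ioc]
              ring_nf
              simp
          _ ≤ _ := by
              refine setLIntegral_mono' measurableSet_Ioc fun t ht => ?_
              refine ofReal_one_div_anti hfpos hfmono (lt_of_le_of_lt (by positivity) ht.1) ?_
              push_cast
              exact ht.2
    _ = ∫⁻ t in ⋃ n : ℕ, Ioc ((n : ℝ) + 1) (n + 2), ENNReal.ofReal (1 / f t) :=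
        (lintegral_iUnion (fun n => measurableSet_Ioc) hdisj _).symm
    _ ≤ _ := by
        refine lintegral_mono_set (iUnion_subset fun n t ht => ?_)
        have : (1 : ℝ) ≤ n + 1 := by simp
        exact lt_of_le_of_lt this ht.1

lemma lintegral_Ioi_eq_top (hfpos : ∀ t, 0 < t → 0 < f t) (hfmono : MonotoneOn f (Ioi 0))
    (hint : (∫⁻ t in Ioi (1 : ℝ), ENNReal.ofReal (1 / f t)) = ⊤) (a : ℝ) :
    (∫⁻ t in Ioi a, ENNReal.ofReal (1 / f t)) = ⊤ := by
  have hfin : (∫⁻ t in Ioc 1 (max 1 a), ENNReal.ofReal (1 / f t)) < ⊤ := by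
    calc _ ≤ ∫⁻ _ in Ioc 1 (max 1 a), ENNReal.ofReal (1 / f 1) := by
          refine setLIntegral_mono' measurableSet_Ioc fun t ht => ?_
          exact ofReal_one_div_anti hfpos hfmono one_pos ht.1.le
      _ < ⊤ := by
          rw [setLIntegral_const, Real.volume_Ioc]
          exact ENNReal.mul_lt_top ENNReal.ofReal_lt_top ENNReal.ofReal_lt_top
  rw [← Ioc_union_Ioi_eq_Ioi (le_max_left 1 a)] at hint
  have h1 := lintegral_union_le (μ := volume) (fun t => ENNReal.ofReal (1 / f t))
    (Ioc 1 (max 1 a)) (Ioi (max 1 a))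
  rw [hint, top_le_iff, ENNReal.add_eq_top] at h1
  refine top_le_iff.1 ((h1.resolve_left hfin.ne).symm.le.trans ?_)
  exact lintegral_mono_set (Ioi_subset_Ioi (le_max_right 1 a))

lemma tsum_one_div_eq_top (hfpos : ∀ t, 0 < t → 0 < f t) (hfmono : MonotoneOn f (Ioi 0))
    (hint : (∫⁻ t in Ioi (1 : ℝ), ENNReal.ofReal (1 / f t)) = ⊤) {J : ℕ} (hJ : 1 ≤ J) :
    ∑' n : ℕ, ENNReal.ofReal (1 / f ((n : ℝ) + J)) = ⊤ := by
  have hJ' : (1 : ℝ) ≤ J := by exact_mod_cast hJ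
  rw [← top_le_iff, ← lintegral_Ioi_eq_top hfpos hfmono hint J]
  calc _ ≤ ∫⁻ t in ⋃ n : ℕ, Ioc ((n : ℝ) + J) (n + J + 1), ENNReal.ofReal (1 / f t) := by
        refine lintegral_mono_set fun t ht => ?_
        have ht' : (J : ℝ) < t := ht
        rw [mem_iUnion]
        obtain ⟨k, hk⟩ : ∃ k, ⌈t - J⌉₊ = k + 1 :=
          Nat.exists_eq_succ_of_ne_zero (Nat.ceil_pos.2 (by linarith)).ne'
        refine ⟨k, ?_, ?_⟩
        · have := Nat.lt_ceil.1 (show k < ⌈t - J⌉₊ by omega)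
          linarith
        · have := Nat.ceil_le.1 hk.le
          push_cast at this
          linarith
    _ ≤ ∑' n : ℕ, ∫⁻ t in Ioc ((n : ℝ) + J) (n + J + 1), ENNReal.ofReal (1 / f t) :=
        lintegral_iUnion_le _ _
    _ ≤ _ := by
        refine ENNReal.tsum_le_tsum fun n => ?_
        calc _ ≤ ∫⁻ _ in Ioc ((n : ℝ) + J) (n + J + 1), ENNReal.ofReal (1 / f (n + J)) := by
              refine setLIntegral_mono' measurableSet_Ioc fun t ht => ?_
              exact ofReal_one_div_anti hfpos hfmono (by positivity) ht.1.le
          _ = _ := by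
              rw [setLIntegral_const, Real.volume_Ioc]
              simp

/-- Divergence of the integral of `1 / f` persists when `f` is replaced by `max f t`. -/
lemma lintegral_one_div_max_eq_top (hfpos : ∀ t, 0 < t → 0 < f t) (hfmono : MonotoneOn f (Ioi 0))
    (hint : (∫⁻ t in Ioi (1 : ℝ), ENNReal.ofReal (1 / f t)) = ⊤) :
    (∫⁻ t in Ioi (1 : ℝ), ENNReal.ofReal (1 / max (f t) t)) = ⊤ := by
  by_contra hcon
  have hpos : ∀ t, 0 < t → 0 < max (f t) t := fun t ht => lt_max_of_lt_right ht
  have hmono : MonotoneOn (fun t => max (f t) t) (Ioi 0) := fun s hs t ht hst =>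
    max_le_max (hfmono hs ht hst) hst
  -- If the integral with the maximum were finite, `t` would be negligible against the maximum. The
  -- maximum would then eventually be `f` itself, whose integral diverges.
  have hlim := tendsto_div_of_lintegral_lt_top hpos hmono (lt_top_iff_ne_top.2 hcon)
  obtain ⟨T, hT⟩ := eventually_atTop.1
    ((hlim.eventually (gt_mem_nhds one_pos)).and (eventually_ge_atTop 1))
  have h1 := lintegral_Ioi_eq_top hfpos hfmono hint (max 1 T)
  apply hcon
  rw [← top_le_iff, ← h1]
  calc _ = ∫⁻ t in Ioi (max 1 T), ENNReal.ofReal (1 / max (f t) t) := by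
        refine setLIntegral_congr_fun measurableSet_Ioi fun t ht => ?_
        have ht1 : 1 < t := (le_max_left 1 T).trans_lt ht
        have h2 := (hT t ((le_max_right 1 T).trans ht.le)).1
        rw [div_lt_one (hpos t (by linarith))] at h2
        have h3 : t < f t := by
          rcases lt_max_iff.1 h2 with h | h
          · exact h
          · exact absurd h (lt_irrefl _)
        simp only [max_eq_left h3.le]
    _ ≤ _ := lintegral_mono_set (Ioi_subset_Ioi (le_max_left 1 T))

end IntegralTest

/-! ### Borel–Cantelli and summability -/

section BorelCantelli

variable {Ω : Type*} [MeasurableSpace Ω] {P : Measure Ω}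

lemma ae_eventually_notMem_of_eventually_le {s : ℕ → Set Ω} {a : ℕ → ℝ≥0∞} {k : ℕ}
    (hs : ∀ᶠ n in atTop, P (s n) ≤ a n) (ha : ∑' n, a (n + k) < ⊤) :
    ∀ᵐ ω ∂P, ∀ᶠ n in atTop, ω ∉ s n := by
  obtain ⟨M, hM⟩ := eventually_atTop.1 hs
  have h1 : ∑' n, P (s (n + k + M)) ≠ ⊤ := by
    refine (lt_of_le_of_lt ?_ ha).ne
    calc _ ≤ ∑' n, a (n + k + M) := ENNReal.tsum_le_tsum fun n => hM _ (by omega)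
      _ = ∑' n, (fun m => a (m + k)) (n + M) := by
          refine tsum_congr fun n => ?_
          simp only
          congr 1
          omega
      _ ≤ _ := ENNReal.tsum_comp_le_tsum_of_injective (add_left_injective M) _
  filter_upwards [ae_eventually_notMem h1] with ω hω
  obtain ⟨K, hK⟩ := eventually_atTop.1 hω
  filter_upwards [eventually_ge_atTop (K + k + M)] with n hn
  have := hK (n - k - M) (by omega)
  rwa [show n - k - M + k + M = n by omega] at this

/-- Exponential decay beats `x^(-2/a)`, which at `x = n^a` is the summable `n⁻²`. -/
lemma summable_exp_neg_mul_rpow {a c : ℝ} (ha : 0 < a) (hc : 0 < c) :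
    Summable fun n : ℕ => Real.exp (-c * (n : ℝ) ^ a) := by
  have h1 : (fun x : ℝ => Real.exp (-c * x)) =o[atTop] fun x => x ^ (-(2 / a)) :=
    isLittleO_exp_neg_mul_rpow_atTop hc _
  have h2 : Tendsto (fun n : ℕ => (n : ℝ) ^ a) atTop atTop :=
    (tendsto_rpow_atTop ha).comp tendsto_natCast_atTop_atTop
  refine summable_of_isBigO_nat (Real.summable_nat_rpow.2 (show (-2 : ℝ) < -1 by norm_num)) ?_
  refine ((h1.comp_tendsto h2).isBigO).trans (Eventually.isBigO ?_)
  filter_upwards with n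
  rw [Function.comp_apply, ← Real.rpow_mul (by positivity), Real.norm_of_nonneg (by positivity)]
  apply le_of_eq
  congr 1
  field_simp

lemma tsum_ofReal_exp_lt_top {a c : ℝ} (ha : 0 < a) (hc : 0 < c) :
    ∑' n : ℕ, ENNReal.ofReal (Real.exp (-c * (n : ℝ) ^ a)) < ⊤ := by
  rw [← ENNReal.ofReal_tsum_of_nonneg (fun n => (Real.exp_pos _).le)
    (summable_exp_neg_mul_rpow ha hc)]
  exact ENNReal.ofReal_lt_top

end BorelCantelli


/-! ### Almost sure bounds for past and recent jumps -/

section UpperBounds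

variable {Ω : Type*} [MeasurableSpace Ω] {P : Measure Ω} [IsProbabilityMeasure P]
  {d : ℕ} {lam : Measure ℝ} {N : Ω → Measure (ℝ × Space d × ℝ)}

lemma ae_apply_space_zero (hN : IsPoissonRandomMeasure P N (jumpIntensity d lam)) (hd : 1 ≤ d)
    [SFinite lam] : ∀ᵐ ω ∂P, ∀ᵐ p ∂(N ω), p.2.1 ≠ 0 := by
  have hm : MeasurableSet {p : ℝ × Space d × ℝ | p.2.1 = 0} :=
    (measurable_snd.fst) (measurableSet_singleton (0 : Space d))
  have : Nonempty (Fin d) := ⟨⟨0, by omega⟩⟩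
  have h0 : jumpIntensity d lam {p | p.2.1 = 0} = 0 := by
    rw [← lintegral_indicator_one hm, lintegral_jumpIntensity (measurable_one.indicator hm)]
    have h1 : ∀ (s z : ℝ), ∫⁻ y : Space d, {p : ℝ × Space d × ℝ | p.2.1 = 0}.indicator
        (1 : ℝ × Space d × ℝ → ℝ≥0∞) (s, y, z) = 0 := by
      intro s z
      have h2 : ∀ y : Space d, {p : ℝ × Space d × ℝ | p.2.1 = 0}.indicator
        (1 : ℝ × Space d × ℝ → ℝ≥0∞) (s, y, z) = ({0} : Set (Space d)).indicator 1 y := fun y => rfl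
      simp_rw [h2]
      rw [lintegral_indicator_one (measurableSet_singleton 0), measure_singleton]
    simp [h1]
  filter_upwards [hN.ae_eq_zero hm h0] with ω hω
  rw [ae_iff]
  simpa using hω

/-- The contribution at time `n + 2` of the jumps before time `n - 1`. -/
noncomputable def pastSum (M : Measure (ℝ × Space d × ℝ)) (n : ℕ) : ℝ≥0∞ :=
  ∫⁻ p in {p | p.1 ≤ (n : ℝ) - 1}, jumpHeat ((n : ℝ) + 2) p ∂M

/-- The bound for the contribution of the jumps between the times `n - 1` and `n + 1`. -/
noncomputable def recentSum (M : Measure (ℝ × Space d × ℝ)) (n : ℕ) : ℝ≥0∞ :=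
  ∫⁻ p in {p | p.1 ∈ Ioc ((n : ℝ) - 1) (n + 1)}, recentJump p ∂M

lemma measurableSet_pastTimes (a : ℝ) : MeasurableSet {p : ℝ × Space d × ℝ | p.1 ≤ a} :=
  measurableSet_le measurable_fst measurable_const

lemma measurableSet_times {I : Set ℝ} (hI : MeasurableSet I) :
    MeasurableSet {p : ℝ × Space d × ℝ | p.1 ∈ I} := measurable_fst hI

/-- The age at `t` is at least 1 and the age at `n + 2` exceeds it by at most 2, hence is at most
three times as large. Monotonicity of `t^(d/2) g(t,x)` then gives the factor. -/
lemma jumpHeat_le_of_past {n t : ℝ} (h1 : n ≤ t) (h2 : t ≤ n + 1) {p : ℝ × Space d × ℝ}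
    (hp : p.1 ≤ n - 1) :
    jumpHeat t p ≤ ENNReal.ofReal (3 ^ ((d : ℝ) / 2)) * jumpHeat (n + 2) p := by
  rw [jumpHeat, jumpHeat, ← ENNReal.ofReal_mul (by positivity)]
  apply ENNReal.ofReal_le_ofReal
  have hs : 0 < t - p.1 := by linarith
  have h3 := rpow_mul_heatKernel_mono hs (show t - p.1 ≤ n + 2 - p.1 by linarith) p.2.1
  have h4 : (n + 2 - p.1) ^ ((d : ℝ) / 2) ≤ (3 * (t - p.1)) ^ ((d : ℝ) / 2) :=
    Real.rpow_le_rpow (by linarith) (by linarith) (by positivity)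
  rw [Real.mul_rpow (by norm_num) hs.le] at h4
  have h5 : heatKernel d (t - p.1) p.2.1
      ≤ 3 ^ ((d : ℝ) / 2) * heatKernel d (n + 2 - p.1) p.2.1 := by
    have h6 : 0 < (t - p.1) ^ ((d : ℝ) / 2) := by positivity
    refine le_of_mul_le_mul_left ?_ h6
    calc _ ≤ _ := h3
      _ ≤ 3 ^ ((d : ℝ) / 2) * (t - p.1) ^ ((d : ℝ) / 2) * heatKernel d (n + 2 - p.1) p.2.1 := by
          gcongr
          exact heatKernel_nonneg _ _
      _ = _ := by ring
  rw [← mul_assoc]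
  gcongr

/-- Countably many variables control all times simultaneously. Jumps after `n - 1` have age at most
2 at time `t`, which is the range of `recentJump`; jumps after `n + 1` have not happened yet. -/
lemma lintegral_jumpHeat_le_pastSum_add_recentSum {M : Measure (ℝ × Space d × ℝ)}
    (hM : ∀ᵐ p ∂M, p.2.1 ≠ 0) {n : ℕ} {t : ℝ} (h1 : n ≤ t) (h2 : t ≤ n + 1) :
    ∫⁻ p, jumpHeat t p ∂M ≤ ENNReal.ofReal (3 ^ ((d : ℝ) / 2)) * pastSum M n
      + ENNReal.ofReal (heatBound d) * recentSum M n := by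
  have hm1 := measurableSet_pastTimes (d := d) ((n : ℝ) - 1)
  have hm2 := measurableSet_times (d := d) (measurableSet_Ioc (a := (n : ℝ) - 1) (b := n + 1))
  rw [pastSum, recentSum, ← lintegral_indicator hm1, ← lintegral_indicator hm2,
    ← lintegral_const_mul _ ((measurable_jumpHeat _).indicator hm1),
    ← lintegral_const_mul _ (measurable_recentJump.indicator hm2),
    ← lintegral_add_left (((measurable_jumpHeat _).indicator hm1).const_mul _)]
  refine lintegral_mono_ae ?_
  filter_upwards [hM] with p hp
  rcases le_or_gt p.1 ((n : ℝ) - 1) with hs | hs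
  · rw [indicator_of_mem (show p ∈ {p : ℝ × Space d × ℝ | p.1 ≤ (n : ℝ) - 1} from hs)]
    exact le_add_right (jumpHeat_le_of_past h1 h2 hs)
  · refine le_add_left ?_
    rcases le_or_gt p.1 ((n : ℝ) + 1) with hs' | hs'
    · rw [indicator_of_mem (show p ∈ {p : ℝ × Space d × ℝ | p.1 ∈ Ioc ((n : ℝ) - 1) (n + 1)}
        from ⟨hs, hs'⟩)]
      exact jumpHeat_le_recentJump hp (by linarith)
    · rw [jumpHeat, heatKernel_of_nonpos (by linarith)]
      simp

lemma ae_pastSum_lt_top (hN : IsPoissonRandomMeasure P N (jumpIntensity d lam)) [SFinite lam]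
    (hκ : ∫⁻ z, ENNReal.ofReal |z| ∂lam < ⊤) : ∀ᵐ ω ∂P, ∀ n, pastSum (N ω) n < ⊤ := by
  rw [ae_all_iff]
  intro n
  have h1 := hN.ae_lintegral_lt_top (measurable_jumpHeat ((n : ℝ) + 2)) (by
    rw [lintegral_jumpHeat]
    exact ENNReal.mul_lt_top ENNReal.ofReal_lt_top hκ)
  filter_upwards [h1] with ω hω
  exact (setLIntegral_le_lintegral _ _).trans_lt hω

/-- The mean need not be finite, because `1/v` is not integrable at 0. Values above 1 have finite
intensity, hence a finite sum, and the others have finite mean. -/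
lemma ae_recentSum_lt_top (hN : IsPoissonRandomMeasure P N (jumpIntensity d lam)) (hd : 1 ≤ d)
    (hlam : IsLevyMeasure lam) (hκ : ∫⁻ z, ENNReal.ofReal |z| ∂lam < ⊤)
    (hlog : IntegrableOn (fun z : ℝ => |z * Real.log z|) (Icc (-1) 1) lam) :
    ∀ᵐ ω ∂P, ∀ n, recentSum (N ω) n < ⊤ := by
  have := hlam.sigmaFinite
  rw [ae_all_iff]
  intro n
  have hvol : volume (Ioc ((n : ℝ) - 1) (n + 1)) < ⊤ := measure_Ioc_lt_top
  set I := Ioc ((n : ℝ) - 1) (n + 1) with hI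
  have hIm : MeasurableSet I := measurableSet_Ioc
  have hmA := measurableSet_prod_recentJump (d := d) hIm (ENNReal.ofReal 1)
  have hmB : MeasurableSet {p : ℝ × Space d × ℝ | p.1 ∈ I ∧ recentJump p ≤ ENNReal.ofReal 1} :=
    (measurable_fst hIm).inter (measurableSet_le measurable_recentJump measurable_const)
  have h1 := hN.ae_setLIntegral_lt_top hmA ((jumpIntensity_recentJump_le hd hIm one_pos).trans_lt (by
    simp only [ENNReal.ofReal_one, div_one]
    exact ENNReal.mul_lt_top hvol (ENNReal.mul_lt_top volume_ball_lt_top hκ)))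
    measurable_recentJump (fun p => ENNReal.ofReal_lt_top)
  have h2 := hN.ae_lintegral_lt_top (measurable_recentJump.indicator hmB) (by
    rw [lintegral_indicator hmB]
    refine (lintegral_recentJump_le hd hlam hIm le_rfl).trans_lt ?_
    refine ENNReal.mul_lt_top hvol (ENNReal.mul_lt_top volume_ball_lt_top ?_)
    exact ENNReal.add_lt_top.2 ⟨ENNReal.mul_lt_top hκ ENNReal.ofReal_lt_top,
      hlog.lintegral_lt_top⟩)
  filter_upwards [h1, h2] with ω hω1 hω2
  rw [lintegral_indicator hmB] at hω2
  have hunion : {p : ℝ × Space d × ℝ | p.1 ∈ I} = {p | p.1 ∈ I ∧ ENNReal.ofReal 1 < recentJump p}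
      ∪ {p | p.1 ∈ I ∧ recentJump p ≤ ENNReal.ofReal 1} := by
    ext p
    simp only [mem_ofPred_eq, mem_union, ← and_or_left, lt_or_ge, and_true]
  rw [recentSum, ← hI, hunion]
  exact (lintegral_union_le _ _ _).trans_lt (ENNReal.add_lt_top.2 ⟨hω1, hω2⟩)

/-- The contribution of past jumps grows at most linearly. -/
lemma ae_eventually_pastSum_le (hN : IsPoissonRandomMeasure P N (jumpIntensity d lam))
    (hd : 1 ≤ d) [SFinite lam]
    (hmoment : ∃ ε : ℝ, 0 < ε ∧ Integrable (fun z : ℝ => |z| ^ (1 + ε)) lam)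
    (hκ : ∫⁻ z, ENNReal.ofReal |z| ∂lam < ⊤) :
    ∀ᵐ ω ∂P, ∃ K : ℝ, 0 ≤ K ∧ ∀ᶠ n : ℕ in atTop, pastSum (N ω) n ≤ ENNReal.ofReal (K * n) := by
  obtain ⟨ε, hε, hm⟩ := hmoment
  -- Chosen so that `β < 1 < β (1 + ε)`: the first inequality serves the Chernoff bound, the second
  -- the finiteness of `largeJumps`.
  set β : ℝ := (1 + ε / 2) / (1 + ε) with hβ
  have hβ0 : 0 < β := by positivity
  have hβ1 : β < 1 := by
    rw [hβ, div_lt_one (by positivity)]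
    linarith
  have hβε : 1 < β * (1 + ε) := by
    rw [hβ, div_mul_cancel₀ _ (by positivity)]
    linarith
  set κ : ℝ := (∫⁻ z, ENNReal.ofReal |z| ∂lam).toReal with hκr
  have hκ0 : 0 ≤ κ := ENNReal.toReal_nonneg
  have hκe : ∫⁻ z, ENNReal.ofReal |z| ∂lam = ENNReal.ofReal κ :=
    (ENNReal.ofReal_toReal hκ.ne).symm
  set C := heatBound d with hC
  have hC0 : 0 < C := one_pos.trans_le one_le_heatBound
  have hD := measurableSet_largeJumps (d := d) β
  have hy0 : MeasurableSet {p : ℝ × Space d × ℝ | p.2.1 ≠ 0} :=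
    (measurable_snd.fst) (measurableSet_singleton (0 : Space d)).compl
  let A : ℕ → Set (ℝ × Space d × ℝ) := fun n =>
    ({p | p.1 ≤ (n : ℝ) - 1} ∩ (largeJumps d β)ᶜ) ∩ {p | p.2.1 ≠ 0}
  have hA : ∀ n, MeasurableSet (A n) := fun n =>
    ((measurableSet_pastTimes _).inter hD.compl).inter hy0
  let h : ℕ → ℝ × Space d × ℝ → ℝ≥0∞ := fun n => (A n).indicator (jumpHeat ((n : ℝ) + 2))
  have hhm : ∀ n, Measurable (h n) := fun n => (measurable_jumpHeat _).indicator (hA n)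
  -- The mean is at most `(n+2)κ ≤ 3nκ` and single contributions are at most `b = C n^β`. With `θ =
  -- 1/b` the Chernoff exponent is exactly `-n^(1-β)`.
  set K₀ : ℝ := 3 * Real.exp 1 * κ + C with hK₀
  have hbad : ∀ᶠ n : ℕ in atTop, P {ω | ENNReal.ofReal (K₀ * n) < ∫⁻ p, h n p ∂(N ω)}
      ≤ ENNReal.ofReal (Real.exp (-1 * (n : ℝ) ^ (1 - β))) := by
    filter_upwards [eventually_ge_atTop 1] with n hn
    have hn1 : (1 : ℝ) ≤ n := by exact_mod_cast hn
    have hn0 : (0 : ℝ) < n := by linarith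
    set b : ℝ := C * (n : ℝ) ^ β with hb
    have hb0 : 0 < b := by positivity
    have hle : ∀ p, h n p ≤ ENNReal.ofReal b := by
      intro p
      by_cases hp : p ∈ A n
      · simp only [h, indicator_of_mem hp]
        have hp1 : p.1 ≤ (n : ℝ) - 1 := hp.1.1
        refine (jumpHeat_le_pastJump hp.2 (by linarith)).trans ?_
        have hp2 : pastJump p ≤ ENNReal.ofReal (max 1 p.1 ^ β) := not_lt.1 hp.1.2
        rw [hb, ENNReal.ofReal_mul hC0.le]
        gcongr
        refine hp2.trans (ENNReal.ofReal_le_ofReal ?_)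
        apply Real.rpow_le_rpow (by positivity) _ hβ0.le
        exact max_le hn1 (by linarith)
      · simp only [h, indicator_of_notMem hp]
        exact zero_le
    have hT : ∫⁻ p, h n p ∂(jumpIntensity d lam) ≤ ENNReal.ofReal (3 * n * κ) := by
      calc _ ≤ ∫⁻ p, jumpHeat ((n : ℝ) + 2) p ∂(jumpIntensity d lam) :=
            lintegral_mono fun p => indicator_le_self _ _ p
        _ = ENNReal.ofReal (((n : ℝ) + 2) * κ) := by
            rw [lintegral_jumpHeat, hκe, ENNReal.ofReal_mul (by positivity)]
        _ ≤ _ := by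
            apply ENNReal.ofReal_le_ofReal
            gcongr
            linarith
    have hch := hN.measure_lt_lintegral_le (hhm n) (x := K₀ * n) (θ := b⁻¹) (by positivity) hle hT
      (by positivity)
    refine hch.trans (ENNReal.ofReal_le_ofReal (Real.exp_le_exp.2 (le_of_eq ?_)))
    have hpow : (n : ℝ) ^ (1 - β) = n / (n : ℝ) ^ β := by
      rw [Real.rpow_sub hn0, Real.rpow_one]
    rw [inv_mul_cancel₀ hb0.ne', hpow, hK₀, hb]
    field_simp
    ring
  have hsum : ∑' n : ℕ, ENNReal.ofReal (Real.exp (-1 * ((n + 0 : ℕ) : ℝ) ^ (1 - β))) < ⊤ :=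
    tsum_ofReal_exp_lt_top (sub_pos.2 hβ1) one_pos
  have hBC := ae_eventually_notMem_of_eventually_le (k := 0)
    (a := fun n : ℕ => ENNReal.ofReal (Real.exp (-1 * (n : ℝ) ^ (1 - β)))) hbad hsum
  -- The large jumps add up to one finite random constant that serves for every `n`.
  have hlarge := hN.ae_setLIntegral_lt_top hD (jumpIntensity_largeJumps_lt_top hd hε hβε hm)
    measurable_pastJump (fun p => ENNReal.ofReal_lt_top)
  filter_upwards [hBC, hlarge, ae_apply_space_zero hN hd] with ω h1 h2 h3
  set L : ℝ := (∫⁻ p in largeJumps d β, pastJump p ∂(N ω)).toReal with hL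
  have hLe : ∫⁻ p in largeJumps d β, pastJump p ∂(N ω) = ENNReal.ofReal L :=
    (ENNReal.ofReal_toReal h2.ne).symm
  have hL0 : 0 ≤ L := ENNReal.toReal_nonneg
  refine ⟨K₀ + C * L, by positivity, ?_⟩
  filter_upwards [h1, eventually_ge_atTop 1] with n hn hn1
  have hn1' : (1 : ℝ) ≤ n := by exact_mod_cast hn1
  have hn' : ∫⁻ p, h n p ∂(N ω) ≤ ENNReal.ofReal (K₀ * n) := not_lt.1 hn
  calc pastSum (N ω) n
      ≤ ∫⁻ p, (h n p + (largeJumps d β).indicator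
          (fun p => ENNReal.ofReal C * pastJump p) p) ∂(N ω) := by
        rw [pastSum, ← lintegral_indicator (measurableSet_pastTimes _)]
        refine lintegral_mono_ae ?_
        filter_upwards [h3] with p hp
        by_cases hp1 : p ∈ {p : ℝ × Space d × ℝ | p.1 ≤ (n : ℝ) - 1}
        · rw [indicator_of_mem hp1]
          by_cases hp2 : p ∈ largeJumps d β
          · rw [indicator_of_mem hp2]
            have hp1' : p.1 ≤ (n : ℝ) - 1 := hp1
            exact le_add_left (jumpHeat_le_pastJump hp (by linarith))
          · refine le_add_right ?_
            simp only [h]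
            rw [indicator_of_mem (show p ∈ A n from ⟨⟨hp1, hp2⟩, hp⟩)]
        · rw [indicator_of_notMem hp1]
          exact zero_le
    _ = ∫⁻ p, h n p ∂(N ω) + ENNReal.ofReal C * ENNReal.ofReal L := by
        rw [lintegral_add_left (hhm n), lintegral_indicator hD,
          lintegral_const_mul _ measurable_pastJump, hLe]
    _ ≤ ENNReal.ofReal (K₀ * n) + ENNReal.ofReal (C * L * n) := by
        rw [← ENNReal.ofReal_mul hC0.le]
        exact add_le_add hn' (ENNReal.ofReal_le_ofReal
          (le_mul_of_one_le_right (by positivity) hn1'))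
    _ = _ := by
        rw [← ENNReal.ofReal_add (by positivity) (by positivity)]
        congr 1
        ring

/-- The contribution of recent jumps is negligible compared with `f` if `1 / f` is integrable. -/
lemma ae_eventually_recentSum_le (hN : IsPoissonRandomMeasure P N (jumpIntensity d lam))
    (hd : 1 ≤ d) (hlam : IsLevyMeasure lam) (hκ : ∫⁻ z, ENNReal.ofReal |z| ∂lam < ⊤)
    (hlog : IntegrableOn (fun z : ℝ => |z * Real.log z|) (Icc (-1) 1) lam) {f : ℝ → ℝ}
    (hfpos : ∀ t, 0 < t → 0 < f t) (hfmono : MonotoneOn f (Ioi 0))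
    (hint : (∫⁻ t in Ioi (1 : ℝ), ENNReal.ofReal (1 / f t)) < ⊤) {η : ℝ} (hη : 0 < η) :
    ∀ᵐ ω ∂P, ∀ᶠ n : ℕ in atTop, recentSum (N ω) n ≤ ENNReal.ofReal (8 * η * f n) := by
  have := hlam.sigmaFinite
  set κ : ℝ := (∫⁻ z, ENNReal.ofReal |z| ∂lam).toReal with hκr
  have hκ0 : 0 ≤ κ := ENNReal.toReal_nonneg
  have hκe : ∫⁻ z, ENNReal.ofReal |z| ∂lam = ENNReal.ofReal κ :=
    (ENNReal.ofReal_toReal hκ.ne).symm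
  set L : ℝ := (∫⁻ z in Icc (-1) 1, ENNReal.ofReal |z * Real.log z| ∂lam).toReal with hLr
  have hL0 : 0 ≤ L := ENNReal.toReal_nonneg
  have hLe : ∫⁻ z in Icc (-1) 1, ENNReal.ofReal |z * Real.log z| ∂lam = ENNReal.ofReal L :=
    (ENNReal.ofReal_toReal hlog.lintegral_lt_top.ne).symm
  set w : ℝ := (volume (Metric.ball (0 : Space d) 1)).toReal with hwr
  have hw0 : 0 ≤ w := ENNReal.toReal_nonneg
  have hwe : volume (Metric.ball (0 : Space d) 1) = ENNReal.ofReal w :=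
    (ENNReal.ofReal_toReal volume_ball_lt_top.ne).symm
  let I : ℕ → Set ℝ := fun n => Ioc ((n : ℝ) - 1) (n + 1)
  have hIm : ∀ n, MeasurableSet (I n) := fun n => measurableSet_Ioc
  have hIv : ∀ n, volume (I n) = ENNReal.ofReal 2 := fun n => by
    rw [Real.volume_Ioc]
    congr 1
    ring
  let b : ℕ → ℝ := fun n => η * f n
  let A : ℕ → Set (ℝ × Space d × ℝ) := fun n =>
    {p | p.1 ∈ I n ∧ ENNReal.ofReal (b n) < recentJump p}
  let B : ℕ → Set (ℝ × Space d × ℝ) := fun n =>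
    {p | p.1 ∈ I n ∧ recentJump p ≤ ENNReal.ofReal (b n)}
  have hA : ∀ n, MeasurableSet (A n) := fun n => measurableSet_prod_recentJump (hIm n) _
  have hB : ∀ n, MeasurableSet (B n) := fun n =>
    (measurable_fst (hIm n)).inter (measurableSet_le measurable_recentJump measurable_const)
  let h : ℕ → ℝ × Space d × ℝ → ℝ≥0∞ := fun n => (B n).indicator recentJump
  have hhm : ∀ n, Measurable (h n) := fun n => measurable_recentJump.indicator (hB n)
  have hb1 : ∀ᶠ n : ℕ in atTop, 1 ≤ b n := by
    have hlim := (tendsto_div_of_lintegral_lt_top hfpos hfmono hint).comp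
      tendsto_natCast_atTop_atTop
    filter_upwards [hlim.eventually (gt_mem_nhds hη), eventually_ge_atTop 1] with n hn hn1
    have hn1' : (1 : ℝ) ≤ n := by exact_mod_cast hn1
    have hf := hfpos n (by linarith)
    simp only [Function.comp_apply] at hn
    rw [div_lt_iff₀ hf] at hn
    exact hn1'.trans hn.le
  set c : ℝ := 2 * (w * (κ + L)) with hc
  have hc0 : 0 ≤ c := by positivity
  have hbadA : ∀ᶠ n : ℕ in atTop, P {ω | N ω (A n) ≠ 0}
      ≤ ENNReal.ofReal (c / η) * ENNReal.ofReal (1 / f n) := by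
    filter_upwards [hb1, eventually_ge_atTop 1] with n hn hn1
    have hn1' : (1 : ℝ) ≤ n := by exact_mod_cast hn1
    have hf := hfpos n (by linarith)
    have hbn : 0 < b n := by linarith
    refine (hN.measure_apply_ne_zero_le (hA n)).trans ?_
    refine (jumpIntensity_recentJump_le hd (hIm n) hbn).trans ?_
    rw [hIv, hwe, hκe, ← ENNReal.ofReal_div_of_pos hbn, ← ENNReal.ofReal_mul hw0,
      ← ENNReal.ofReal_mul (by norm_num), ← ENNReal.ofReal_mul (by positivity)]
    apply ENNReal.ofReal_le_ofReal
    calc 2 * (w * (κ / b n)) = 2 * (w * κ) / η * (1 / f n) := by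
          simp only [b]
          field_simp
      _ ≤ _ := by
          gcongr
          rw [hc]
          gcongr
          linarith
  have hbadB : ∀ᶠ n : ℕ in atTop, P {ω | ENNReal.ofReal (8 * b n) < ∫⁻ p, h n p ∂(N ω)}
      ≤ ENNReal.ofReal (Real.exp (5 * c) / η) * ENNReal.ofReal (1 / f n) := by
    filter_upwards [hb1, eventually_ge_atTop 1] with n hn hn1
    have hn1' : (1 : ℝ) ≤ n := by exact_mod_cast hn1
    have hf := hfpos n (by linarith)
    have hbn : 0 < b n := by linarith
    have hlog0 : 0 ≤ Real.log (b n) := Real.log_nonneg hn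
    have hle : ∀ p, h n p ≤ ENNReal.ofReal (b n) := by
      intro p
      by_cases hp : p ∈ B n
      · simp only [h, indicator_of_mem hp]
        exact hp.2
      · simp only [h, indicator_of_notMem hp]
        exact zero_le
    have hT : ∫⁻ p, h n p ∂(jumpIntensity d lam) ≤ ENNReal.ofReal (c * (1 + Real.log (b n))) := by
      simp only [h]
      rw [lintegral_indicator (hB n)]
      refine (lintegral_recentJump_le hd hlam (hIm n) hn).trans ?_
      rw [hIv, hwe, hκe, hLe, ← ENNReal.ofReal_mul hκ0,
        ← ENNReal.ofReal_add (by positivity) hL0, ← ENNReal.ofReal_mul hw0,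
        ← ENNReal.ofReal_mul (by norm_num)]
      apply ENNReal.ofReal_le_ofReal
      rw [hc, mul_assoc, mul_assoc]
      gcongr
      nlinarith
    -- With `θ = log b / (4b)` the factor `exp (θb)` is only `b^(1/4)`, so the mean adds at most a
    -- constant to the exponent, while the level `8b` yields `-2 log b`. One `log b` suffices for a
    -- bound of order `1/b`.
    have hch := hN.measure_lt_lintegral_le (hhm n) (x := 8 * b n)
      (θ := Real.log (b n) / 4 / b n) (by positivity) hle hT (by positivity)
    refine hch.trans ?_
    rw [← ENNReal.ofReal_mul (by positivity)]
    apply ENNReal.ofReal_le_ofReal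
    set l := Real.log (b n) with hl
    set q := (b n) ^ (1 / 4 : ℝ) with hq
    have hq1 : 1 ≤ q := Real.one_le_rpow hn (by norm_num)
    have hq4 : q ^ 4 = b n := by
      rw [hq, ← Real.rpow_natCast, ← Real.rpow_mul hbn.le]
      norm_num
    have hlq : l ≤ 4 * q := by
      have := Real.log_le_rpow_div hbn.le (show (0 : ℝ) < 1 / 4 by norm_num)
      rw [← hq, ← hl] at this
      linarith
    have hexp : Real.exp (l / 4 / b n * b n) = q := by
      rw [div_mul_cancel₀ _ hbn.ne', hq, Real.rpow_def_of_pos hbn]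
      congr 1
      ring
    have hmain : -(l / 4 / b n) * (8 * b n) + l / 4 / b n * Real.exp (l / 4 / b n * b n) *
        (c * (1 + l)) ≤ -l + 5 * c := by
      rw [hexp]
      have h1 : -(l / 4 / b n) * (8 * b n) = -2 * l := by
        field_simp
        ring
      have h2 : l / 4 / b n * q * (c * (1 + l)) ≤ 5 * c := by
        rw [← hq4]
        have h3 : l / 4 / q ^ 4 * q * (c * (1 + l)) = c * (l * (1 + l) / (4 * q ^ 3)) := by
          field_simp
        rw [h3, mul_comm 5 c]
        gcongr
        rw [div_le_iff₀ (by positivity)]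
        calc l * (1 + l) ≤ 4 * q * (1 + 4 * q) := by gcongr
          _ ≤ 5 * (4 * q ^ 3) := by nlinarith [mul_nonneg (sub_nonneg.2 hq1) (sub_nonneg.2 hq1)]
      linarith
    calc _ ≤ Real.exp (-l + 5 * c) := Real.exp_le_exp.2 hmain
      _ = Real.exp (5 * c) / η * (1 / f n) := by
          rw [Real.exp_add, Real.exp_neg, hl, Real.exp_log hbn]
          simp only [b]
          field_simp
  have hsum : ∀ a : ℝ, ∑' n : ℕ, (ENNReal.ofReal a * ENNReal.ofReal (1 / f ((n + 2 : ℕ) : ℝ)))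
      < ⊤ := fun a => by
    rw [ENNReal.tsum_mul_left]
    exact ENNReal.mul_lt_top ENNReal.ofReal_lt_top (tsum_one_div_lt_top hfpos hfmono hint)
  have hBC1 := ae_eventually_notMem_of_eventually_le (k := 2)
    (a := fun n : ℕ => ENNReal.ofReal (c / η) * ENNReal.ofReal (1 / f n)) hbadA (hsum _)
  have hBC2 := ae_eventually_notMem_of_eventually_le (k := 2)
    (a := fun n : ℕ => ENNReal.ofReal (Real.exp (5 * c) / η) * ENNReal.ofReal (1 / f n))
    hbadB (hsum _)
  filter_upwards [hBC1, hBC2] with ω h1 h2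
  filter_upwards [h1, h2] with n hn1 hn2
  have hn1' : N ω (A n) = 0 := not_not.1 hn1
  have hn2' : ∫⁻ p, h n p ∂(N ω) ≤ ENNReal.ofReal (8 * b n) := not_lt.1 hn2
  have hunion : {p : ℝ × Space d × ℝ | p.1 ∈ I n} = A n ∪ B n := by
    ext p
    simp only [A, B, mem_ofPred_eq, mem_union, ← and_or_left, lt_or_ge, and_true]
  calc recentSum (N ω) n = ∫⁻ p in A n ∪ B n, recentJump p ∂(N ω) := by
        rw [recentSum, ← hunion]
    _ ≤ ∫⁻ p in A n, recentJump p ∂(N ω) + ∫⁻ p in B n, recentJump p ∂(N ω) :=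
        lintegral_union_le _ _ _
    _ = ∫⁻ p, h n p ∂(N ω) := by
        simp only [h]
        rw [setLIntegral_measure_zero _ _ hn1', zero_add, lintegral_indicator (hB n)]
    _ ≤ _ := hn2'
    _ = _ := by
        simp only [b]
        congr 1
        ring

end UpperBounds


/-! ### Absolute convergence and the case of integrable `1/f` -/

section Solution

variable {d : ℕ} {lam : Measure ℝ}

lemma measurable_mildKernel (t : ℝ) : Measurable (mildKernel (d := d) t 0) := by
  have : mildKernel (d := d) t 0 = fun q => heatKernel d (t - q.1) q.2 :=
    funext fun q => mildKernel_zero t q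
  rw [this]
  exact measurable_heatKernel.comp (f := fun q : ℝ × Space d => (t - q.1, q.2)) (by fun_prop)

lemma mildKernel_nonneg (t : ℝ) (q : ℝ × Space d) : 0 ≤ mildKernel t 0 q := by
  rw [mildKernel_zero]
  exact heatKernel_nonneg _ _

lemma lintegral_mildKernel (t : ℝ) :
    ∫⁻ q, ENNReal.ofReal (mildKernel t 0 q) ∂(spaceTimeVolume d) = ENNReal.ofReal t := by
  rw [spaceTimeVolume, lintegral_prod _ (measurable_mildKernel t).ennreal_ofReal.aemeasurable]
  have h1 : ∀ s : ℝ, ∫⁻ y : Space d, ENNReal.ofReal (mildKernel t 0 (s, y))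
      = (Iio t).indicator 1 s := by
    intro s
    simp_rw [mildKernel_zero]
    by_cases hs : s < t
    · rw [lintegral_heatKernel (by linarith), indicator_of_mem (show s ∈ Iio t from hs)]
      rfl
    · rw [indicator_of_notMem (show s ∉ Iio t from hs)]
      simp only [heatKernel_of_nonpos (sub_nonpos.2 (not_lt.1 hs))]
      simp
  simp_rw [h1]
  rw [lintegral_indicator_one measurableSet_Iio, Measure.restrict_apply measurableSet_Iio,
    Iio_inter_Ioi, Real.volume_Ioo, sub_zero]

lemma integrable_mildKernel (t : ℝ) : Integrable (mildKernel t 0) (spaceTimeVolume d) := by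
  refine ⟨(measurable_mildKernel t).aestronglyMeasurable, ?_⟩
  rw [hasFiniteIntegral_iff_ofReal (ae_of_all _ (mildKernel_nonneg t)), lintegral_mildKernel]
  exact ENNReal.ofReal_lt_top

lemma integral_mildKernel {t : ℝ} (ht : 0 ≤ t) :
    ∫ q, mildKernel t 0 q ∂(spaceTimeVolume d) = t := by
  rw [integral_eq_lintegral_of_nonneg_ae (ae_of_all _ (mildKernel_nonneg t))
    (measurable_mildKernel t).aestronglyMeasurable, lintegral_mildKernel, ENNReal.toReal_ofReal ht]

lemma measurable_mildKernel_mul (t : ℝ) :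
    Measurable fun p : ℝ × Space d × ℝ => mildKernel t 0 (p.1, p.2.1) * p.2.2 :=
  ((measurable_mildKernel t).comp (f := fun p : ℝ × Space d × ℝ => (p.1, p.2.1))
    (by fun_prop)).mul (by fun_prop)

lemma jumpHeat_eq_ofReal_abs (t : ℝ) (p : ℝ × Space d × ℝ) :
    jumpHeat t p = ENNReal.ofReal |mildKernel t 0 (p.1, p.2.1) * p.2.2| := by
  rw [jumpHeat, abs_mul, abs_of_nonneg (mildKernel_nonneg t _), mildKernel_zero]

lemma integrable_mildKernel_mul {t : ℝ} {M : Measure (ℝ × Space d × ℝ)}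
    (hM : ∫⁻ p, jumpHeat t p ∂M < ⊤) :
    Integrable (fun p => mildKernel t 0 (p.1, p.2.1) * p.2.2) M := by
  refine ⟨(measurable_mildKernel_mul t).aestronglyMeasurable, ?_⟩
  rw [hasFiniteIntegral_iff_norm]
  simpa only [Real.norm_eq_abs, ← jumpHeat_eq_ofReal_abs] using hM

lemma mildSolution_eq {t : ℝ} (ht : 0 ≤ t) (m : ℝ) (M : Measure (ℝ × Space d × ℝ)) :
    mildSolution m lam M t 0
      = noiseDrift m lam * t + ∫ p, mildKernel t 0 (p.1, p.2.1) * p.2.2 ∂M := by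
  rw [mildSolution, noiseIntegral, integral_mildKernel ht]

lemma abs_mildSolution_le {t : ℝ} (ht : 0 ≤ t) (m : ℝ) (M : Measure (ℝ × Space d × ℝ)) :
    |mildSolution m lam M t 0| ≤ |noiseDrift m lam| * t + (∫⁻ p, jumpHeat t p ∂M).toReal := by
  rw [mildSolution_eq ht]
  refine (abs_add_le _ _).trans ?_
  rw [abs_mul, abs_of_nonneg ht]
  gcongr
  rw [← Real.norm_eq_abs]
  refine (norm_integral_le_lintegral_norm _).trans (le_of_eq ?_)
  simp only [Real.norm_eq_abs, ← jumpHeat_eq_ofReal_abs]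

variable {Ω : Type*} [MeasurableSpace Ω] {P : Measure Ω} [IsProbabilityMeasure P]
  {N : Ω → Measure (ℝ × Space d × ℝ)}

lemma ae_forall_lintegral_jumpHeat_lt_top
    (hN : IsPoissonRandomMeasure P N (jumpIntensity d lam)) (hd : 1 ≤ d)
    (hlam : IsLevyMeasure lam) (hκ : ∫⁻ z, ENNReal.ofReal |z| ∂lam < ⊤)
    (hlog : IntegrableOn (fun z : ℝ => |z * Real.log z|) (Icc (-1) 1) lam) :
    ∀ᵐ ω ∂P, ∀ t : ℝ, 0 ≤ t → ∫⁻ p, jumpHeat t p ∂(N ω) < ⊤ := by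
  have := hlam.sigmaFinite
  filter_upwards [ae_pastSum_lt_top hN hκ, ae_recentSum_lt_top hN hd hlam hκ hlog,
    ae_apply_space_zero hN hd] with ω h1 h2 h3 t ht
  refine (lintegral_jumpHeat_le_pastSum_add_recentSum h3 (Nat.floor_le ht)
    (Nat.lt_floor_add_one t).le).trans_lt (ENNReal.add_lt_top.2 ⟨?_, ?_⟩)
  · exact ENNReal.mul_lt_top ENNReal.ofReal_lt_top (h1 _)
  · exact ENNReal.mul_lt_top ENNReal.ofReal_lt_top (h2 _)

/-- The solution is negligible compared with `f` if `1 / f` is integrable. -/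
lemma ae_tendsto_mildSolution_div (hN : IsPoissonRandomMeasure P N (jumpIntensity d lam))
    (hd : 1 ≤ d) (m : ℝ) (hlam : IsLevyMeasure lam)
    (hmoment : ∃ ε : ℝ, 0 < ε ∧ Integrable (fun z : ℝ => |z| ^ (1 + ε)) lam)
    (hlog : IntegrableOn (fun z : ℝ => |z * Real.log z|) (Icc (-1) 1) lam) {f : ℝ → ℝ}
    (hfpos : ∀ t, 0 < t → 0 < f t) (hfmono : MonotoneOn f (Ioi 0))
    (hint : (∫⁻ t in Ioi (1 : ℝ), ENNReal.ofReal (1 / f t)) < ⊤) :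
    ∀ᵐ ω ∂P, Tendsto (fun t : ℝ => mildSolution m lam (N ω) t 0 / f t) atTop (𝓝 0) := by
  have := hlam.sigmaFinite
  have hκ := hlam.lintegral_abs_lt_top hmoment hlog
  have hlim := tendsto_div_of_lintegral_lt_top hfpos hfmono hint
  set C := heatBound d with hC
  have hC0 : 0 < C := one_pos.trans_le one_le_heatBound
  -- Countably many values of `η` leave a single null set for all `δ`.
  have hrec : ∀ᵐ ω ∂P, ∀ k : ℕ, ∀ᶠ n : ℕ in atTop,
      recentSum (N ω) n ≤ ENNReal.ofReal (8 * (1 / ((k : ℝ) + 1)) * f n) := by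
    rw [ae_all_iff]
    intro k
    exact ae_eventually_recentSum_le hN hd hlam hκ hlog hfpos hfmono hint (by positivity)
  filter_upwards [ae_eventually_pastSum_le hN hd hmoment hκ, hrec, ae_apply_space_zero hN hd]
    with ω ⟨K, hK0, hK⟩ h2 h3
  rw [Metric.tendsto_nhds]
  intro δ hδ
  obtain ⟨k, hk⟩ := exists_nat_one_div_lt (show 0 < δ / 2 / (8 * C) by positivity)
  set A : ℝ := |noiseDrift m lam| + 3 ^ ((d : ℝ) / 2) * K with hA
  have hA0 : 0 ≤ A := by positivity
  have hlimA : ∀ᶠ t in atTop, A * (t / f t) < δ / 2 := by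
    have := hlim.const_mul A
    rw [mul_zero] at this
    exact this.eventually (gt_mem_nhds (by positivity))
  have hfloor : Tendsto (fun t : ℝ => ⌊t⌋₊) atTop atTop := tendsto_nat_floor_atTop
  filter_upwards [hfloor.eventually hK, hfloor.eventually (h2 k), hlimA,
    eventually_ge_atTop (1 : ℝ)] with t ht1 ht2 ht3 ht4
  have ht0 : 0 < t := by linarith
  have hft := hfpos t ht0
  set n := ⌊t⌋₊ with hn
  have hnt : (n : ℝ) ≤ t := Nat.floor_le ht0.le
  have hn1 : 1 ≤ n := (Nat.one_le_floor_iff t).2 ht4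
  have hn0 : (0 : ℝ) < n := by exact_mod_cast hn1
  have hfn := hfpos n hn0
  have hfnt : f n ≤ f t := hfmono hn0 ht0 hnt
  set r : ℝ := 1 / ((k : ℝ) + 1) with hr
  have hr0 : 0 < r := by positivity
  have hZ : (∫⁻ p, jumpHeat t p ∂(N ω)).toReal
      ≤ 3 ^ ((d : ℝ) / 2) * (K * n) + C * (8 * r * f n) := by
    refine ENNReal.toReal_le_of_le_ofReal (by positivity) ?_
    refine (lintegral_jumpHeat_le_pastSum_add_recentSum h3 hnt
      (Nat.lt_floor_add_one t).le).trans ?_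
    rw [ENNReal.ofReal_add (by positivity) (by positivity), ENNReal.ofReal_mul (by positivity),
      ENNReal.ofReal_mul (p := C) hC0.le]
    gcongr
  have habs := abs_mildSolution_le (lam := lam) ht0.le m (N ω)
  rw [Real.dist_eq, sub_zero, abs_div, abs_of_pos hft, div_lt_iff₀ hft]
  have h5 : A * t < δ / 2 * f t := by
    rw [mul_div_assoc', div_lt_iff₀ hft] at ht3
    exact ht3
  have h6 : r * (8 * C) < δ / 2 := by rwa [lt_div_iff₀ (by positivity)] at hk
  calc _ ≤ |noiseDrift m lam| * t + (3 ^ ((d : ℝ) / 2) * (K * n) + C * (8 * r * f n)) := by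
        linarith
    _ ≤ |noiseDrift m lam| * t + (3 ^ ((d : ℝ) / 2) * (K * t) + C * (8 * r * f t)) := by gcongr
    _ = A * t + r * (8 * C) * f t := by rw [hA]; ring
    _ < δ / 2 * f t + δ / 2 * f t := by
        have := mul_lt_mul_of_pos_right h6 hft
        linarith
    _ = δ * f t := by ring

end Solution


/-! ### The one-sided law of large numbers -/

section LawOfLargeNumbers

variable {Ω : Type*} [MeasurableSpace Ω] {P : Measure Ω} [IsProbabilityMeasure P]
  {d : ℕ} {lam : Measure ℝ} {N : Ω → Measure (ℝ × Space d × ℝ)}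

/-- The contribution at time `n` of the jumps of size at most `b` before time `n - L`. -/
noncomputable def boundedPastSum (M : Measure (ℝ × Space d × ℝ)) (b : ℝ) (L n : ℕ) : ℝ≥0∞ :=
  ∫⁻ p in {p | p.1 ≤ (n : ℝ) - L ∧ |p.2.2| ≤ b}, jumpHeat (n : ℝ) p ∂M

lemma measurableSet_boundedPast (b a : ℝ) :
    MeasurableSet {p : ℝ × Space d × ℝ | p.1 ≤ a ∧ |p.2.2| ≤ b} :=
  (measurableSet_le measurable_fst measurable_const).inter
    (measurableSet_le (f := fun p : ℝ × Space d × ℝ => |p.2.2|) (by fun_prop) measurable_const)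

lemma lintegral_boundedPast [SFinite lam] (b : ℝ) {L : ℕ} (hL : 1 ≤ L) (n : ℕ) :
    boundedPastSum (jumpIntensity d lam) b L n = ENNReal.ofReal ((n : ℝ) - L) *
      ∫⁻ z in {z | |z| ≤ b}, ENNReal.ofReal |z| ∂lam := by
  have hb : MeasurableSet {z : ℝ | |z| ≤ b} := measurableSet_le (by fun_prop) measurable_const
  have hL' : (1 : ℝ) ≤ L := by exact_mod_cast hL
  have h := lintegral_heatKernel_mul (d := d) (lam := lam) n (measurableSet_Iic (a := (n : ℝ) - L))
    (w := {z | |z| ≤ b}.indicator fun z => ENNReal.ofReal |z|)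
    (Measurable.indicator (by fun_prop) hb)
  have hset : Iic ((n : ℝ) - L) ∩ Ioo 0 (n : ℝ) = Ioc 0 ((n : ℝ) - L) := by
    ext x
    simp only [mem_inter_iff, mem_Iic, mem_Ioo, mem_Ioc]
    constructor
    · rintro ⟨h1, h2, h3⟩
      exact ⟨h2, h1⟩
    · rintro ⟨h1, h2⟩
      exact ⟨h2, h1, by linarith⟩
  rw [hset, Real.volume_Ioc, sub_zero, lintegral_indicator hb] at h
  rw [← h, boundedPastSum, ← lintegral_indicator (measurableSet_boundedPast _ _)]
  refine lintegral_congr fun p => ?_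
  by_cases h1 : p.1 ≤ (n : ℝ) - L
  · rw [indicator_of_mem (show p.1 ∈ Iic ((n : ℝ) - L) from h1), Pi.one_apply, one_mul]
    by_cases h2 : |p.2.2| ≤ b
    · rw [indicator_of_mem (show p ∈ {p : ℝ × Space d × ℝ | p.1 ≤ (n : ℝ) - L ∧ |p.2.2| ≤ b} from
        ⟨h1, h2⟩), indicator_of_mem (show p.2.2 ∈ {z : ℝ | |z| ≤ b} from h2), jumpHeat,
        ENNReal.ofReal_mul (heatKernel_nonneg _ _)]
    · rw [indicator_of_notMem (fun h => h2 h.2), indicator_of_notMem (show p.2.2 ∉ {z : ℝ | |z| ≤ b}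
        from h2), mul_zero]
  · rw [indicator_of_notMem (fun h => h1 h.1), indicator_of_notMem (show p.1 ∉ Iic ((n : ℝ) - L)
      from h1), zero_mul, zero_mul]

lemma ae_eventually_le_boundedPastSum (hN : IsPoissonRandomMeasure P N (jumpIntensity d lam))
    [SFinite lam] {b : ℝ} (hb : 0 ≤ b) {L : ℕ} (hL : 1 ≤ L) {k c : ℝ} (hk : 0 ≤ k)
    (hkb : ∫⁻ z in {z | |z| ≤ b}, ENNReal.ofReal |z| ∂lam = ENNReal.ofReal k) (hck : c < k) :
    ∀ᵐ ω ∂P, ∀ᶠ n : ℕ in atTop, ENNReal.ofReal (c * n) ≤ boundedPastSum (N ω) b L n := by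
  set δ := k - c with hδ
  have hδ0 : 0 < δ := sub_pos.2 hck
  -- This gives `θ b k ≤ δ`, so the quadratic correction in the Chernoff bound costs at most half of
  -- the gain `θ δ n`; the `+ 1` prevents division by zero.
  set θ := δ / (b * k + 1) with hθ
  have hθ0 : 0 < θ := by positivity
  have hL' : (1 : ℝ) ≤ L := by exact_mod_cast hL
  have hθb : θ * b * k ≤ δ := by
    rw [hθ, div_mul_eq_mul_div, div_mul_eq_mul_div, div_le_iff₀ (by positivity)]
    nlinarith
  have hbad : ∀ᶠ n : ℕ in atTop,
      P {ω | boundedPastSum (N ω) b L n < ENNReal.ofReal (c * n)}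
      ≤ ENNReal.ofReal (Real.exp (θ * L * k)) *
        ENNReal.ofReal (Real.exp (-(θ * δ / 2) * (n : ℝ) ^ (1 : ℝ))) := by
    filter_upwards [eventually_ge_atTop L] with n hn
    have hn' : (L : ℝ) ≤ n := by exact_mod_cast hn
    have hm := measurableSet_boundedPast (d := d) b ((n : ℝ) - L)
    have hmh := (measurable_jumpHeat (d := d) (n : ℝ)).indicator hm
    have hint : ∫⁻ p, {p : ℝ × Space d × ℝ | p.1 ≤ (n : ℝ) - L ∧ |p.2.2| ≤ b}.indicator
        (jumpHeat (n : ℝ)) p ∂(jumpIntensity d lam) = ENNReal.ofReal (((n : ℝ) - L) * k) := by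
      rw [lintegral_indicator hm]
      have := lintegral_boundedPast (d := d) (lam := lam) b hL n
      rw [boundedPastSum, hkb] at this
      rw [this, ENNReal.ofReal_mul (by linarith)]
    have hch := hN.measure_lintegral_lt_le hmh (x := c * n) hb (fun p => ?_)
      (by rw [hint]; exact ENNReal.ofReal_lt_top) hθ0.le
    · simp only [lintegral_indicator hm] at hch hint
      rw [hint, ENNReal.toReal_ofReal (mul_nonneg (by linarith) hk)] at hch
      refine hch.trans ?_
      rw [← ENNReal.ofReal_mul (Real.exp_pos _).le, ← Real.exp_add]
      apply ENNReal.ofReal_le_ofReal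
      apply Real.exp_le_exp.2
      rw [Real.rpow_one]
      have h1 : θ * (θ * b * k) * ((n : ℝ) - L) ≤ θ * δ * n := by
        have : (n : ℝ) - L ≤ n := by linarith
        have h2 : 0 ≤ (n : ℝ) - L := by linarith
        gcongr
      have h3 : c = k - δ := by rw [hδ]; ring
      rw [h3]
      nlinarith
    · by_cases hp : p ∈ {p : ℝ × Space d × ℝ | p.1 ≤ (n : ℝ) - L ∧ |p.2.2| ≤ b}
      · rw [indicator_of_mem hp, jumpHeat]
        apply ENNReal.ofReal_le_ofReal
        have hp1 : p.1 ≤ (n : ℝ) - L := hp.1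
        have h1 := heatKernel_le_one (d := d) (show 1 ≤ (n : ℝ) - p.1 by linarith) p.2.1
        calc _ ≤ 1 * |p.2.2| := by gcongr
          _ ≤ b := by rw [one_mul]; exact hp.2
      · rw [indicator_of_notMem hp]
        exact zero_le
  have hsum : ∑' n : ℕ, (ENNReal.ofReal (Real.exp (θ * L * k)) *
      ENNReal.ofReal (Real.exp (-(θ * δ / 2) * ((n + 0 : ℕ) : ℝ) ^ (1 : ℝ)))) < ⊤ := by
    rw [ENNReal.tsum_mul_left]
    exact ENNReal.mul_lt_top ENNReal.ofReal_lt_top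
      (tsum_ofReal_exp_lt_top one_pos (by positivity))
  have hBC := ae_eventually_notMem_of_eventually_le (k := 0)
    (a := fun n : ℕ => ENNReal.ofReal (Real.exp (θ * L * k)) *
      ENNReal.ofReal (Real.exp (-(θ * δ / 2) * (n : ℝ) ^ (1 : ℝ)))) hbad hsum
  filter_upwards [hBC] with ω hω
  filter_upwards [hω] with n hn
  exact not_lt.1 hn

/-- An age of at least `L` at time `n` grows by a factor of at most `(L+1)/L` up to time `t`. The
loss disappears as `L` grows, unlike the fixed factor used for the upper bound. -/
lemma boundedPastSum_le (M : Measure (ℝ × Space d × ℝ)) (b : ℝ) {L n : ℕ} (hL : 1 ≤ L) {t : ℝ}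
    (h1 : n ≤ t) (h2 : t ≤ n + 1) :
    ENNReal.ofReal (((L : ℝ) / (L + 1)) ^ ((d : ℝ) / 2)) * boundedPastSum M b L n
      ≤ ∫⁻ p, jumpHeat t p ∂M := by
  have hm := measurableSet_boundedPast (d := d) b ((n : ℝ) - L)
  have hL' : (1 : ℝ) ≤ L := by exact_mod_cast hL
  rw [boundedPastSum, ← lintegral_const_mul _ (measurable_jumpHeat _)]
  refine (setLIntegral_mono' hm fun p hp => ?_).trans (setLIntegral_le_lintegral _ _)
  have hp1 : p.1 ≤ (n : ℝ) - L := hp.1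
  rw [jumpHeat, jumpHeat, ← ENNReal.ofReal_mul (by positivity), ← mul_assoc]
  apply ENNReal.ofReal_le_ofReal
  gcongr
  have hs : 0 < (n : ℝ) - p.1 := by linarith
  have ht : 0 < t - p.1 := by linarith
  have h3 := rpow_mul_heatKernel_mono hs (show (n : ℝ) - p.1 ≤ t - p.1 by linarith) p.2.1
  have h6 : 0 < (t - p.1) ^ ((d : ℝ) / 2) := by positivity
  refine le_of_mul_le_mul_left (le_trans ?_ h3) h6
  rw [← mul_assoc, ← Real.mul_rpow ht.le (by positivity)]
  have h7 : (t - p.1) * ((L : ℝ) / (L + 1)) ≤ n - p.1 := by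
    rw [mul_div_assoc', div_le_iff₀ (by positivity)]
    nlinarith
  gcongr
  exact heatKernel_nonneg _ _

lemma exists_truncation {κ c : ℝ}
    (hκ : ∫⁻ z, ENNReal.ofReal |z| ∂lam = ENNReal.ofReal κ) (hc : c < κ) (hc0 : 0 ≤ c) :
    ∃ b k : ℝ, 0 ≤ b ∧ c < k ∧
      ∫⁻ z in {z | |z| ≤ b}, ENNReal.ofReal |z| ∂lam = ENNReal.ofReal k := by
  have hm : ∀ n : ℕ, MeasurableSet {z : ℝ | |z| ≤ n} := fun n =>
    measurableSet_le (by fun_prop) measurable_const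
  have hU : ⋃ n : ℕ, {z : ℝ | |z| ≤ n} = univ := by
    refine eq_univ_of_forall fun z => mem_iUnion.2 ?_
    exact exists_nat_ge |z|
  have hmono : Monotone fun n : ℕ => {z : ℝ | |z| ≤ n} := fun m n hmn z hz =>
    le_trans (show |z| ≤ m from hz) (by exact_mod_cast hmn)
  have hsup := setLIntegral_iUnion_of_directed (μ := lam) (fun z : ℝ => ENNReal.ofReal |z|)
    hmono.directed_le
  rw [hU, setLIntegral_univ, hκ] at hsup
  have hlt : ENNReal.ofReal c < ENNReal.ofReal κ :=
    (ENNReal.ofReal_lt_ofReal_iff (hc0.trans_lt hc)).2 hc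
  rw [hsup, lt_iSup_iff] at hlt
  obtain ⟨n, hn⟩ := hlt
  have hfin : ∫⁻ z in {z : ℝ | |z| ≤ n}, ENNReal.ofReal |z| ∂lam < ⊤ :=
    (setLIntegral_le_lintegral _ _).trans_lt (by rw [hκ]; exact ENNReal.ofReal_lt_top)
  refine ⟨n, (∫⁻ z in {z : ℝ | |z| ≤ n}, ENNReal.ofReal |z| ∂lam).toReal, by positivity, ?_,
    (ENNReal.ofReal_toReal hfin.ne).symm⟩
  rwa [ENNReal.ofReal_lt_iff_lt_toReal hc0 hfin.ne] at hn

lemma exists_ratio_lt (d : ℕ) {r : ℝ} (hr : r < 1) :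
    ∃ L : ℕ, 1 ≤ L ∧ r < ((L : ℝ) / (L + 1)) ^ ((d : ℝ) / 2) := by
  have h1 : Tendsto (fun L : ℕ => ((L : ℝ) / (L + 1)) ^ ((d : ℝ) / 2)) atTop (𝓝 1) := by
    have h2 : Tendsto (fun L : ℕ => (L : ℝ) / (L + 1)) atTop (𝓝 1) :=
      tendsto_natCast_div_add_atTop (1 : ℝ)
    have h3 := h2.rpow_const (p := (d : ℝ) / 2) (Or.inr (by positivity))
    rwa [Real.one_rpow] at h3
  obtain ⟨L, hL1, hL2⟩ := ((eventually_ge_atTop 1).and (h1.eventually (lt_mem_nhds hr))).exists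
  exact ⟨L, hL1, hL2⟩

/-- The sum of the absolute contributions of all jumps is asymptotically at least `κ t`. -/
lemma ae_eventually_le_lintegral_jumpHeat
    (hN : IsPoissonRandomMeasure P N (jumpIntensity d lam)) [SFinite lam] {κ c : ℝ}
    (hκ : ∫⁻ z, ENNReal.ofReal |z| ∂lam = ENNReal.ofReal κ) (hc : c < κ) :
    ∀ᵐ ω ∂P, ∀ᶠ t : ℝ in atTop, ENNReal.ofReal (c * t) ≤ ∫⁻ p, jumpHeat t p ∂(N ω) := by
  rcases lt_or_ge c 0 with hc0 | hc0
  · refine ae_of_all _ fun ω => ?_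
    filter_upwards [eventually_ge_atTop 0] with t ht
    rw [ENNReal.ofReal_of_nonpos (mul_nonpos_of_nonpos_of_nonneg hc0.le ht)]
    exact zero_le
  -- The three gaps in `c < c₁ < c₂ < κ` pay for replacing `⌊t⌋` by `t`, for the interpolation
  -- between integers and for the truncation of the jump sizes.
  · set c₁ := c + (κ - c) / 4 with hc₁
    set c₂ := c + (κ - c) / 2 with hc₂
    have h01 : c < c₁ := by rw [hc₁]; linarith
    have h12 : c₁ < c₂ := by rw [hc₁, hc₂]; linarith
    have h2 : c₂ < κ := by rw [hc₂]; linarith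
    have hc₂0 : 0 < c₂ := by linarith
    obtain ⟨b, k, hb, hck, hkb⟩ := exists_truncation hκ h2 hc₂0.le
    obtain ⟨L, hL, hr⟩ := exists_ratio_lt d (show c₁ / c₂ < 1 from (div_lt_one hc₂0).2 h12)
    filter_upwards [ae_eventually_le_boundedPastSum hN hb hL (hc₂0.le.trans hck.le) hkb hck]
      with ω hω
    filter_upwards [tendsto_nat_floor_atTop.eventually hω,
      eventually_ge_atTop (max 0 (c₁ / (c₁ - c)))] with t ht1 ht2
    have ht0 : 0 ≤ t := (le_max_left _ _).trans ht2
    refine le_trans ?_ (boundedPastSum_le (N ω) b hL (Nat.floor_le ht0)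
      (Nat.lt_floor_add_one t).le)
    refine le_trans ?_ (mul_le_mul_right ht1 _)
    rw [← ENNReal.ofReal_mul (by positivity)]
    apply ENNReal.ofReal_le_ofReal
    have h4 : c₁ ≤ t * (c₁ - c) := by
      have := (le_max_right _ _).trans ht2
      rwa [div_le_iff₀ (sub_pos.2 h01)] at this
    have h5 : t - 1 ≤ (⌊t⌋₊ : ℝ) := by linarith [Nat.lt_floor_add_one t]
    calc c * t ≤ c₁ * (t - 1) := by linarith
      _ ≤ c₁ * ⌊t⌋₊ := by gcongr
      _ = c₁ / c₂ * (c₂ * ⌊t⌋₊) := by field_simp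
      _ ≤ _ := by gcongr

/-- Along a random sequence of times, the sum of the absolute contributions of all jumps is
asymptotically at most `κ t`. -/
lemma ae_frequently_lintegral_jumpHeat_le
    (hN : IsPoissonRandomMeasure P N (jumpIntensity d lam)) [SFinite lam] {κ : ℝ} (hκ0 : 0 ≤ κ)
    (hκ : ∫⁻ z, ENNReal.ofReal |z| ∂lam = ENNReal.ofReal κ) :
    ∀ᵐ ω ∂P, ∀ c : ℝ, κ < c →
      ∃ᶠ n : ℕ in atTop, ∫⁻ p, jumpHeat ((n : ℝ) + 1) p ∂(N ω) ≤ ENNReal.ofReal (c * (n + 1)) := by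
  let W : ℕ → Ω → ℝ≥0∞ := fun n ω =>
    (∫⁻ p, jumpHeat ((n : ℝ) + 1) p ∂(N ω)) / ENNReal.ofReal ((n : ℝ) + 1)
  have hpos : ∀ n : ℕ, ENNReal.ofReal ((n : ℝ) + 1) ≠ 0 := fun n => by
    rw [Ne, ENNReal.ofReal_eq_zero, not_le]
    positivity
  have hW : ∀ n, Measurable (W n) := fun n =>
    (hN.measurable_lintegral (measurable_jumpHeat _)).div_const _
  have hEW : ∀ n, ∫⁻ ω, W n ω ∂P = ENNReal.ofReal κ := by
    intro n
    simp only [W, ENNReal.div_eq_inv_mul]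
    rw [lintegral_const_mul _ (hN.measurable_lintegral (measurable_jumpHeat _)),
      hN.lintegral_lintegral (measurable_jumpHeat _), lintegral_jumpHeat, hκ, ← mul_assoc,
      ENNReal.inv_mul_cancel (hpos n) ENNReal.ofReal_ne_top, one_mul]
  -- Every `W n` has mean `κ`, so the lower limit has mean at most `κ`. Being almost surely at least
  -- `κ`, it equals `κ`; no second moment is needed.
  have hfatou : ∫⁻ ω, liminf (fun n => W n ω) atTop ∂P ≤ ENNReal.ofReal κ := by
    refine (lintegral_liminf_le hW).trans ?_
    simp_rw [hEW]
    simp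
  have hlow : ∀ᵐ ω ∂P, ENNReal.ofReal κ ≤ liminf (fun n => W n ω) atTop := by
    have h1 : ∀ᵐ ω ∂P, ∀ k : ℕ, ∀ᶠ t : ℝ in atTop,
        ENNReal.ofReal ((κ - 1 / ((k : ℝ) + 1)) * t) ≤ ∫⁻ p, jumpHeat t p ∂(N ω) := by
      rw [ae_all_iff]
      intro k
      exact ae_eventually_le_lintegral_jumpHeat hN hκ (sub_lt_self _ (by positivity))
    filter_upwards [h1] with ω hω
    have h2 : ∀ k : ℕ, ENNReal.ofReal (κ - 1 / ((k : ℝ) + 1)) ≤ liminf (fun n => W n ω) atTop := by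
      intro k
      refine le_liminf_of_le (by isBoundedDefault) ?_
      have htend : Tendsto (fun n : ℕ => (n : ℝ) + 1) atTop atTop :=
        tendsto_atTop_add_const_right _ _ tendsto_natCast_atTop_atTop
      filter_upwards [htend.eventually (hω k)] with n hn
      rw [ENNReal.le_div_iff_mul_le (Or.inl (hpos n)) (Or.inl ENNReal.ofReal_ne_top),
        ← ENNReal.ofReal_mul' (by positivity)]
      exact hn
    have h3 : Tendsto (fun k : ℕ => ENNReal.ofReal (κ - 1 / ((k : ℝ) + 1))) atTop
        (𝓝 (ENNReal.ofReal κ)) := by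
      refine ENNReal.tendsto_ofReal ?_
      have := (tendsto_const_nhds (x := κ)).sub tendsto_one_div_add_atTop_nhds_zero_nat
      rwa [sub_zero] at this
    exact le_of_tendsto' h3 h2
  have heq := ae_eq_of_ae_le_of_lintegral_le hlow (by simp)
    (Measurable.liminf hW).aemeasurable (by simpa using hfatou)
  filter_upwards [heq] with ω hω c hc
  have hlt : liminf (fun n => W n ω) atTop < ENNReal.ofReal c := by
    rw [← hω]
    exact (ENNReal.ofReal_lt_ofReal_iff (hκ0.trans_lt hc)).2 hc
  refine (frequently_lt_of_liminf_lt (by isBoundedDefault) hlt).mono fun n hn => ?_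
  have h1 := hn.le
  rw [ENNReal.div_le_iff (hpos n) ENNReal.ofReal_ne_top, ← ENNReal.ofReal_mul' (by positivity)]
    at h1
  exact h1

/-- Without positive jumps, the law of large numbers holds for the upper limit. -/
lemma ae_limsup_mildSolution_div_eq (hN : IsPoissonRandomMeasure P N (jumpIntensity d lam))
    (hd : 1 ≤ d) (m : ℝ) (hlam : IsLevyMeasure lam)
    (hκ : ∫⁻ z, ENNReal.ofReal |z| ∂lam < ⊤)
    (hlog : IntegrableOn (fun z : ℝ => |z * Real.log z|) (Icc (-1) 1) lam)
    (hneg : lam (Ioi 0) = 0) :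
    ∀ᵐ ω ∂P, limsup (fun t : ℝ => ((mildSolution m lam (N ω) t 0 / t : ℝ) : EReal)) atTop
      = (m : EReal) := by
  have := hlam.sigmaFinite
  set κ : ℝ := (∫⁻ z, ENNReal.ofReal |z| ∂lam).toReal with hκr
  have hκ0 : 0 ≤ κ := ENNReal.toReal_nonneg
  have hκe : ∫⁻ z, ENNReal.ofReal |z| ∂lam = ENNReal.ofReal κ :=
    (ENNReal.ofReal_toReal hκ.ne).symm
  have hdrift : noiseDrift m lam = m + κ := by
    have hz : ∀ᵐ z ∂lam, z ≤ 0 := by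
      rw [ae_iff]
      simpa [Ioi] using hneg
    have h1 : ∫ z, z ∂lam = -∫ z, |z| ∂lam := by
      rw [← integral_neg]
      refine integral_congr_ae ?_
      filter_upwards [hz] with z hz
      rw [abs_of_nonpos hz, neg_neg]
    rw [noiseDrift, h1, integral_eq_lintegral_of_nonneg_ae (ae_of_all _ fun z => abs_nonneg z)
      (by fun_prop), sub_neg_eq_add]
  have hposm : MeasurableSet {p : ℝ × Space d × ℝ | 0 < p.2.2} :=
    measurableSet_lt measurable_const (by fun_prop)
  have hNneg : ∀ᵐ ω ∂P, ∀ᵐ p ∂(N ω), p.2.2 ≤ 0 := by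
    have h0 : jumpIntensity d lam {p | 0 < p.2.2} = 0 := by
      have hset : {p : ℝ × Space d × ℝ | 0 < p.2.2} = univ ×ˢ (univ ×ˢ Ioi 0) := by
        ext p
        simp
      rw [hset, jumpIntensity, Measure.prod_prod, Measure.prod_prod, hneg, mul_zero, mul_zero]
    filter_upwards [hN.ae_eq_zero hposm h0] with ω hω
    rw [ae_iff]
    simpa using hω
  have hlow : ∀ᵐ ω ∂P, ∀ k : ℕ, ∀ᶠ t : ℝ in atTop,
      ENNReal.ofReal ((κ - 1 / ((k : ℝ) + 1)) * t) ≤ ∫⁻ p, jumpHeat t p ∂(N ω) := by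
    rw [ae_all_iff]
    intro k
    exact ae_eventually_le_lintegral_jumpHeat hN hκe (sub_lt_self _ (by positivity))
  filter_upwards [hNneg, hlow, ae_frequently_lintegral_jumpHeat_le hN hκ0 hκe,
    ae_forall_lintegral_jumpHeat_lt_top hN hd hlam hκ hlog] with ω h1 h2 h3 h4
  have hY : ∀ t : ℝ, 0 ≤ t → mildSolution m lam (N ω) t 0
      = (m + κ) * t - (∫⁻ p, jumpHeat t p ∂(N ω)).toReal := by
    intro t ht
    rw [mildSolution_eq ht, hdrift, sub_eq_add_neg]
    congr 1
    have h5 : ∫ p, mildKernel t 0 (p.1, p.2.1) * p.2.2 ∂(N ω)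
        = -∫ p, |mildKernel t 0 (p.1, p.2.1) * p.2.2| ∂(N ω) := by
      rw [← integral_neg]
      refine integral_congr_ae ?_
      filter_upwards [h1] with p hp
      rw [abs_of_nonpos (mul_nonpos_of_nonneg_of_nonpos (mildKernel_nonneg t _) hp), neg_neg]
    rw [h5, integral_eq_lintegral_of_nonneg_ae (ae_of_all _ fun p => abs_nonneg _)
      (measurable_mildKernel_mul t).norm.aestronglyMeasurable]
    simp only [← jumpHeat_eq_ofReal_abs]
  -- A lower bound on the sum of jumps at all late times bounds the upper limit from above; an upper
  -- bound along integers bounds it from below.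
  apply le_antisymm
  · rw [← EReal.le_of_forall_lt_iff_le]
    intro a ha
    have ha' : m < a := by exact_mod_cast ha
    obtain ⟨k, hk⟩ := exists_nat_one_div_lt (sub_pos.2 ha')
    refine limsup_le_of_le (by isBoundedDefault) ?_
    filter_upwards [h2 k, eventually_gt_atTop 0] with t ht ht0
    have h6 := (ENNReal.ofReal_le_iff_le_toReal (h4 t ht0.le).ne).1 ht
    rw [EReal.coe_le_coe_iff, div_le_iff₀ ht0, hY t ht0.le]
    have := mul_lt_mul_of_pos_right hk ht0
    nlinarith
  · rw [← EReal.ge_of_forall_gt_iff_ge]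
    intro a ha
    have ha' : a < m := by exact_mod_cast ha
    have hfr := h3 (κ + (m - a)) (by linarith)
    refine le_limsup_of_frequently_le ?_ (by isBoundedDefault)
    have htend : Tendsto (fun n : ℕ => (n : ℝ) + 1) atTop atTop :=
      tendsto_atTop_add_const_right _ _ tendsto_natCast_atTop_atTop
    refine htend.frequently (hfr.mono fun n hn => ?_)
    have hn0 : (0 : ℝ) < n + 1 := by positivity
    have h6 := ENNReal.toReal_le_of_le_ofReal
      (mul_nonneg (by linarith) hn0.le) hn
    rw [EReal.coe_le_coe_iff, le_div_iff₀ hn0, hY _ hn0.le]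
    nlinarith

end LawOfLargeNumbers


/-! ### Large peaks when `1/f` is not integrable -/

section Peaks

variable {Ω : Type*} [MeasurableSpace Ω] {P : Measure Ω} [IsProbabilityMeasure P]
  {d : ℕ} {lam : Measure ℝ} {N : Ω → Measure (ℝ × Space d × ℝ)}

/-- The total contribution at time `t` of the negative jumps. -/
noncomputable def negJumpHeat (t : ℝ) (p : ℝ × Space d × ℝ) : ℝ≥0∞ :=
  ENNReal.ofReal (-(mildKernel t 0 (p.1, p.2.1) * p.2.2))

lemma measurable_negJumpHeat (t : ℝ) : Measurable (negJumpHeat (d := d) t) :=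
  (measurable_mildKernel_mul t).neg.ennreal_ofReal

lemma negJumpHeat_le_jumpHeat (t : ℝ) (p : ℝ × Space d × ℝ) : negJumpHeat t p ≤ jumpHeat t p := by
  rw [jumpHeat_eq_ofReal_abs, negJumpHeat]
  exact ENNReal.ofReal_le_ofReal (neg_le_abs _)

lemma negJumpHeat_of_nonneg (t : ℝ) {p : ℝ × Space d × ℝ} (hp : 0 ≤ p.2.2) :
    negJumpHeat t p = 0 := by
  rw [negJumpHeat, ENNReal.ofReal_eq_zero, neg_nonpos]
  exact mul_nonneg (mildKernel_nonneg _ _) hp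

/-- Markov's inequality: the mean is at most `κ t`, so the resulting bound does not depend on `t`.
-/
lemma le_measure_negJumpHeat_le (hN : IsPoissonRandomMeasure P N (jumpIntensity d lam))
    [SFinite lam] {C t : ℝ} (hC : 0 < C) (ht : 0 < t) :
    1 - (∫⁻ z, ENNReal.ofReal |z| ∂lam) / ENNReal.ofReal C
      ≤ P {ω | ∫⁻ p, negJumpHeat t p ∂(N ω) ≤ ENNReal.ofReal (C * t)} := by
  set κ := ∫⁻ z, ENNReal.ofReal |z| ∂lam with hκ
  have hm := hN.measurable_lintegral (measurable_negJumpHeat (d := d) t)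
  have hset : {ω | ∫⁻ p, negJumpHeat t p ∂(N ω) ≤ ENNReal.ofReal (C * t)}
      = {ω | ENNReal.ofReal (C * t) < ∫⁻ p, negJumpHeat t p ∂(N ω)}ᶜ := by
    ext ω
    simp
  rw [hset, prob_compl_eq_one_sub (measurableSet_lt measurable_const hm)]
  apply tsub_le_tsub_left
  have hCt : ENNReal.ofReal (C * t) ≠ 0 := by
    rw [Ne, ENNReal.ofReal_eq_zero, not_le]
    positivity
  have ht' : ENNReal.ofReal t ≠ 0 := by
    rw [Ne, ENNReal.ofReal_eq_zero, not_le]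
    exact ht
  calc P {ω | ENNReal.ofReal (C * t) < ∫⁻ p, negJumpHeat t p ∂(N ω)}
      ≤ P {ω | ENNReal.ofReal (C * t) ≤ ∫⁻ p, negJumpHeat t p ∂(N ω)} :=
        measure_mono fun ω hω => le_of_lt (show ENNReal.ofReal (C * t) < _ from hω)
    _ ≤ (∫⁻ ω, ∫⁻ p, negJumpHeat t p ∂(N ω) ∂P) / ENNReal.ofReal (C * t) :=
        meas_ge_le_lintegral_div hm.aemeasurable hCt ENNReal.ofReal_ne_top
    _ ≤ (ENNReal.ofReal t * κ) / ENNReal.ofReal (C * t) := by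
        rw [hN.lintegral_lintegral (measurable_negJumpHeat t), hκ,
          ← lintegral_jumpHeat (d := d) t]
        gcongr
        exact negJumpHeat_le_jumpHeat t _
    _ = κ / ENNReal.ofReal C := by
        rw [mul_comm C t, ENNReal.ofReal_mul ht.le]
        exact ENNReal.mul_div_mul_left _ _ ht' ENNReal.ofReal_ne_top

/-- Rounding `q^(1/d) ≥ 1` up at most doubles it. An integer `M` lets slices of length `M⁻²` fill a
unit of time exactly. -/
lemma exists_nat_pow_between (hd : 1 ≤ d) {q : ℝ} (hq : 1 ≤ q) :
    ∃ M : ℕ, 1 ≤ M ∧ q ≤ (M : ℝ) ^ d ∧ (M : ℝ) ^ d ≤ 2 ^ d * q := by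
  have hd0 : d ≠ 0 := by omega
  have hr : 1 ≤ q ^ ((d : ℝ)⁻¹) := Real.one_le_rpow hq (by positivity)
  have hrq : (q ^ ((d : ℝ)⁻¹)) ^ d = q := Real.rpow_inv_natCast_pow (by linarith) hd0
  refine ⟨⌈q ^ ((d : ℝ)⁻¹)⌉₊, Nat.one_le_ceil_iff.2 (by linarith), ?_, ?_⟩
  · calc q = (q ^ ((d : ℝ)⁻¹)) ^ d := hrq.symm
      _ ≤ _ := by
          gcongr
          exact Nat.le_ceil _
  · calc _ ≤ (2 * q ^ ((d : ℝ)⁻¹)) ^ d := by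
          gcongr
          have := (Nat.ceil_lt_add_one (show 0 ≤ q ^ ((d : ℝ)⁻¹) by linarith)).le
          linarith
      _ = _ := by rw [mul_pow, hrq]

lemma exists_measure_Ioi_pos (h : 0 < lam (Ioi 0)) : ∃ δ : ℝ, 0 < δ ∧ 0 < lam (Ioi δ) := by
  by_contra! hcon
  have hU : Ioi (0 : ℝ) = ⋃ n : ℕ, Ioi (1 / ((n : ℝ) + 1)) := by
    ext x
    simp only [mem_Ioi, mem_iUnion]
    refine ⟨fun hx => exists_nat_one_div_lt hx, fun ⟨n, hn⟩ => lt_trans (by positivity) hn⟩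
  rw [hU] at h
  refine h.ne' (measure_iUnion_null fun n => ?_)
  exact le_antisymm (hcon _ (by positivity)) zero_le

/-- The peaks of the solution exceed `J * max (f t) t` at some time `t ≥ J` with probability
close to one. -/
lemma exists_peak_event (hN : IsPoissonRandomMeasure P N (jumpIntensity d lam)) (hd : 1 ≤ d)
    (m : ℝ) (hlam : IsLevyMeasure lam) (hκ : ∫⁻ z, ENNReal.ofReal |z| ∂lam < ⊤)
    (hlog : IntegrableOn (fun z : ℝ => |z * Real.log z|) (Icc (-1) 1) lam) {F : ℝ → ℝ}
    (hFmono : MonotoneOn F (Ioi 0)) (hFt : ∀ t, 0 < t → t ≤ F t)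
    (hint : (∫⁻ t in Ioi (1 : ℝ), ENNReal.ofReal (1 / F t)) = ⊤) (hpos : 0 < lam (Ioi 0))
    {J : ℕ} (hJ : 1 ≤ J) :
    ∃ G : Set Ω, MeasurableSet G ∧
      1 - (∫⁻ z, ENNReal.ofReal |z| ∂lam) / ENNReal.ofReal J ≤ P G ∧
      ∀ᵐ ω ∂P, ω ∈ G → ∃ t : ℝ, J ≤ t ∧ J * F t ≤ mildSolution m lam (N ω) t 0 := by
  have := hlam.sigmaFinite
  have hFpos : ∀ t, 0 < t → 0 < F t := fun t ht => ht.trans_le (hFt t ht)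
  obtain ⟨δ, hδ, hlamδ⟩ := exists_measure_Ioi_pos hpos
  have hJ' : (1 : ℝ) ≤ J := by exact_mod_cast hJ
  set D := |noiseDrift m lam| with hD
  set c₀ : ℝ := (8 * Real.pi) ^ (-(d : ℝ) / 2) * Real.exp (-(1 / 4)) with hc₀
  have hc₀0 : 0 < c₀ := by positivity
  -- A peak of height `(2J + D) F t` is wanted: `J F t` is the goal, another `J F t` absorbs the
  -- negative jumps and `D F t` the drift. The `+ 1` gives `K ≥ 1`.
  set K : ℝ := (2 * J + D) / (c₀ * δ) + 1 with hK
  have hD0 : 0 ≤ D := abs_nonneg _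
  have hK1 : 1 ≤ K := by
    rw [hK, le_add_iff_nonneg_left]
    positivity
  have hKc : 2 * J + D ≤ c₀ * δ * K := by
    rw [hK, mul_add, mul_div_cancel₀ _ (by positivity)]
    have : 0 ≤ c₀ * δ * 1 := by positivity
    linarith
  -- `n + J + 2` bounds the observation times of all nonempty cells of the slab starting at `n + J`.
  have hq : ∀ n : ℕ, 1 ≤ K * F ((n : ℝ) + (J + 2 : ℕ)) := fun n => by
    have h1 := hFt ((n : ℝ) + (J + 2 : ℕ)) (by positivity)
    have h2 : (1 : ℝ) ≤ (n : ℝ) + (J + 2 : ℕ) := by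
      push_cast
      have : (0 : ℝ) ≤ n := by positivity
      linarith
    nlinarith
  choose M hM1 hMq hMq2 using fun n => exists_nat_pow_between hd (hq n)
  have hM0 : ∀ n, (0 : ℝ) < M n := fun n => by exact_mod_cast hM1 n
  let a : ℕ → ℝ := fun n => (n : ℝ) + J
  have ha0 : ∀ n, 0 < a n := fun n => by
    have : (0 : ℝ) ≤ n := by positivity
    simp only [a]
    linarith
  let R : ℕ → Set (Space d × ℝ) := fun n => Metric.ball (0 : Space d) (1 / M n) ×ˢ Ioi δ
  let S : ℕ → Set (ℝ × Space d × ℝ) := fun n => Ioc (a n) (a n + 1) ×ˢ R n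
  let I : ℕ → ℕ → Set ℝ := fun n k => Ioc (a n + k / (M n : ℝ) ^ 2) (a n + (k + 1) / (M n : ℝ) ^ 2)
  -- Unpairing `i` gives the slab and the slice. Intersecting with the slab leaves slices beyond the
  -- unit of time empty.
  let A : ℕ → Set (ℝ × Space d × ℝ) := fun i =>
    (Ioc (a i.unpair.1) (a i.unpair.1 + 1) ∩ I i.unpair.1 i.unpair.2) ×ˢ R i.unpair.1
  -- Jumps of the slice have age between `M⁻²` and `2 M⁻²` at this time, where the kernel is of
  -- order `M^d`. As `τ i` is deterministic, independence of the negative jumps from the cells can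
  -- be used.
  let τ : ℕ → ℝ := fun i => a i.unpair.1 + (i.unpair.2 + 2) / (M i.unpair.1 : ℝ) ^ 2
  have hRm : ∀ n, MeasurableSet (R n) := fun n => measurableSet_ball.prod measurableSet_Ioi
  have hSm : ∀ n, MeasurableSet (S n) := fun n => measurableSet_Ioc.prod (hRm n)
  have hAm : ∀ i, MeasurableSet (A i) := fun i =>
    (measurableSet_Ioc.inter measurableSet_Ioc).prod (hRm _)
  have hIoc : ∀ (m n : ℕ) (x : ℝ), x ∈ Ioc (a m) (a m + 1) → x ∈ Ioc (a n) (a n + 1) → m = n := by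
    rintro m n x ⟨h1, h2⟩ ⟨h3, h4⟩
    simp only [a] at h1 h2 h3 h4
    have h5 : (m : ℝ) < n + 1 := by linarith
    have h6 : (n : ℝ) < m + 1 := by linarith
    norm_cast at h5 h6
    omega
  have hAd : Pairwise fun i j => Disjoint (A i) (A j) := by
    intro i j hij
    rw [Set.disjoint_left]
    rintro p ⟨⟨h1, h2⟩, -⟩ ⟨⟨h3, h4⟩, -⟩
    have hn := hIoc _ _ _ h1 h3
    apply hij
    rw [← Nat.pair_unpair i, ← Nat.pair_unpair j, ← hn]
    rw [← hn] at h4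
    congr 1
    have hMp : (0 : ℝ) < (M i.unpair.1 : ℝ) ^ 2 := pow_pos (hM0 _) 2
    have h5 : (i.unpair.2 : ℝ) / (M i.unpair.1 : ℝ) ^ 2
        < (j.unpair.2 + 1) / (M i.unpair.1 : ℝ) ^ 2 := by linarith [h2.1, h4.2]
    have h6 : (j.unpair.2 : ℝ) / (M i.unpair.1 : ℝ) ^ 2
        < (i.unpair.2 + 1) / (M i.unpair.1 : ℝ) ^ 2 := by linarith [h2.2, h4.1]
    rw [div_lt_div_iff_of_pos_right hMp] at h5 h6
    norm_cast at h5 h6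
    omega
  have hSA : ∀ n, S n ⊆ ⋃ i, A i := by
    rintro n p ⟨h1, h2⟩
    have hMp : (0 : ℝ) < (M n : ℝ) ^ 2 := pow_pos (hM0 _) 2
    have h3 : 0 < (p.1 - a n) * (M n : ℝ) ^ 2 := mul_pos (sub_pos.2 h1.1) hMp
    obtain ⟨k, hk⟩ : ∃ k, ⌈(p.1 - a n) * (M n : ℝ) ^ 2⌉₊ = k + 1 :=
      Nat.exists_eq_succ_of_ne_zero (Nat.ceil_pos.2 h3).ne'
    refine mem_iUnion.2 ⟨Nat.pair n k, ?_⟩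
    simp only [A, Nat.unpair_pair]
    refine ⟨⟨h1, ?_, ?_⟩, h2⟩
    · have := Nat.lt_ceil.1 (show k < ⌈(p.1 - a n) * (M n : ℝ) ^ 2⌉₊ by omega)
      rw [← div_lt_iff₀ hMp] at this
      linarith
    · have := Nat.ceil_le.1 hk.le
      push_cast at this
      rw [← le_div_iff₀ hMp] at this
      linarith
  have hSd : Pairwise (Function.onFun Disjoint S) := by
    intro m n hmn
    rw [Function.onFun, Set.disjoint_left]
    rintro p ⟨h1, -⟩ ⟨h2, -⟩
    exact hmn (hIoc _ _ _ h1 h2)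
  have hw0 : volume (Metric.ball (0 : Space d) 1) ≠ 0 :=
    (Metric.measure_ball_pos volume 0 one_pos).ne'
  -- A slab has intensity proportional to `M⁻ᵈ`, hence at least of order `1/F (n + J + 2)`, and
  -- these add up to infinity.
  have htop : jumpIntensity d lam (⋃ i, A i) = ⊤ := by
    rw [← top_le_iff]
    have hS : ∀ n : ℕ, volume (Metric.ball (0 : Space d) 1) * lam (Ioi δ) *
        ENNReal.ofReal (1 / (2 ^ d * K)) * ENNReal.ofReal (1 / F ((n : ℝ) + (J + 2 : ℕ)))
        ≤ jumpIntensity d lam (S n) := by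
      intro n
      have hF := hFpos ((n : ℝ) + (J + 2 : ℕ)) (by positivity)
      have h1 : ((volume : Measure ℝ).restrict (Ioi 0)) (Ioc (a n) (a n + 1)) = 1 := by
        rw [Measure.restrict_apply measurableSet_Ioc, inter_eq_left.2, Real.volume_Ioc]
        · simp
        · exact fun x hx => (ha0 n).trans hx.1
      have h2 : volume (Metric.ball (0 : Space d) (1 / M n))
          = ENNReal.ofReal ((1 / (M n : ℝ)) ^ d) * volume (Metric.ball (0 : Space d) 1) := by
        have h0 : (0 : ℝ) < 1 / M n := one_div_pos.2 (hM0 n)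
        rw [Measure.addHaar_ball_of_pos _ _ h0, finrank_euclideanSpace, Fintype.card_fin]
      rw [jumpIntensity, Measure.prod_prod, Measure.prod_prod, h1, h2, one_mul, mul_assoc,
        ← ENNReal.ofReal_mul (by positivity), mul_comm (_ * _) (ENNReal.ofReal _), ← mul_assoc]
      gcongr
      rw [one_div_pow, one_div_mul_one_div]
      apply one_div_le_one_div_of_le (pow_pos (hM0 n) d)
      calc _ ≤ _ := hMq2 n
        _ = _ := by ring
    calc (⊤ : ℝ≥0∞) = ∑' n : ℕ, volume (Metric.ball (0 : Space d) 1) * lam (Ioi δ) *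
          ENNReal.ofReal (1 / (2 ^ d * K)) * ENNReal.ofReal (1 / F ((n : ℝ) + (J + 2 : ℕ))) := by
          rw [ENNReal.tsum_mul_left, tsum_one_div_eq_top hFpos hFmono hint (by omega),
            ENNReal.mul_top]
          refine mul_ne_zero (mul_ne_zero hw0 hlamδ.ne') ?_
          rw [Ne, ENNReal.ofReal_eq_zero, not_le]
          positivity
      _ ≤ ∑' n, jumpIntensity d lam (S n) := ENNReal.tsum_le_tsum hS
      _ = jumpIntensity d lam (⋃ n, S n) := (measure_iUnion hSd hSm).symm
      _ ≤ _ := measure_mono (iUnion_subset hSA)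
  have hτ0 : ∀ i, 0 < τ i := fun i => by
    have := ha0 i.unpair.1
    simp only [τ]
    positivity
  refine ⟨⋃ i, {ω | N ω (A i) ≠ 0} ∩ {ω | ∫⁻ p, negJumpHeat (τ i) p ∂(N ω)
    ≤ ENNReal.ofReal (J * τ i)}, ?_, ?_, ?_⟩
  · refine MeasurableSet.iUnion fun i => MeasurableSet.inter ?_ ?_
    · exact (hN.measurable_apply (hAm i)) (measurableSet_singleton 0).compl
    · exact measurableSet_le (hN.measurable_lintegral (measurable_negJumpHeat _)) measurable_const
  · refine hN.le_measure_iUnion_hit hAm hAd htop (fun i => measurable_negJumpHeat (τ i)) ?_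
      (fun i => le_measure_negJumpHeat_le hN (by linarith) (hτ0 i))
    rintro j i p ⟨-, -, h2⟩
    exact negJumpHeat_of_nonneg _ (hδ.le.trans (le_of_lt h2))
  · have hone : ∀ᵐ ω ∂P, ∀ i, N ω (A i) ≠ 0 → 1 ≤ N ω (A i) := by
      rw [ae_all_iff]
      exact fun i => hN.ae_one_le_of_ne_zero (hAm i)
    filter_upwards [hone, ae_forall_lintegral_jumpHeat_lt_top hN hd hlam hκ hlog] with ω h1 h2 hω
    obtain ⟨i, hi1, hi2⟩ := mem_iUnion.1 hω
    have hi2' : ∫⁻ p, negJumpHeat (τ i) p ∂(N ω) ≤ ENNReal.ofReal (J * τ i) := hi2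
    set n := i.unpair.1 with hn
    set k := i.unpair.2 with hk
    set t := τ i with ht
    have ht0 : 0 < t := hτ0 i
    have hMp : (0 : ℝ) < (M n : ℝ) ^ 2 := pow_pos (hM0 _) 2
    have hte : t = a n + (k + 2) / (M n : ℝ) ^ 2 := rfl
    have hne : (A i).Nonempty := by
      by_contra h
      rw [not_nonempty_iff_eq_empty] at h
      exact hi1 (by rw [h, measure_empty])
    -- A nonempty cell has `k < M²`, so `(k + 2)/M² ≤ 1 + 1/M² ≤ 2`.
    have hta : t ≤ (n : ℝ) + (J + 2 : ℕ) := by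
      obtain ⟨p, ⟨h3, h4⟩, -⟩ := hne
      have h5 : (k : ℝ) / (M n : ℝ) ^ 2 < 1 := by linarith [h3.2, h4.1]
      rw [div_lt_one hMp] at h5
      have h6 : k + 1 ≤ M n ^ 2 := by
        have : k < M n ^ 2 := by exact_mod_cast h5
        omega
      have h7 : ((k : ℝ) + 1) ≤ (M n : ℝ) ^ 2 := by exact_mod_cast h6
      have h8 : (1 : ℝ) ≤ (M n : ℝ) ^ 2 := one_le_pow₀ (by exact_mod_cast hM1 n)
      have h9 : ((k : ℝ) + 2) / (M n : ℝ) ^ 2 ≤ 2 := by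
        rw [div_le_iff₀ hMp]
        linarith
      rw [hte]
      simp only [a]
      push_cast
      linarith
    have htJ : (J : ℝ) ≤ t := by
      have h3 : (0 : ℝ) ≤ ((k : ℝ) + 2) / (M n : ℝ) ^ 2 := by positivity
      have h4 : (0 : ℝ) ≤ n := by positivity
      rw [hte]
      simp only [a]
      linarith
    have hFle : F t ≤ F ((n : ℝ) + (J + 2 : ℕ)) := hFmono ht0 (ht0.trans_le hta) hta
    refine ⟨t, htJ, ?_⟩
    have hpeak : ENNReal.ofReal ((2 * J + D) * F t)
        ≤ ∫⁻ p, ENNReal.ofReal (mildKernel t 0 (p.1, p.2.1) * p.2.2) ∂(N ω) := by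
      calc ENNReal.ofReal ((2 * J + D) * F t)
          ≤ ENNReal.ofReal ((2 * J + D) * F t) * N ω (A i) := le_mul_of_one_le_right zero_le (h1 i hi1)
        _ = ∫⁻ _ in A i, ENNReal.ofReal ((2 * J + D) * F t) ∂(N ω) := by
            rw [setLIntegral_const]
        _ ≤ ∫⁻ p in A i, ENNReal.ofReal (mildKernel t 0 (p.1, p.2.1) * p.2.2) ∂(N ω) := by
            refine setLIntegral_mono' (hAm i) fun p hp => ?_
            obtain ⟨⟨-, h4⟩, h5, h6⟩ := hp
            apply ENNReal.ofReal_le_ofReal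
            have h6' : δ < p.2.2 := h6
            have h5' : ‖p.2.1‖ < 1 / (M n : ℝ) := by simpa using h5
            have h7 : ‖p.2.1‖ ^ 2 ≤ 1 / (M n : ℝ) ^ 2 := by
              rw [← one_div_pow]
              gcongr
            have h8 : 1 / (M n : ℝ) ^ 2 ≤ t - p.1 := by
              have := h4.2
              rw [hte]
              have h9 : ((k : ℝ) + 2) / (M n : ℝ) ^ 2
                  = (k + 1) / (M n : ℝ) ^ 2 + 1 / (M n : ℝ) ^ 2 := by ring
              linarith
            have h10 : t - p.1 ≤ 2 * (1 / (M n : ℝ) ^ 2) := by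
              have := h4.1
              rw [hte]
              have h9 : ((k : ℝ) + 2) / (M n : ℝ) ^ 2
                  = k / (M n : ℝ) ^ 2 + 2 * (1 / (M n : ℝ) ^ 2) := by ring
              linarith
            have hker := le_heatKernel_of_sq_le (d := d) (one_div_pos.2 hMp) h8 h10 p.2.1 h7
            have hpow : (1 / (M n : ℝ) ^ 2) ^ (-(d : ℝ) / 2) = (M n : ℝ) ^ d := by
              rw [one_div, Real.inv_rpow hMp.le, ← Real.rpow_neg hMp.le, ← Real.rpow_natCast _ 2,
                ← Real.rpow_mul (hM0 n).le, ← Real.rpow_natCast _ d]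
              congr 1
              push_cast
              ring
            rw [hpow, ← hc₀] at hker
            rw [mildKernel_zero]
            have hFpos' := hFpos t ht0
            calc (2 * J + D) * F t ≤ c₀ * δ * K * F ((n : ℝ) + (J + 2 : ℕ)) := by gcongr
              _ = c₀ * (K * F ((n : ℝ) + (J + 2 : ℕ))) * δ := by ring
              _ ≤ c₀ * (M n : ℝ) ^ d * p.2.2 := by
                  have := hMq n
                  gcongr
              _ ≤ _ := by
                  gcongr
                  exact hδ.le.trans h6'.le
        _ ≤ _ := setLIntegral_le_lintegral _ _
    have hintg := integrable_mildKernel_mul (h2 t ht0.le)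
    rw [mildSolution_eq ht0.le, integral_eq_lintegral_pos_part_sub_lintegral_neg_part hintg]
    have hfin : ∫⁻ p, ENNReal.ofReal (mildKernel t 0 (p.1, p.2.1) * p.2.2) ∂(N ω) < ⊤ := by
      refine (lintegral_mono fun p => ?_).trans_lt (h2 t ht0.le)
      rw [jumpHeat_eq_ofReal_abs]
      exact ENNReal.ofReal_le_ofReal (le_abs_self _)
    have h3 := (ENNReal.ofReal_le_iff_le_toReal hfin.ne).1 hpeak
    have h4 : (∫⁻ p, ENNReal.ofReal (-(mildKernel t 0 (p.1, p.2.1) * p.2.2)) ∂(N ω)).toReal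
        ≤ J * t := ENNReal.toReal_le_of_le_ofReal (by positivity) hi2'
    have h5 : -(D * t) ≤ noiseDrift m lam * t := by
      rw [← neg_mul]
      gcongr
      exact neg_abs_le _
    have h6 := hFt t ht0
    -- `(2J + D) F t - J t - D t ≥ J F t`, because `t ≤ F t`.
    nlinarith

/-- The solution has peaks larger than `f` if there are positive jumps and `1 / f` is not
integrable. -/
lemma ae_limsup_mildSolution_div_eq_top
    (hN : IsPoissonRandomMeasure P N (jumpIntensity d lam)) (hd : 1 ≤ d)
    (m : ℝ) (hlam : IsLevyMeasure lam) (hκ : ∫⁻ z, ENNReal.ofReal |z| ∂lam < ⊤)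
    (hlog : IntegrableOn (fun z : ℝ => |z * Real.log z|) (Icc (-1) 1) lam) {f : ℝ → ℝ}
    (hfpos : ∀ t, 0 < t → 0 < f t) (hfmono : MonotoneOn f (Ioi 0))
    (hint : (∫⁻ t in Ioi (1 : ℝ), ENNReal.ofReal (1 / f t)) = ⊤) (hpos : 0 < lam (Ioi 0)) :
    ∀ᵐ ω ∂P, limsup (fun t : ℝ => ((mildSolution m lam (N ω) t 0 / f t : ℝ) : EReal)) atTop
      = ⊤ := by
  have hFmono : MonotoneOn (fun t => max (f t) t) (Ioi 0) := fun s hs t ht hst =>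
    max_le_max (hfmono hs ht hst) hst
  choose G hGm hGp hG using fun J : ℕ => exists_peak_event hN hd m hlam hκ hlog hFmono
    (fun t _ => le_max_right (f t) t) (lintegral_one_div_max_eq_top hfpos hfmono hint) hpos
    (J := J + 1) (by omega)
  -- No independence between different `J` is needed: the union contains events of probability
  -- arbitrarily close to one.
  have hio : ∀ᵐ ω ∂P, ∀ j : ℕ, ω ∈ ⋃ i, G (i + j) := by
    rw [ae_all_iff]
    intro j
    have hm : MeasurableSet (⋃ i, G (i + j)) := MeasurableSet.iUnion fun i => hGm _
    refine (mem_ae_iff_prob_eq_one hm).2 (le_antisymm prob_le_one ?_)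
    have hlim : Tendsto (fun i : ℕ => 1 - (∫⁻ z, ENNReal.ofReal |z| ∂lam) /
        ENNReal.ofReal ((i + j + 1 : ℕ) : ℝ)) atTop (𝓝 (1 - 0)) := by
      refine ENNReal.Tendsto.sub tendsto_const_nhds ?_ (Or.inl ENNReal.one_ne_top)
      have h1 : Tendsto (fun i : ℕ => ENNReal.ofReal ((i + j + 1 : ℕ) : ℝ)) atTop (𝓝 ⊤) := by
        refine ENNReal.tendsto_ofReal_atTop.comp (tendsto_natCast_atTop_atTop.comp ?_)
        exact tendsto_atTop_mono (fun i => show i ≤ i + j + 1 by omega) tendsto_id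
      have h2 := ENNReal.Tendsto.const_div h1 (a := ∫⁻ z, ENNReal.ofReal |z| ∂lam)
        (Or.inr hκ.ne)
      simpa using h2
    rw [tsub_zero] at hlim
    exact le_of_tendsto' hlim fun i => (hGp (i + j)).trans
      (measure_mono (subset_iUnion (fun i => G (i + j)) i))
  filter_upwards [hio, ae_all_iff.2 hG] with ω h1 h2
  rw [← top_le_iff, ← EReal.ge_of_forall_gt_iff_ge]
  intro c _
  refine le_limsup_of_frequently_le ?_ (by isBoundedDefault)
  rw [frequently_atTop]
  intro T
  obtain ⟨j, hj⟩ := exists_nat_ge (max T c)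
  obtain ⟨i, hi⟩ := mem_iUnion.1 (h1 j)
  obtain ⟨t, ht1, ht2⟩ := h2 _ hi
  push_cast at ht1 ht2
  have hi0 : (0 : ℝ) ≤ i := by positivity
  have hj0 : (0 : ℝ) ≤ j := by positivity
  have hT := (le_max_left T c).trans hj
  have hc := (le_max_right T c).trans hj
  have ht0 : 0 < t := by linarith
  have hft := hfpos t ht0
  refine ⟨t, by linarith, ?_⟩
  rw [EReal.coe_le_coe_iff, le_div_iff₀ hft]
  calc c * f t ≤ ((i : ℝ) + j + 1) * f t := by
        gcongr
        linarith
    _ ≤ ((i : ℝ) + j + 1) * max (f t) t := by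
        gcongr
        exact le_max_left _ _
    _ ≤ _ := ht2

end Peaks


/-! ### Reflection of the jump sizes -/

section Reflection

variable {d : ℕ} {lam : Measure ℝ}

/-- The reflection `(s,y,z) ↦ (s,y,-z)`. -/
noncomputable def reflectJumps (d : ℕ) : (ℝ × Space d × ℝ) ≃ᵐ (ℝ × Space d × ℝ) :=
  (MeasurableEquiv.refl ℝ).prodCongr
    ((MeasurableEquiv.refl (Space d)).prodCongr (MeasurableEquiv.neg ℝ))

lemma reflectJumps_apply (p : ℝ × Space d × ℝ) : reflectJumps d p = (p.1, p.2.1, -p.2.2) := rfl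

lemma jumpIntensity_map_neg [SFinite lam] :
    jumpIntensity d (lam.map (MeasurableEquiv.neg ℝ))
      = (jumpIntensity d lam).map (reflectJumps d) := by
  have h1 : ((volume : Measure (Space d)).prod lam).map
      (Prod.map id (MeasurableEquiv.neg ℝ)) = (volume : Measure (Space d)).prod
        (lam.map (MeasurableEquiv.neg ℝ)) := by
    rw [← Measure.map_prod_map _ _ measurable_id (MeasurableEquiv.neg ℝ).measurable,
      Measure.map_id]
  rw [jumpIntensity, ← h1]
  conv_lhs => rw [← Measure.map_id (μ := (volume : Measure ℝ).restrict (Ioi 0))]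
  rw [Measure.map_prod_map _ _ measurable_id
    (measurable_id.prodMap (MeasurableEquiv.neg ℝ).measurable)]
  rfl

lemma IsLevyMeasure.map_neg (hlam : IsLevyMeasure lam) :
    IsLevyMeasure (lam.map (MeasurableEquiv.neg ℝ)) where
  zero_singleton := by
    rw [MeasurableEquiv.map_apply]
    have : (MeasurableEquiv.neg ℝ) ⁻¹' {0} = {0} := by
      ext z
      simp [MeasurableEquiv.neg]
    rw [this, hlam.zero_singleton]
  lintegral_min_lt_top := by
    rw [lintegral_map_equiv]
    simpa [MeasurableEquiv.neg] using hlam.lintegral_min_lt_top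

lemma mildSolution_map_neg (m : ℝ) (M : Measure (ℝ × Space d × ℝ)) (t : ℝ) :
    mildSolution (-m) (lam.map (MeasurableEquiv.neg ℝ)) (M.map (reflectJumps d)) t 0
      = -mildSolution m lam M t 0 := by
  have h1 : noiseDrift (-m) (lam.map (MeasurableEquiv.neg ℝ)) = -noiseDrift m lam := by
    rw [noiseDrift, noiseDrift, integral_map_equiv]
    have : ∫ z, (MeasurableEquiv.neg ℝ) z ∂lam = -∫ z, z ∂lam := integral_neg _
    rw [this]
    ring
  rw [mildSolution, mildSolution, noiseIntegral, noiseIntegral, h1, integral_map_equiv]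
  simp only [reflectJumps_apply, mul_neg, integral_neg]
  ring

lemma integrable_rpow_map_neg
    (hmoment : ∃ ε : ℝ, 0 < ε ∧ Integrable (fun z : ℝ => |z| ^ (1 + ε)) lam) :
    ∃ ε : ℝ, 0 < ε ∧
      Integrable (fun z : ℝ => |z| ^ (1 + ε)) (lam.map (MeasurableEquiv.neg ℝ)) := by
  obtain ⟨ε, hε, hm⟩ := hmoment
  refine ⟨ε, hε, (integrable_map_equiv (MeasurableEquiv.neg ℝ) _).2 ?_⟩
  simpa [Function.comp_def, MeasurableEquiv.neg] using hm

lemma integrableOn_mul_log_map_neg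
    (hlog : IntegrableOn (fun z : ℝ => |z * Real.log z|) (Icc (-1) 1) lam) :
    IntegrableOn (fun z : ℝ => |z * Real.log z|) (Icc (-1) 1)
      (lam.map (MeasurableEquiv.neg ℝ)) := by
  rw [MeasurableEmbedding.integrableOn_map_iff (MeasurableEquiv.neg ℝ).measurableEmbedding]
  have h1 : (MeasurableEquiv.neg ℝ) ⁻¹' (Icc (-1) 1) = Icc (-1) 1 := by
    ext z
    simp only [MeasurableEquiv.neg, mem_preimage, MeasurableEquiv.coe_mk,
      Equiv.neg_apply, mem_Icc]
    constructor <;> rintro ⟨h1, h2⟩ <;> constructor <;> linarith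
  rw [h1]
  simpa [Function.comp_def, MeasurableEquiv.neg] using hlog

lemma map_neg_Ioi : lam.map (MeasurableEquiv.neg ℝ) (Ioi 0) = lam (Iio 0) := by
  rw [MeasurableEquiv.map_apply]
  congr 1
  ext z
  simp [MeasurableEquiv.neg]

lemma liminf_eq_neg_limsup_neg (u : ℝ → ℝ) :
    liminf (fun t => ((u t : ℝ) : EReal)) atTop
      = -limsup (fun t => ((-u t : ℝ) : EReal)) atTop := by
  rw [← EReal.liminf_neg]
  congr 1
  funext t
  simp

end Reflection


/-! ### Assembly of the theorem -/

theorem mainTheorem1 {Ω : Type*} [MeasurableSpace Ω] (P : Measure Ω) [IsProbabilityMeasure P]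
    (d : ℕ) (hd : 1 ≤ d) (m : ℝ) (lam : Measure ℝ) (hlam : IsLevyMeasure lam)
    (hmoment : ∃ ε : ℝ, 0 < ε ∧ Integrable (fun z : ℝ => |z| ^ (1 + ε)) lam)
    (hlog : IntegrableOn (fun z : ℝ => |z * Real.log z|) (Icc (-1) 1) lam)
    (N : Ω → Measure (ℝ × Space d × ℝ))
    (hN : IsPoissonRandomMeasure P N (jumpIntensity d lam))
    (f : ℝ → ℝ) (hfpos : ∀ t, 0 < t → 0 < f t) (hfmono : MonotoneOn f (Ioi 0)) :
    -- the integral that defines `Y(t,0)` converges absolutely for all `t`, almost surely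
    (∀ᵐ ω ∂P, ∀ t : ℝ, 0 < t → NoiseIntegrable (N ω) (mildKernel t (0 : Space d))) ∧
    -- (1)
    ((∫⁻ t in Ioi (1 : ℝ), ENNReal.ofReal (1 / f t)) = ⊤ →
      (0 < lam (Ioi 0) → ∀ᵐ ω ∂P,
        limsup (fun t : ℝ => ((mildSolution m lam (N ω) t 0 / f t : ℝ) : EReal)) atTop = ⊤) ∧
      (0 < lam (Iio 0) → ∀ᵐ ω ∂P,
        liminf (fun t : ℝ => ((mildSolution m lam (N ω) t 0 / f t : ℝ) : EReal)) atTop = ⊥)) ∧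
    -- (2)
    ((∫⁻ t in Ioi (1 : ℝ), ENNReal.ofReal (1 / f t)) < ⊤ →
      ∀ᵐ ω ∂P, Tendsto (fun t : ℝ => mildSolution m lam (N ω) t 0 / f t) atTop (𝓝 0)) ∧
    -- (3)
    (lam (Ioi 0) = 0 → ∀ᵐ ω ∂P,
      limsup (fun t : ℝ => ((mildSolution m lam (N ω) t 0 / t : ℝ) : EReal)) atTop = (m : EReal)) ∧
    (lam (Iio 0) = 0 → ∀ᵐ ω ∂P,
      liminf (fun t : ℝ => ((mildSolution m lam (N ω) t 0 / t : ℝ) : EReal)) atTop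
        = (m : EReal)) := by
  have hσ := hlam.sigmaFinite
  have hκ := hlam.lintegral_abs_lt_top hmoment hlog
  have hlam' := hlam.map_neg
  have hlog' := integrableOn_mul_log_map_neg hlog
  have hκ' := hlam'.lintegral_abs_lt_top (integrable_rpow_map_neg hmoment) hlog'
  -- The reflected measure drives `-Y`, with mean `-m` and the reflected Lévy measure, so the lower
  -- limits of `Y` are upper limits for it.
  have hN' := hN.map_equiv (reflectJumps d)
  rw [← jumpIntensity_map_neg] at hN'
  refine ⟨?_, fun hint => ⟨fun hpos => ?_, fun hpos => ?_⟩, fun hint => ?_, fun h0 => ?_,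
    fun h0 => ?_⟩
  · filter_upwards [ae_forall_lintegral_jumpHeat_lt_top hN hd hlam hκ hlog] with ω hω t ht
    exact ⟨integrable_mildKernel t, integrable_mildKernel_mul (hω t ht.le)⟩
  · exact ae_limsup_mildSolution_div_eq_top hN hd m hlam hκ hlog hfpos hfmono hint hpos
  · rw [← map_neg_Ioi] at hpos
    filter_upwards [ae_limsup_mildSolution_div_eq_top hN' hd (-m) hlam' hκ' hlog' hfpos hfmono
      hint hpos] with ω hω
    simp only [mildSolution_map_neg, neg_div] at hω
    rw [liminf_eq_neg_limsup_neg, hω, EReal.neg_top]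
  · exact ae_tendsto_mildSolution_div hN hd m hlam hmoment hlog hfpos hfmono hint
  · exact ae_limsup_mildSolution_div_eq hN hd m hlam hκ hlog h0
  · rw [← map_neg_Ioi] at h0
    filter_upwards [ae_limsup_mildSolution_div_eq hN' hd (-m) hlam' hκ' hlog' h0] with ω hω
    simp only [mildSolution_map_neg, neg_div] at hω
    rw [liminf_eq_neg_limsup_neg, hω, EReal.coe_neg, neg_neg]
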